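/- **Setting.** Let $k\ge 1$, $N,m\ge 0$ be integers and let $f_q(x)=x^{\vec\alpha_{1,q}}+\dots+x^{\vec\alpha_{\tau_q,q}}$ $(1\le q\le k)$ with $\vec\alpha_{r,q}\in(\mathbf Z_{\ge 0})^N$. Choose $m$ different monomials among all the $(r,q)$ and multiply the $j$-th chosen one by a new variable $s'_j$; denote the result by $f_q(x,s')$. Let $I$ be the set of the monomials of the phase function $F=\sum_q y_q\,(f_q(x,s')+s_q)$, so $|I|=\sum_q(\tau_q+1)$, and let $T_a$ $(a\in I)$ be these monomials. Let ${\sf L}$ be the integer matrix, with rows indexed by $I$ and columns by the variables $x_1,\dots,x_N,s'_1,\dots,s'_m,s_1,\dots,s_k,y_1,\dots,y_k$, for which $\log T={\sf L}\cdot\log(x,s',s,y)$. Assume that $\sf L$ is a square matrix (that is, $\sum_q(\tau_q+1)=N+m+2k$) with $\det{\sf L}\ne0$ (the system is then called a simplicial complete intersection). *Fibre integral.* For ${\bf i}\in\mathbf Z^N$, $\zeta\in\mathbf C^k$, $$I(s,s')=\int_\gamma\prod_{q=1}^k(f_q(x,s')+s_q)^{-\zeta_q-1}\,x^{{\bf i}+{\bf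 1}}\frac{dx}{x^{\bf 1}},$$ where $\gamma$ is a compact smooth $N$-cycle in $(\mathbf C^\times)^N\setminus\bigcup_q\{f_q(x,s')+s_q=0\}$ with coefficients in the local system of the branches of $\prod_q(f_q(x,s')+s_q)^{-\zeta_q-1}$. This is a germ of a holomorphic function of $(s,s')\in(\mathbf C^\times)^{k+m}$; a determination of the fibre integral on a connected open set, in logarithmic coordinates of $(s,s')$, is any analytic continuation of such a germ to this set. *Mellin transform.* For ${\bf z}\in\mathbf C^k$, ${\bf z}'\in\mathbf C^m$, $$M^\zeta_{{\bf i},\gamma}({\bf z},{\bf z}')=\int_\Pi s^{\bf z}s'^{{\bf z}'}I(s,s')\,\frac{ds}{s^{\bf 1}}\wedge\frac{ds'}{s'^{\bf 1}},$$ where $\Pi$ is a compact smooth $(k+m)$-cycle, in the part of $(\mathbf C^\times)^{k+m}$ over which the fibre integral is regular, for the multivalued integrand: a finite combination of smooth cubes, each carrying a branch of $s^{\bf z}s'^{{\bf z}'}$ and a determination of $I$ on a connected neighbourhood (in logarithmic coordinates), whose coefficients are rational functions of the $e^{2\pi\sqrt{-1}z_\ell}$, $e^{2\pi\sqrt{-1}z'_j}$,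 and whose boundary vanishes in the local system of these branches for all $({\bf z},{\bf z}')$ at which the coefficients are finite. **Proposition 2.1.** There are a unique integer $\Delta>0$ and a unique integer matrix ${\sf T}$ with $\Delta^{-1}{\sf T}={\sf L}^{-1}$ such that the entries of $\sf T$ have greatest common divisor $1$. Write the column of $\sf T$ with index $a\in I$ as $(A_1^a,\dots,A_N^a,C_1^a,\dots,C_m^a,B_1^a,\dots,B_k^a,D_1^a,\dots,D_k^a)$ and put $$\mathcal L_a({\bf i},{\bf z},{\bf z}',\zeta)=\frac{\sum_{j=1}^NA_j^a(i_j+1)+\sum_{j=1}^mC_j^az'_j+\sum_{\ell=1}^k\left(B_\ell^az_\ell+D_\ell^a(\zeta_\ell+1)\right)}{\Delta}.$$ 1) For all ${\bf i}$, $\zeta$ and every cycle $\Pi$ as above (with its determinations of the fibre integral) there is a rational function $h$ of $k+m$ variables such that, with the $\Delta$-periodic function $g({\bf z},{\bf z}')=h(e^{2\pi\sqrt{-1}z_1/\Delta},\dots,e^{2\pi\sqrt{-1}z_k/\Delta},e^{2\pi\sqrt{-1}z'_1/\Delta},\dots,e^{2\pi\sqrt{-1}z'_m/\Delta})$, $$M^\zeta_{{\bf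 i},\gamma}({\bf z},{\bf z}')=g({\bf z},{\bf z}')\prod_{a\in I}\Gamma\bigl(\mathcal L_a({\bf i},{\bf z},{\bf z}',\zeta)\bigr)$$ at all $({\bf z},{\bf z}')$ for which no $\mathcal L_a({\bf i},{\bf z},{\bf z}',\zeta)$ is a non-positive integer and the denominator of $h$ (in a suitable representation of $h$ as a quotient of polynomials) does not vanish. Moreover, for every $a\in I$, one of the following holds: a) for some $\ell$ one has $\mathcal L_a({\bf i},{\bf z},{\bf z}',\zeta)=z_\ell$, i.e. $B_\ell^a=\Delta$ and all the other entries of the column vanish; b) $\displaystyle\mathcal L_a({\bf i},{\bf z},{\bf z}',\zeta)=\frac{\sum_{j=1}^NA_j^a(i_j+1)+\sum_{j=1}^mC_j^az'_j+\sum_{\ell=1}^kB_\ell^a(z_\ell-\zeta_\ell-1)}{\Delta}.$ 2) $\sum_{a\in I}A_j^a=0$ $(1\le j\le N)$, $\sum_{a\in I}B_q^a=0$ $(1\le q\le k)$, $\sum_{a\in I}C_j^a=0$ $(1\le j\le m)$. 3) $\sum_{a\in I}\mathcal L_a({\bf i},{\bf z},{\bf z}',\zeta)=\zeta_1+\dots+\zeta_k+k$.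 -/

import Mathlib

open scoped ContDiff

noncomputable section

/-! ### The polynomial system and the matrix of its phase function -/

/-- The combinatorial data of a system
`f_q = ∑_r x ^ α_{r,q}` (`q = 1, …, k`, `r = 1, …, τ_q`) in `N` variables, together with the choice
of the `m` monomials (one for each new variable `x'_j = s'_j`) that are multiplied by `s'_j`. -/
structure CISystem (N k m : ℕ) where
  τ : Fin k → ℕ
  α : (q : Fin k) → Fin (τ q) → Fin N → ℕ
  mark : Fin m ↪ (Σ q : Fin k, Fin (τ q))

/-- The variables `x_1, …, x_N, s'_1, …, s'_m` and `s_1, …, s_k, y_1, …, y_k`. -/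
abbrev PhaseVar (N k m : ℕ) : Type := (Fin N ⊕ Fin m) ⊕ (Fin k ⊕ Fin k)

namespace CISystem

variable {N k m : ℕ}

/-- The index set `I` of the monomials of `F = ∑ y_q (f_q(x,s') + s_q)`:
`inl ⟨q, r⟩` is the `r`-th monomial of `y_q f_q(x,s')`, and `inr q` is `y_q s_q`. -/
abbrev Mono (S : CISystem N k m) : Type := (Σ q : Fin k, Fin (S.τ q)) ⊕ Fin k

/-- The matrix `L` of exponents: `log T = L · log (x, s', s, y)`. -/
def phaseMatrix (S : CISystem N k m) : Matrix S.Mono (PhaseVar N k m) ℤ := fun a c =>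
  match a, c with
  | .inl a, .inl (.inl j) => (S.α a.1 a.2 j : ℤ)
  | .inl a, .inl (.inr j) => if S.mark j = a then 1 else 0
  | .inl _, .inr (.inl _) => 0
  | .inl a, .inr (.inr l) => if a.1 = l then 1 else 0
  | .inr _, .inl _ => 0
  | .inr q, .inr (.inl l) => if q = l then 1 else 0
  | .inr q, .inr (.inr l) => if q = l then 1 else 0

/-- `L` is square and has non-zero determinant (for one, hence for every, numbering). -/
def Nondegenerate (S : CISystem N k m) : Prop :=
  ∃ e : S.Mono ≃ PhaseVar N k m, (S.phaseMatrix.submatrix id e).det ≠ 0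

/-- `Δ⁻¹ T = L⁻¹` with `Δ > 0` and `T` an integer matrix whose entries have g.c.d. `1`. -/
def IsScaledInverse (S : CISystem N k m) (Δ : ℤ) (T : Matrix (PhaseVar N k m) S.Mono ℤ) : Prop :=
  0 < Δ ∧ S.phaseMatrix * T = Δ • 1 ∧ T * S.phaseMatrix = Δ • 1 ∧
    (Finset.univ.gcd fun p : PhaseVar N k m × S.Mono => T p.1 p.2) = 1

/-- The linear form `𝓛_a(i, z, z', ζ)`, the product of the row vector `(i + 1, z', z, ζ + 1)` with
the `a`-th column `(A^a, C^a, B^a, D^a) / Δ` of `Δ⁻¹ T`. -/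
def linForm (S : CISystem N k m) (Δ : ℤ) (T : Matrix (PhaseVar N k m) S.Mono ℤ) (a : S.Mono)
    (i : Fin N → ℤ) (z : Fin k → ℂ) (z' : Fin m → ℂ) (ζ : Fin k → ℂ) : ℂ :=
  ((∑ j, (T (.inl (.inl j)) a : ℂ) * ((i j : ℂ) + 1)) + (∑ j, (T (.inl (.inr j)) a : ℂ) * z' j)
    + ∑ l, ((T (.inr (.inl l)) a : ℂ) * z l + (T (.inr (.inr l)) a : ℂ) * (ζ l + 1))) / (Δ : ℂ)

/-- `f_q(x, s')`. -/
def f (S : CISystem N k m) (q : Fin k) (x : Fin N → ℂ) (s' : Fin m → ℂ) : ℂ :=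
  ∑ r : Fin (S.τ q),
    (∏ j, if S.mark j = ⟨q, r⟩ then s' j else 1) * ∏ j, x j ^ S.α q r j

/-- `f_q(x, s') + s_q` as a function of `x` and of the logarithms `w` of `(s, s')`. -/
def fiberEq (S : CISystem N k m) (q : Fin k) (x : Fin N → ℂ) (w : Fin (k + m) → ℂ) : ℂ :=
  S.f q x (fun j => Complex.exp (w (Fin.natAdd k j))) + Complex.exp (w (Fin.castAdd m q))

end CISystem

/-! ### Singular cubes -/

/-- The closed unit cube. -/
def unitCube (n : ℕ) : Set (Fin n → ℝ) := Set.Icc 0 1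

/-- The face `t_j = 0` (`e = false`) or `t_j = 1` (`e = true`) of the cube, parametrized by
inserting this value at the position `j`. -/
def cubeFace {n : ℕ} (j : Fin n) (e : Bool) (u : Fin (n - 1) → ℝ) : Fin n → ℝ := fun i =>
  if h : i.1 < j.1 then u ⟨i.1, by omega⟩
  else if h' : i.1 = j.1 then (if e then 1 else 0)
  else u ⟨i.1 - 1, by omega⟩

/-- The sign of a face in the cubical boundary. -/
def faceSign {n : ℕ} (j : Fin n) (e : Bool) : ℂ := (-1) ^ (j.1 + 1 + (if e then 1 else 0))

/-- The Jacobian: the pull-back of `dx_1 ∧ … ∧ dx_n` under `c` is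
`cubeJacobian c t · dt_1 ∧ … ∧ dt_n`. -/
def cubeJacobian {n : ℕ} (c : (Fin n → ℝ) → (Fin n → ℂ)) (t : Fin n → ℝ) : ℂ :=
  (Matrix.of fun a b : Fin n => fderiv ℝ c t (Pi.single b 1) a).det

/-! ### The fibre integral -/

/-- A twisted cycle `γ` in the fibres
`(ℂ^×)^N ∖ ⋃_q {x | f_q(x, s') + s_q = 0}`, for all `(s, s') = exp w` with `w ∈ V`: a finite
combination of smooth `N`-dimensional cubes, each carrying a branch of
`∏_q (f_q(x, s') + s_q) ^ (- ζ_q - 1)` (given by continuous logarithms `lg`), with zero boundary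
in the local system of these branches. -/
structure FibreCycle {N k m : ℕ} (S : CISystem N k m) (ζ : Fin k → ℂ)
    (V : Set (Fin (k + m) → ℂ)) where
  numCells : ℕ
  coeff : Fin numCells → ℂ
  map : Fin numCells → (Fin N → ℝ) → (Fin N → ℂ)
  smooth : ∀ p, ContDiff ℝ ∞ (map p)
  ne_zero : ∀ p, ∀ t ∈ unitCube N, ∀ j, map p t j ≠ 0
  lg : Fin numCells → Fin k → (Fin (k + m) → ℂ) → (Fin N → ℝ) → ℂ
  lg_continuous : ∀ p q, ContinuousOn (fun vt : (Fin (k + m) → ℂ) × (Fin N → ℝ) => lg p q vt.1 vt.2)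
    (V ×ˢ unitCube N)
  exp_lg : ∀ p q, ∀ v ∈ V, ∀ t ∈ unitCube N,
    Complex.exp (lg p q v t) = S.fiberEq q (map p t) v
  /-- On every face, the branches carried by all the faces that coincide with it cancel. -/
  closed : ∀ v ∈ V, ∀ (p₀ : Fin numCells) (j₀ : Fin N) (e₀ : Bool), ∀ u ∈ unitCube (N - 1),
    open Classical in
    ∑ p, ∑ j, ∑ e,
      (if ∀ u' ∈ unitCube (N - 1), map p (cubeFace j e u') = map p₀ (cubeFace j₀ e₀ u') then
        faceSign j e * coeff p * Complex.exp (-∑ q, (ζ q + 1) * lg p q v (cubeFace j e u))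
      else 0) = 0

/-- The fibre integral
`I(s, s') = ∫_γ ∏_q (f_q(x, s') + s_q) ^ (- ζ_q - 1) x ^ (i + 1) dx / x ^ 1` at `(s, s') = exp v`. -/
def FibreCycle.integral {N k m : ℕ} {S : CISystem N k m} {ζ : Fin k → ℂ}
    {V : Set (Fin (k + m) → ℂ)} (γ : FibreCycle S ζ V) (i : Fin N → ℤ) (v : Fin (k + m) → ℂ) : ℂ :=
  ∑ p, γ.coeff p * ∫ t in unitCube N,
    Complex.exp (-∑ q, (ζ q + 1) * γ.lg p q v t) * (∏ j, γ.map p t j ^ i j)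
      * cubeJacobian (γ.map p) t

/-- `J` is a determination of the (multivalued) fibre integral on the connected open set `U` of
logarithms `w` of `(s, s')`: a holomorphic function obtained by analytic continuation from a
non-empty open set, on which it is the fibre integral over a twisted cycle. -/
def IsFibreIntegral {N k m : ℕ} (S : CISystem N k m) (i : Fin N → ℤ) (ζ : Fin k → ℂ)
    (U : Set (Fin (k + m) → ℂ)) (J : (Fin (k + m) → ℂ) → ℂ) : Prop :=
  IsOpen U ∧ IsPreconnected U ∧ DifferentiableOn ℂ J U ∧
    ∃ V : Set (Fin (k + m) → ℂ), V ⊆ U ∧ IsOpen V ∧ V.Nonempty ∧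
      ∃ γ : FibreCycle S ζ V, ∀ v ∈ V, J v = γ.integral i v

/-! ### The Mellin transform -/

/-- The value of the polynomial `P` at the point
`(exp (2πi z_1 / Δ), …, exp (2πi z_k / Δ), exp (2πi z'_1 / Δ), …, exp (2πi z'_m / Δ))`. -/
def expEval {k m : ℕ} (Δ : ℤ) (P : MvPolynomial (Fin (k + m)) ℂ) (z : Fin k → ℂ)
    (z' : Fin m → ℂ) : ℂ :=
  MvPolynomial.eval
    (fun c => Complex.exp (2 * (Real.pi : ℂ) * Complex.I * (Fin.append z z' c / (Δ : ℂ)))) P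

/-- `s ^ z s' ^ z'` at `(s, s') = exp w`. -/
def mellinKernel {k m : ℕ} (z : Fin k → ℂ) (z' : Fin m → ℂ) (w : Fin (k + m) → ℂ) : ℂ :=
  Complex.exp (∑ c, Fin.append z z' c * w c)

/-- A cycle `Π` for the multivalued integrand `s ^ z s' ^ z' I(s, s')` in the part of the torus
`(ℂ^×)^(k+m)` over which the fibre integral `I` is regular: a finite combination of smooth
`(k+m)`-dimensional cubes in the torus (given by their logarithms `map`), each carrying a
determination `J` of `I` near it, with zero boundary in the local system of the branches of
`s ^ z s' ^ z' I(s, s')`. The coefficients `num / den` may be rational functions of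
`exp (2πi z_1), …, exp (2πi z'_m)`. -/
structure MellinCycle {N k m : ℕ} (S : CISystem N k m) (i : Fin N → ℤ) (ζ : Fin k → ℂ) where
  numCells : ℕ
  num : Fin numCells → MvPolynomial (Fin (k + m)) ℂ
  den : Fin numCells → MvPolynomial (Fin (k + m)) ℂ
  den_ne_zero : ∀ p, den p ≠ 0
  map : Fin numCells → (Fin (k + m) → ℝ) → (Fin (k + m) → ℂ)
  smooth : ∀ p, ContDiff ℝ ∞ (map p)
  dom : Fin numCells → Set (Fin (k + m) → ℂ)
  map_mem : ∀ p, ∀ t ∈ unitCube (k + m), map p t ∈ dom p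
  J : Fin numCells → (Fin (k + m) → ℂ) → ℂ
  isFibreIntegral : ∀ p, IsFibreIntegral S i ζ (dom p) (J p)
  /-- Along every face, the germs carried by all the faces that coincide with it in the torus
  cancel; `h` is the displacement from the point of the face. -/
  closed : ∀ (z : Fin k → ℂ) (z' : Fin m → ℂ), (∀ p, expEval 1 (den p) z z' ≠ 0) →
    ∀ (p₀ : Fin numCells) (j₀ : Fin (k + m)) (e₀ : Bool), ∀ u ∈ unitCube (k + m - 1),
    ∀ᶠ h : Fin (k + m) → ℂ in nhds 0,
    open Classical in
    ∑ p, ∑ j, ∑ e,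
      (if ∀ u' ∈ unitCube (k + m - 1), ∀ c, Complex.exp (map p (cubeFace j e u') c)
          = Complex.exp (map p₀ (cubeFace j₀ e₀ u') c) then
        faceSign j e * (expEval 1 (num p) z z' / expEval 1 (den p) z z')
          * (mellinKernel z z' (map p (cubeFace j e u) + h) * J p (map p (cubeFace j e u) + h))
      else 0) = 0

/-- The Mellin transform
`M(z, z') = ∫_Π s ^ z s' ^ z' I(s, s') ds / s ^ 1 ∧ ds' / s' ^ 1`, where `ds / s = d (log s)`. -/
def MellinCycle.mellin {N k m : ℕ} {S : CISystem N k m} {i : Fin N → ℤ} {ζ : Fin k → ℂ}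
    (C : MellinCycle S i ζ) (z : Fin k → ℂ) (z' : Fin m → ℂ) : ℂ :=
  ∑ p, expEval 1 (C.num p) z z' / expEval 1 (C.den p) z z' * ∫ t in unitCube (k + m),
    mellinKernel z z' (C.map p t) * C.J p (C.map p t) * cubeJacobian (C.map p) t

end

/-! ### The scaled inverse of an integer matrix -/

/-! Inserting a monomial `T_b` of the phase function into the fibre integral (and dividing by the
`f_q + s_q` it belongs to) amounts, on the Mellin side, to multiplication by a linear form. Three
families of relations link the integral to its insertions: exact forms in the `x_j`
(`FibreCycle.euler_x`), derivatives in `log s`, `log s'` (`FibreCycle.hasDerivAt_gen`) and degree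
one in each `y_q` (`FibreCycle.gen_eq_sum_y`). Together they form a linear system whose matrix is
the transpose of `L`. Inverting it with `T` (`FibreCycle.scaled_genMono`) expresses each insertion
by a first order operator in `log s`, `log s'`. Under the Mellin transform the derivative in the
coordinate `c` becomes `-Z c` (`MellinCycle.pairing_partialDeriv`, a form of Stokes' theorem), so
inserting `∏ T_a ^ ν_a` replaces each `Γ(𝓛_a)` by `Γ(𝓛_a + ν_a)` (`MellinCycle.exists_shifted`).

By `T L = Δ`, the product of the `T_a` with exponents the row of `T` of a parameter is the `Δ`-th
power of that parameter. Inserting the positive part of this row therefore equals inserting the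
negative part and shifting the Mellin variable by `Δ`. Hence the Mellin transform times `∏ 1/Γ(𝓛_a)`
is `Δ`-periodic in every variable (`MellinCycle.pairing_periodic`).

After clearing the denominators of the coefficients this product is entire in each variable and of
exponential type on vertical strips: the Mellin integral runs over compact cubes, and `1/Γ` grows at
most like `exp (π |Im s|)` there. A periodic entire function with such growth is a Laurent
polynomial in `exp (2πi z / Δ)`. The degree bound is uniform, so interpolation turns separate
polynomiality into joint polynomiality (`StripBounded.exists_mvPolynomial`), which gives the
rational function `h`.

The alternative a), b) and the sums in 2), 3) are read off from `L T = T L = Δ`: each monomial has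
total degree one in the `y_q`, and `s_q` occurs only in `y_q s_q`. -/

theorem Matrix.exists_primitive_scaled_inverse {I J : Type*} [Fintype I] [DecidableEq I] [Fintype J]
    [DecidableEq J] [Nonempty I] (L : Matrix I J ℤ) (e : I ≃ J)
    (hdet : (L.submatrix id e).det ≠ 0) :
    ∃ (Δ : ℤ) (T : Matrix J I ℤ), 0 < Δ ∧ L * T = Δ • 1 ∧ T * L = Δ • 1 ∧
      (Finset.univ.gcd fun p : J × I => T p.1 p.2) = 1 := by
  classical
  set A := L.submatrix id e with hA
  have hL : L = A.submatrix id e.symm := by ext; simp [hA]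
  set ε : ℤ := A.det.sign with hε
  have hεd : ε * A.det = |A.det| := Int.sign_mul_self_eq_abs A.det
  -- The sign of the determinant makes the scalar positive; dividing by the gcd of the entries then
  -- makes the matrix primitive.
  set T0 : Matrix J I ℤ := (ε • A.adjugate).submatrix e.symm id with hT0
  have h1 : L * T0 = |A.det| • 1 := by
    rw [hL, hT0, Matrix.submatrix_mul_equiv, mul_smul_comm, Matrix.mul_adjugate, smul_smul, hεd]
    simp
  have h2 : T0 * L = |A.det| • 1 := by
    have : T0 * L = ((ε • A.adjugate) * A).submatrix e.symm e.symm := by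
      rw [hL, hT0]
      exact Matrix.submatrix_mul_equiv _ _ _ (Equiv.refl _) _
    rw [this, smul_mul_assoc, Matrix.adjugate_mul, smul_smul, hεd]
    exact congrArg (fun M : Matrix J J ℤ => |A.det| • M) (Matrix.submatrix_one_equiv e.symm)
  obtain ⟨a0⟩ := ‹Nonempty I›
  obtain ⟨t, ht, hgcd⟩ := Finset.extract_gcd (fun p : J × I => T0 p.1 p.2)
    (s := Finset.univ) ⟨(e a0, a0), Finset.mem_univ _⟩
  set g := Finset.univ.gcd (fun p : J × I => T0 p.1 p.2) with hg
  set T : Matrix J I ℤ := Matrix.of fun j i => t (j, i) with hT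
  have hT0T : T0 = g • T := by
    ext j i
    simpa [hT] using ht (j, i) (Finset.mem_univ _)
  have hg0 : 0 ≤ g := Int.nonneg_of_normalize_eq_self Finset.normalize_gcd
  have hpos : 0 < |A.det| := abs_pos.mpr hdet
  have hdiag : |A.det| = g * (L * T) a0 a0 := by
    have := congrFun (congrFun h1 a0) a0
    rw [hT0T, Matrix.mul_smul, Matrix.smul_apply, Matrix.smul_apply, Matrix.one_apply_eq] at this
    simpa using this.symm
  have hgne : g ≠ 0 := by
    rintro h
    rw [h] at hdiag
    simp at hdiag
    exact hdet hdiag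
  have hgpos : 0 < g := lt_of_le_of_ne hg0 hgne.symm
  -- `Δ` is `|det A| / g`, taken as a diagonal entry of `L * T` so that it is visibly an integer.
  refine ⟨(L * T) a0 a0, T, ?_, ?_, ?_, ?_⟩
  · rw [hdiag] at hpos
    exact pos_of_mul_pos_right hpos hg0
  · have h3 : g • (L * T) = g • ((L * T) a0 a0 • (1 : Matrix I I ℤ)) := by
      rw [← Matrix.mul_smul, ← hT0T, h1, smul_smul, ← hdiag]
    exact smul_right_injective _ hgne h3
  · have h3 : g • (T * L) = g • ((L * T) a0 a0 • (1 : Matrix J J ℤ)) := by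
      rw [← Matrix.smul_mul, ← hT0T, h2, smul_smul, ← hdiag]
    exact smul_right_injective _ hgne h3
  · simpa [hT] using hgcd

/-- Computing `T' L T` in two ways gives `Δ T' = Δ' T`; comparing the gcds of the entries gives `Δ =
Δ'`. -/
theorem Matrix.primitive_scaled_inverse_unique {I J : Type*} [Fintype I] [DecidableEq I] [Fintype J]
    [DecidableEq J] {L : Matrix I J ℤ} {Δ Δ' : ℤ} {T T' : Matrix J I ℤ}
    (hΔ : 0 < Δ) (hLT : L * T = Δ • 1) (hg : (Finset.univ.gcd fun p : J × I => T p.1 p.2) = 1)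
    (hΔ' : 0 < Δ') (hTL' : T' * L = Δ' • 1)
    (hg' : (Finset.univ.gcd fun p : J × I => T' p.1 p.2) = 1) : Δ' = Δ ∧ T' = T := by
  have h : Δ • T' = Δ' • T := by
    have h1 : T' * (L * T) = Δ • T' := by rw [hLT, Matrix.mul_smul, Matrix.mul_one]
    rw [← h1, ← Matrix.mul_assoc, hTL', Matrix.smul_mul, Matrix.one_mul]
  have hgcd : ∀ (d : ℤ) (M : Matrix J I ℤ), 0 < d →
      (Finset.univ.gcd fun p : J × I => M p.1 p.2) = 1 →
      (Finset.univ.gcd fun p : J × I => (d • M) p.1 p.2) = d := by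
    intro d M hd hM
    have : (fun p : J × I => (d • M) p.1 p.2) = fun p : J × I => d * M p.1 p.2 := by
      ext; simp
    rw [this, Finset.gcd_mul_left, hM, mul_one, Int.normalize_of_nonneg hd.le]
  have hd : Δ' = Δ := by
    rw [← hgcd Δ T' hΔ hg', h, hgcd Δ' T hΔ' hg]
  refine ⟨hd, ?_⟩
  rw [hd] at h
  exact smul_right_injective _ hΔ.ne' h

/-! ### Identities for the entries of `T` -/

namespace CISystem

variable {N k m : ℕ} {S : CISystem N k m} {Δ : ℤ} {T : Matrix (PhaseVar N k m) S.Mono ℤ}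

theorem exists_isScaledInverse (hk : 0 < k) (hS : S.Nondegenerate) :
    ∃ (Δ : ℤ) (T : Matrix (PhaseVar N k m) S.Mono ℤ), S.IsScaledInverse Δ T := by
  obtain ⟨e, he⟩ := hS
  have : Nonempty S.Mono := ⟨.inr ⟨0, hk⟩⟩
  exact S.phaseMatrix.exists_primitive_scaled_inverse e he

theorem IsScaledInverse.unique (h : S.IsScaledInverse Δ T) {Δ' : ℤ}
    {T' : Matrix (PhaseVar N k m) S.Mono ℤ} (h' : S.IsScaledInverse Δ' T') : Δ' = Δ ∧ T' = T :=
  Matrix.primitive_scaled_inverse_unique h.1 h.2.1 h.2.2.2 h'.1 h'.2.2.1 h'.2.2.2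

/-- The index of the polynomial to which a monomial belongs. -/
def block (S : CISystem N k m) : S.Mono → Fin k := Sum.elim Sigma.fst id

theorem phaseMatrix_y (S : CISystem N k m) (a : S.Mono) (l : Fin k) :
    S.phaseMatrix a (.inr (.inr l)) = if S.block a = l then 1 else 0 := by
  rcases a with a | q <;> rfl

theorem IsScaledInverse.mul_apply (h : S.IsScaledInverse Δ T) (a b : S.Mono) :
    ∑ c, S.phaseMatrix a c * T c b = if a = b then Δ else 0 := by
  have := congrFun (congrFun h.2.1 a) b
  rw [Matrix.mul_apply] at this
  rw [this, Matrix.smul_apply, Matrix.one_apply]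
  split_ifs <;> simp

theorem IsScaledInverse.mul_apply' (h : S.IsScaledInverse Δ T) (c d : PhaseVar N k m) :
    ∑ a, T c a * S.phaseMatrix a d = if c = d then Δ else 0 := by
  have := congrFun (congrFun h.2.2.1 c) d
  rw [Matrix.mul_apply] at this
  rw [this, Matrix.smul_apply, Matrix.one_apply]
  split_ifs <;> simp

/-- The row of `L` for `y_q s_q` has exactly two non-zero entries, both `1`, at `s_q` and `y_q`.
This gives `D = -B` in the columns of the other monomials. -/
theorem IsScaledInverse.s_add_y (h : S.IsScaledInverse Δ T) (q : Fin k) (a : S.Mono) :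
    T (.inr (.inl q)) a + T (.inr (.inr q)) a = if Sum.inr q = a then Δ else 0 := by
  rw [← h.mul_apply]
  simp [Fintype.sum_sum_type, phaseMatrix]

/-- The variable `s_q` occurs only in `y_q s_q`, so its column of `L` is a unit vector and `T L = Δ`
reads off this column of `T`. -/
theorem IsScaledInverse.column_inr (h : S.IsScaledInverse Δ T) (q : Fin k) (c : PhaseVar N k m) :
    T c (.inr q) = if c = .inr (.inl q) then Δ else 0 := by
  rw [← h.mul_apply']
  simp [Fintype.sum_sum_type, phaseMatrix]

/-- Each monomial contains exactly one `y_l`, to the first power, so the all-ones vector is the sum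
of the `y`-columns of `L`. -/
theorem IsScaledInverse.row_sum (h : S.IsScaledInverse Δ T) (c : PhaseVar N k m) :
    ∑ a, T c a = ∑ l : Fin k, if c = .inr (.inr l) then Δ else 0 := by
  simp_rw [← h.mul_apply', phaseMatrix_y]
  rw [Finset.sum_comm]
  simp

theorem IsScaledInverse.alternative (h : S.IsScaledInverse Δ T) (a : S.Mono) :
    (∃ l : Fin k, (∀ j, T (.inl (.inl j)) a = 0) ∧ (∀ j, T (.inl (.inr j)) a = 0) ∧
      (∀ l', T (.inr (.inl l')) a = if l' = l then Δ else 0) ∧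
      (∀ l', T (.inr (.inr l')) a = 0) ∧
      ∀ (i : Fin N → ℤ) (z : Fin k → ℂ) (z' : Fin m → ℂ) (ζ : Fin k → ℂ),
        S.linForm Δ T a i z z' ζ = z l) ∨
    (∀ (i : Fin N → ℤ) (z : Fin k → ℂ) (z' : Fin m → ℂ) (ζ : Fin k → ℂ),
      S.linForm Δ T a i z z' ζ =
        ((∑ j, (T (.inl (.inl j)) a : ℂ) * ((i j : ℂ) + 1))
          + (∑ j, (T (.inl (.inr j)) a : ℂ) * z' j)
          + ∑ l, (T (.inr (.inl l)) a : ℂ) * (z l - ζ l - 1)) / (Δ : ℂ)) := by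
  have hΔ : (Δ : ℂ) ≠ 0 := by exact_mod_cast h.1.ne'
  rcases a with a | l
  · right
    intro i z z' ζ
    rw [linForm]
    congr 2
    refine Finset.sum_congr rfl fun l _ => ?_
    have h1 := h.s_add_y l (.inl a)
    rw [if_neg (by simp)] at h1
    have h2 : (T (.inr (.inr l)) (.inl a) : ℂ) = -(T (.inr (.inl l)) (.inl a) : ℂ) := by
      rw [← Int.cast_neg, Int.cast_inj]; omega
    rw [h2]; ring
  · left
    have hx : ∀ j, T (.inl (.inl j)) (.inr l) = 0 := fun j => by simp [h.column_inr]
    have hs' : ∀ j, T (.inl (.inr j)) (.inr l) = 0 := fun j => by simp [h.column_inr]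
    have hs : ∀ l', T (.inr (.inl l')) (.inr l) = if l' = l then Δ else 0 :=
      fun j => by simp [h.column_inr]
    have hy : ∀ l', T (.inr (.inr l')) (.inr l) = 0 := fun j => by simp [h.column_inr]
    refine ⟨l, hx, hs', hs, hy, fun i z z' ζ => ?_⟩
    simp [linForm, hx, hs', hs, hy, hΔ]

theorem IsScaledInverse.sum_linForm (h : S.IsScaledInverse Δ T) (i : Fin N → ℤ) (z : Fin k → ℂ)
    (z' : Fin m → ℂ) (ζ : Fin k → ℂ) :
    ∑ a : S.Mono, S.linForm Δ T a i z z' ζ = (∑ l, ζ l) + (k : ℂ) := by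
  have hΔ : (Δ : ℂ) ≠ 0 := by exact_mod_cast h.1.ne'
  have hx : ∀ j, ∑ a, (T (.inl (.inl j)) a : ℂ) = 0 := fun j => by
    exact_mod_cast (h.row_sum (.inl (.inl j))).trans (by simp)
  have hs' : ∀ j, ∑ a, (T (.inl (.inr j)) a : ℂ) = 0 := fun j => by
    exact_mod_cast (h.row_sum (.inl (.inr j))).trans (by simp)
  have hs : ∀ j, ∑ a, (T (.inr (.inl j)) a : ℂ) = 0 := fun j => by
    exact_mod_cast (h.row_sum (.inr (.inl j))).trans (by simp)
  have hy : ∀ j, ∑ a, (T (.inr (.inr j)) a : ℂ) = Δ := fun j => by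
    exact_mod_cast (h.row_sum (.inr (.inr j))).trans (by simp)
  simp_rw [linForm, ← Finset.sum_div, Finset.sum_add_distrib]
  rw [Finset.sum_comm, Finset.sum_comm (γ := S.Mono) (f := fun a j => (T (.inl (.inr j)) a : ℂ) * z' j),
    Finset.sum_comm (γ := S.Mono) (f := fun a j => (T (.inr (.inl j)) a : ℂ) * z j),
    Finset.sum_comm (γ := S.Mono) (f := fun a j => (T (.inr (.inr j)) a : ℂ) * (ζ j + 1))]
  simp_rw [← Finset.sum_mul, hx, hs', hs, hy]
  simp [← Finset.mul_sum, hΔ, Finset.sum_add_distrib]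

end CISystem

open MeasureTheory Topology Metric Set

/-! ### Parametric integrals over the cube -/

theorem isCompact_unitCube (n : ℕ) : IsCompact (unitCube n) := isCompact_Icc

theorem measurableSet_unitCube (n : ℕ) : MeasurableSet (unitCube n) := measurableSet_Icc

theorem hasDerivAt_integral_unitCube {n : ℕ} {F F' : ℂ → (Fin n → ℝ) → ℂ} {s : Set ℂ} {x₀ : ℂ}
    (hs : s ∈ 𝓝 x₀) (hF : ContinuousOn (fun p : ℂ × (Fin n → ℝ) => F p.1 p.2) (s ×ˢ unitCube n))
    (hF' : ContinuousOn (fun p : ℂ × (Fin n → ℝ) => F' p.1 p.2) (s ×ˢ unitCube n))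
    (h : ∀ x ∈ s, ∀ t ∈ unitCube n, HasDerivAt (fun y => F y t) (F' x t) x) :
    HasDerivAt (fun x => ∫ t in unitCube n, F x t) (∫ t in unitCube n, F' x₀ t) x₀ := by
  obtain ⟨ε, hε, hεs⟩ := Metric.nhds_basis_closedBall.mem_iff.1 hs
  have hcF : ∀ x ∈ s, ContinuousOn (F x) (unitCube n) := fun x hx =>
    hF.comp (f := fun t => (x, t)) (by fun_prop) fun t ht => ⟨hx, ht⟩
  have hcF' : ∀ x ∈ s, ContinuousOn (F' x) (unitCube n) := fun x hx =>
    hF'.comp (f := fun t => (x, t)) (by fun_prop) fun t ht => ⟨hx, ht⟩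
  obtain ⟨M, hM⟩ := ((isCompact_closedBall x₀ ε).prod (isCompact_unitCube n)).exists_bound_of_continuousOn
    (hF'.mono (prod_mono hεs subset_rfl))
  have hx₀ : x₀ ∈ s := mem_of_mem_nhds hs
  have hfin : IsFiniteMeasure (volume.restrict (unitCube n)) :=
    ⟨by simpa using (isCompact_unitCube n).measure_lt_top⟩
  refine (hasDerivAt_integral_of_dominated_loc_of_deriv_le (μ := volume.restrict (unitCube n))
    (F := F) (F' := F') (bound := fun _ => M)
    (closedBall_mem_nhds x₀ hε) ?_ ?_ ?_ ?_ (integrable_const M) ?_).2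
  · filter_upwards [hs] with x hx
    exact (hcF x hx).aestronglyMeasurable (measurableSet_unitCube n)
  · exact (hcF x₀ hx₀).integrableOn_compact (isCompact_unitCube n)
  · exact (hcF' x₀ hx₀).aestronglyMeasurable (measurableSet_unitCube n)
  · filter_upwards [ae_restrict_mem (measurableSet_unitCube n)] with t ht x hx
    exact hM (x, t) ⟨hx, ht⟩
  · filter_upwards [ae_restrict_mem (measurableSet_unitCube n)] with t ht x hx
    exact h x (hεs hx) t ht

/-! ### Holomorphic functions of several variables -/

section Holomorphic

variable {E : Type*} [NormedAddCommGroup E] [NormedSpace ℂ E]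

/-- The one-variable Cauchy estimate on the disc `ζ ↦ w + ζ • u`. -/
theorem norm_fderiv_apply_le {f : E → ℂ} {U : Set E} (hU : IsOpen U)
    (hf : DifferentiableOn ℂ f U) {w u : E} {r M : ℝ} (hr : 0 < r)
    (hball : ∀ ζ : ℂ, ‖ζ‖ ≤ r → w + ζ • u ∈ U) (hM : ∀ ζ : ℂ, ‖ζ‖ = r → ‖f (w + ζ • u)‖ ≤ M) :
    ‖fderiv ℂ f w u‖ ≤ M / r := by
  have hd : ∀ ζ : ℂ, ‖ζ‖ ≤ r → HasDerivAt (fun ζ : ℂ => f (w + ζ • u))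
      (fderiv ℂ f (w + ζ • u) u) ζ := by
    intro ζ hζ
    have h1 := ((hf _ (hball ζ hζ)).differentiableAt (hU.mem_nhds (hball ζ hζ))).hasFDerivAt
    have h2 : HasDerivAt (fun ζ : ℂ => w + ζ • u) u ζ := by
      simpa using ((hasDerivAt_id ζ).smul_const u).const_add w
    exact h1.comp_hasDerivAt ζ h2
  have h0 := (hd 0 (by simpa using hr.le)).deriv
  simp only [zero_smul, add_zero] at h0
  rw [← h0]
  refine Complex.norm_deriv_le_of_forall_mem_sphere_norm_le hr ?_ ?_
  · refine DifferentiableOn.diffContOnCl_ball (U := closedBall 0 r) (fun ζ hζ => ?_) subset_rfl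
    exact (hd ζ (by simpa using hζ)).differentiableAt.differentiableWithinAt
  · intro ζ hζ
    exact hM ζ (by simpa using hζ)

/-- The directional derivatives of a holomorphic function of several variables are holomorphic. -/
theorem DifferentiableOn.fderiv_apply_const [FiniteDimensional ℂ E] [MeasurableSpace E]
    [BorelSpace E] {f : E → ℂ} {U : Set E} (hU : IsOpen U) (hf : DifferentiableOn ℂ f U) (v : E) :
    DifferentiableOn ℂ (fun w => fderiv ℂ f w v) U := by
  have hproper : ProperSpace E := FiniteDimensional.proper ℂ E
  have hEC : SecondCountableTopology (E →L[ℂ] ℂ) :=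
    have := FiniteDimensional.proper ℂ (E →L[ℂ] ℂ)
    inferInstance
  intro w₀ hw₀
  obtain ⟨R, hR, hRU⟩ := Metric.nhds_basis_closedBall.mem_iff.1 (hU.mem_nhds hw₀)
  obtain ⟨M, hM⟩ := (isCompact_closedBall w₀ R).exists_bound_of_continuousOn
    (hf.continuousOn.mono hRU)
  -- Circles of radius `r` in the direction `v` around points of the ball of radius `R / 4` stay
  -- within `R / 2`. This leaves room for a further Cauchy estimate of radius `R / 8` in every
  -- direction, which dominates the full derivative.
  set r : ℝ := R / (4 * (1 + ‖v‖)) with hr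
  have hv : 0 < 1 + ‖v‖ := by positivity
  have hr0 : 0 < r := by positivity
  have hrv : r * ‖v‖ ≤ R / 4 := by
    rw [hr, div_mul_eq_mul_div, div_le_div_iff₀ (by positivity) (by norm_num)]
    nlinarith [norm_nonneg v]
  have hmem : ∀ w ∈ ball w₀ (R / 4), ∀ ζ : ℂ, ‖ζ‖ ≤ r → w + ζ • v ∈ ball w₀ (R / 2 + R / 8) := by
    intro w hw ζ hζ
    rw [mem_ball, dist_eq_norm] at hw ⊢
    have h1 : ‖w + ζ • v - w₀‖ ≤ ‖w - w₀‖ + ‖ζ‖ * ‖v‖ := by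
      rw [← norm_smul, add_sub_right_comm]; exact norm_add_le _ _
    have h2 : ‖ζ‖ * ‖v‖ ≤ r * ‖v‖ := by gcongr
    linarith
  have hmemU : ∀ w ∈ ball w₀ (R / 4), ∀ ζ : ℂ, ‖ζ‖ ≤ r → w + ζ • v ∈ U := fun w hw ζ hζ =>
    hRU (ball_subset_closedBall (ball_subset_ball (by linarith) (hmem w hw ζ hζ)))
  have hop : ∀ w ∈ ball w₀ (R / 2 + R / 8), ‖fderiv ℂ f w‖ ≤ M / (R / 8) := by
    intro w hw
    have hMnn : 0 ≤ M := (norm_nonneg _).trans (hM w₀ (mem_closedBall_self hR.le))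
    refine ContinuousLinearMap.opNorm_le_of_unit_norm (𝕜 := ℂ) (by positivity) fun u hu => ?_
    have hb : ∀ ζ : ℂ, ‖ζ‖ ≤ R / 8 → w + ζ • u ∈ closedBall w₀ R := by
      intro ζ hζ
      rw [mem_ball, dist_eq_norm] at hw
      rw [mem_closedBall, dist_eq_norm]
      have h1 : ‖w + ζ • u - w₀‖ ≤ ‖w - w₀‖ + ‖ζ‖ * ‖u‖ := by
        rw [← norm_smul, add_sub_right_comm]; exact norm_add_le _ _
      rw [hu] at h1
      linarith
    exact norm_fderiv_apply_le hU hf (by positivity) (fun ζ hζ => hRU (hb ζ hζ))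
      (fun ζ hζ => hM _ (hb ζ hζ.le))
  -- Cauchy's formula writes the directional derivative as an integral of `f` itself, which can be
  -- differentiated in `w` under the integral sign.
  have hcauchy : ∀ w ∈ ball w₀ (R / 4), fderiv ℂ f w v
      = (2 * Real.pi * Complex.I : ℂ)⁻¹ * ∮ ζ in C(0, r), (ζ ^ 2)⁻¹ * f (w + ζ • v) := by
    intro w hw
    have hd : ∀ ζ : ℂ, ‖ζ‖ ≤ r → HasDerivAt (fun ζ : ℂ => f (w + ζ • v))
        (fderiv ℂ f (w + ζ • v) v) ζ := by
      intro ζ hζ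
      have h1 := ((hf _ (hmemU w hw ζ hζ)).differentiableAt
        (hU.mem_nhds (hmemU w hw ζ hζ))).hasFDerivAt
      have h2 : HasDerivAt (fun ζ : ℂ => w + ζ • v) v ζ := by
        simpa using ((hasDerivAt_id ζ).smul_const v).const_add w
      exact h1.comp_hasDerivAt ζ h2
    have h0 := (hd 0 (by simpa using hr0.le)).deriv
    simp only [zero_smul, add_zero] at h0
    rw [← h0]
    set O : Set ℂ := (fun ζ : ℂ => w + ζ • v) ⁻¹' U with hO
    have hOo : IsOpen O := hU.preimage (by fun_prop)
    have hfO : DifferentiableOn ℂ (fun ζ : ℂ => f (w + ζ • v)) O :=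
      hf.comp (by fun_prop) fun ζ hζ => hζ
    have := Complex.two_pi_I_inv_smul_circleIntegral_sub_sq_inv_smul_of_differentiable
      hOo (c := 0) (w₀ := 0) (R := r) (fun ζ hζ => hmemU w hw ζ (by simpa using hζ)) hfO
      (mem_ball_self hr0)
    rw [← this]
    simp
  set φ : ℝ → ℂ := fun θ => _root_.deriv (circleMap 0 r) θ * ((circleMap 0 r θ) ^ 2)⁻¹ with hφ
  have hφc : Continuous φ := by
    have h0 : ∀ θ, (circleMap 0 r θ) ^ 2 ≠ 0 := fun θ => by simp [circleMap, hr0.ne']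
    simp only [hφ, deriv_circleMap]
    exact ((continuous_circleMap 0 r).mul continuous_const).mul
      (((continuous_circleMap 0 r).pow 2).inv₀ h0)
  have hφn : ∀ θ, ‖φ θ‖ = r⁻¹ := fun θ => by
    simp only [hφ, deriv_circleMap, norm_mul, norm_inv, norm_pow, norm_circleMap_zero,
      Complex.norm_I, abs_of_pos hr0]
    field_simp
  have hcirc : ∀ θ, ‖circleMap 0 r θ‖ ≤ r := fun θ => by
    rw [norm_circleMap_zero, abs_of_pos hr0]
  have hline : Continuous fun p : E × ℝ => p.1 + circleMap 0 r p.2 • v := by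
    have := continuous_circleMap 0 r
    fun_prop
  have hw₀b : w₀ ∈ ball w₀ (R / 4) := mem_ball_self (by positivity)
  have hcont : ∀ w ∈ ball w₀ (R / 4), Continuous fun θ => φ θ * f (w + circleMap 0 r θ • v) := by
    intro w hw
    refine hφc.mul ?_
    refine hf.continuousOn.comp_continuous (hline.comp (Continuous.prodMk_right w)) fun θ => ?_
    exact hmemU w hw _ (hcirc θ)
  have hderiv : HasFDerivAt (fun w => ∫ θ in (0 : ℝ)..2 * Real.pi, φ θ * f (w + circleMap 0 r θ • v))
      (∫ θ in (0 : ℝ)..2 * Real.pi, φ θ • fderiv ℂ f (w₀ + circleMap 0 r θ • v)) w₀ := by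
    refine intervalIntegral.hasFDerivAt_integral_of_dominated_of_fderiv_le (𝕜 := ℂ)
      (F := fun w θ => φ θ * f (w + circleMap 0 r θ • v))
      (F' := fun w θ => φ θ • fderiv ℂ f (w + circleMap 0 r θ • v))
      (bound := fun _ => r⁻¹ * (M / (R / 8))) (s := ball w₀ (R / 4))
      (isOpen_ball.mem_nhds hw₀b) ?_ ?_ ?_ ?_ ?_ ?_
    · filter_upwards [isOpen_ball.mem_nhds hw₀b] with w hw
      exact (hcont w hw).aestronglyMeasurable
    · exact (hcont w₀ hw₀b).intervalIntegrable _ _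
    -- Measurability of `fderiv` is enough here; its continuity is not needed.
    · have hm : Measurable fun θ : ℝ => fderiv ℂ f (w₀ + circleMap 0 r θ • v) :=
        (measurable_fderiv ℂ f).comp (hline.comp (Continuous.prodMk_right w₀)).measurable
      exact (hφc.measurable.stronglyMeasurable.smul hm.stronglyMeasurable).aestronglyMeasurable
    · refine Filter.Eventually.of_forall fun θ _ w hw => ?_
      rw [norm_smul, hφn]
      exact mul_le_mul_of_nonneg_left (hop _ (hmem w hw _ (hcirc θ))) (by positivity)
    · exact intervalIntegrable_const
    · refine Filter.Eventually.of_forall fun θ _ w hw => ?_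
      have hmU := hmemU w hw _ (hcirc θ)
      have h1 := ((hf _ hmU).differentiableAt (hU.mem_nhds hmU)).hasFDerivAt
      have h2 : HasFDerivAt (fun w : E => w + circleMap 0 r θ • v) (ContinuousLinearMap.id ℂ E) w :=
        (hasFDerivAt_id w).add_const _
      exact (h1.comp w h2).const_mul (φ θ)
  refine DifferentiableAt.differentiableWithinAt ?_
  refine ((hderiv.differentiableAt).const_mul (2 * Real.pi * Complex.I : ℂ)⁻¹).congr_of_eventuallyEq ?_
  filter_upwards [isOpen_ball.mem_nhds hw₀b] with w hw
  rw [hcauchy w hw, circleIntegral]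
  congr 1
  refine intervalIntegral.integral_congr fun θ _ => ?_
  simp only [hφ, smul_eq_mul]
  ring

/-- The identity theorem for holomorphic functions of several variables. -/
theorem DifferentiableOn.eqOn_of_isPreconnected {f g : E → ℂ} {U V : Set E} (hU : IsOpen U)
    (hUc : IsPreconnected U) (hf : DifferentiableOn ℂ f U) (hg : DifferentiableOn ℂ g U)
    (hV : IsOpen V) (hVU : V ⊆ U) (hne : V.Nonempty) (hfg : EqOn f g V) : EqOn f g U := by
  set W : Set E := {w | f =ᶠ[𝓝 w] g} with hW
  have hWo : IsOpen W := isOpen_iff_mem_nhds.2 fun w hw => hw.eventually_nhds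
  have hsub : U ⊆ W := by
    -- `W` is open and meets `U`; it remains to see that it is closed relative to `U`.
    refine hUc.subset_of_closure_inter_subset hWo ?_ ?_
    · obtain ⟨v, hv⟩ := hne
      exact ⟨v, hVU hv, Filter.eventuallyEq_of_mem (hV.mem_nhds hv) hfg⟩
    · rintro w ⟨hwcl, hwU⟩
      obtain ⟨r, hr, hrU⟩ := Metric.isOpen_iff.1 hU w hwU
      obtain ⟨w', hw'W, hw'⟩ := Metric.mem_closure_iff.1 hwcl r hr
      have hw'b : w' ∈ ball w r := by rwa [mem_ball, dist_comm]
      refine Filter.eventuallyEq_of_mem (ball_mem_nhds w hr) fun x hx => ?_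
      -- On the complex line through `w'`, where the germs agree, and `x`, the one-variable identity
      -- theorem applies on the convex set `D`.
      set ℓ : ℂ → E := fun ζ => w' + ζ • (x - w') with hℓ
      have hℓc : Continuous ℓ := by fun_prop
      have hℓd : Differentiable ℂ ℓ := by fun_prop
      set D : Set ℂ := ℓ ⁻¹' ball w r with hD
      have hDo : IsOpen D := isOpen_ball.preimage hℓc
      have hDc : Convex ℝ D := by
        intro a ha b hb s t hs ht hst
        have : ℓ (s • a + t • b) = s • ℓ a + t • ℓ b := by
          simp only [hℓ, smul_add, add_smul, smul_assoc]
          have : w' = s • w' + t • w' := by rw [← add_smul, hst, one_smul]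
          nth_rewrite 1 [this]
          abel
        have hconv : Convex ℝ (ball w r) := convex_ball w r
        change ℓ _ ∈ ball w r
        rw [this]
        exact hconv ha hb hs ht hst
      have hmaps : MapsTo ℓ D U := fun ζ hζ => hrU hζ
      have hfa : AnalyticOnNhd ℂ (f ∘ ℓ) D :=
        (hf.comp hℓd.differentiableOn hmaps).analyticOnNhd hDo
      have hga : AnalyticOnNhd ℂ (g ∘ ℓ) D :=
        (hg.comp hℓd.differentiableOn hmaps).analyticOnNhd hDo
      have h0 : (0 : ℂ) ∈ D := by simpa [hD, hℓ] using hw'b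
      have h1 : (1 : ℂ) ∈ D := by simpa [hD, hℓ] using hx
      have hev : f ∘ ℓ =ᶠ[𝓝 0] g ∘ ℓ := by
        have : Filter.Tendsto ℓ (𝓝 0) (𝓝 w') := by
          simpa [hℓ] using hℓc.tendsto 0
        exact this.eventually hw'W
      have := hfa.eqOn_of_preconnected_of_eventuallyEq hga hDc.isPreconnected h0 hev h1
      simpa [hℓ] using this
  exact fun w hw => (hsub hw).self_of_nhds

end Holomorphic

/-! ### Derivatives of determinants -/

section Det

variable {ι : Type*} [Fintype ι] [DecidableEq ι]

theorem Matrix.det_eq_sum_row {R : Type*} [CommRing R] (M : Matrix ι ι R) :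
    M.det = ∑ σ : Equiv.Perm ι, ((σ.sign : ℤ) : R) * ∏ i, M i (σ i) := by
  rw [← Matrix.det_transpose, Matrix.det_apply']
  rfl

theorem Matrix.det_updateRow_eq_sum {R : Type*} [CommRing R] (M : Matrix ι ι R) (r : ι)
    (x : ι → R) : (M.updateRow r x).det =
      ∑ σ : Equiv.Perm ι, ((σ.sign : ℤ) : R) * ((∏ i ∈ Finset.univ.erase r, M i (σ i)) * x (σ r)) := by
  rw [Matrix.det_eq_sum_row]
  refine Finset.sum_congr rfl fun σ _ => ?_
  congr 1
  rw [← Finset.mul_prod_erase _ _ (Finset.mem_univ r), Matrix.updateRow_self, mul_comm]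
  congr 1
  refine Finset.prod_congr rfl fun i hi => ?_
  rw [Matrix.updateRow_ne (Finset.ne_of_mem_erase hi)]

/-- Laplace expansion along row `r`: the determinants with a unit vector in that row are its
cofactors. -/
theorem Matrix.sum_mul_det_updateRow_single {R : Type*} [CommRing R] (M : Matrix ι ι R) (r : ι)
    (x : ι → R) : ∑ j, x j * (M.updateRow r (Pi.single j 1)).det = (M.updateRow r x).det := by
  simp_rw [Matrix.det_updateRow_eq_sum, Finset.mul_sum]
  rw [Finset.sum_comm]
  refine Finset.sum_congr rfl fun σ _ => ?_
  rw [Finset.sum_eq_single (σ r)]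
  · simp; ring
  · intro j _ hj
    simp [hj.symm]
  · simp

/-- Exchanging two rows changes the sign. -/
theorem Matrix.det_updateRow_updateRow_swap {R : Type*} [CommRing R] (M : Matrix ι ι R) {a r : ι}
    (har : a ≠ r) (x y : ι → R) :
    ((M.updateRow a x).updateRow r y).det = -((M.updateRow a y).updateRow r x).det := by
  have hadd₂ : ∀ x y y', ((M.updateRow a x).updateRow r (y + y')).det =
      ((M.updateRow a x).updateRow r y).det + ((M.updateRow a x).updateRow r y').det :=
    fun x y y' => Matrix.det_updateRow_add _ _ _ _
  have hcomm : ∀ x y, (M.updateRow a x).updateRow r y = (M.updateRow r y).updateRow a x :=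
    fun x y => Matrix.updateRow_comm _ har _ _
  have hadd₁ : ∀ x x' y, ((M.updateRow a (x + x')).updateRow r y).det =
      ((M.updateRow a x).updateRow r y).det + ((M.updateRow a x').updateRow r y).det := by
    intro x x' y
    simp only [hcomm, Matrix.det_updateRow_add]
  have hself : ∀ x, ((M.updateRow a x).updateRow r x).det = 0 := by
    intro x
    refine Matrix.det_zero_of_row_eq har ?_
    rw [Matrix.updateRow_self, Matrix.updateRow_ne har, Matrix.updateRow_self]
  have := hself (x + y)
  rw [hadd₁, hadd₂, hadd₂, hself, hself] at this
  linear_combination this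

/-- The product rule applied to the permutation expansion differentiates one row at a time. -/
theorem hasFDerivAt_det {X : Type*} [NormedAddCommGroup X] [NormedSpace ℝ X]
    {M : X → Matrix ι ι ℂ} {M' : ι → ι → X →L[ℝ] ℂ} {x : X}
    (h : ∀ i j, HasFDerivAt (fun x => M x i j) (M' i j) x) :
    ∃ D : X →L[ℝ] ℂ, HasFDerivAt (fun x => (M x).det) D x ∧
      ∀ v, D v = ∑ r, ((M x).updateRow r (fun j => M' r j v)).det := by
  refine ⟨∑ σ : Equiv.Perm ι, ((σ.sign : ℤ) : ℂ) •
    ∑ r, (∏ i ∈ Finset.univ.erase r, M x i (σ i)) • M' r (σ r), ?_, ?_⟩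
  · simp_rw [Matrix.det_eq_sum_row]
    refine HasFDerivAt.fun_sum fun σ _ => ?_
    exact (HasFDerivAt.finsetProd fun i _ => h i (σ i)).const_mul _
  · intro v
    simp_rw [Matrix.det_updateRow_eq_sum]
    rw [Finset.sum_comm]
    simp [Finset.mul_sum]

end Det

/-! ### Stokes' formula for a cube -/

section Stokes

variable {n : ℕ}

/-- The Jacobian matrix of a map between `ℝⁿ` and `ℂⁿ`. -/
noncomputable def cubeJacMatrix (c : (Fin n → ℝ) → (Fin n → ℂ)) (t : Fin n → ℝ) :
    Matrix (Fin n) (Fin n) ℂ :=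
  Matrix.of fun a b => fderiv ℝ c t (Pi.single b 1) a

theorem hasFDerivAt_cubeJacMatrix {c : (Fin n → ℝ) → (Fin n → ℂ)} (hc : ContDiff ℝ ∞ c)
    (t : Fin n → ℝ) (a b : Fin n) :
    HasFDerivAt (fun t => cubeJacMatrix c t a b)
      ((ContinuousLinearMap.proj a ∘L ContinuousLinearMap.apply ℝ (Fin n → ℂ) (Pi.single b 1)) ∘L
        fderiv ℝ (fderiv ℝ c) t) t := by
  have h1 : DifferentiableAt ℝ (fderiv ℝ c) t :=
    ((hc.fderiv_right (m := 1) (by norm_cast)).differentiable (by norm_num)).differentiableAt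
  exact ((ContinuousLinearMap.proj (R := ℝ) (φ := fun _ : Fin n => ℂ) a ∘L
    ContinuousLinearMap.apply ℝ (Fin n → ℂ)
    (Pi.single b (1 : ℝ))).hasFDerivAt).comp t h1.hasFDerivAt

theorem continuous_cubeJacMatrix {c : (Fin n → ℝ) → (Fin n → ℂ)} (hc : ContDiff ℝ ∞ c) :
    Continuous (cubeJacMatrix c) :=
  continuous_matrix fun a b => continuous_iff_continuousAt.2 fun t =>
    (hasFDerivAt_cubeJacMatrix hc t a b).continuousAt

theorem continuous_cubeJacobian {c : (Fin n → ℝ) → (Fin n → ℂ)} (hc : ContDiff ℝ ∞ c) :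
    Continuous (cubeJacobian c) :=
  (continuous_cubeJacMatrix hc).matrix_det

/-- The Piola identity: the cofactors of a Jacobian matrix form divergence-free rows. -/
theorem exists_hasFDerivAt_cofactor {c : (Fin n → ℝ) → (Fin n → ℂ)} (hc : ContDiff ℝ ∞ c)
    (a : Fin n) (t : Fin n → ℝ) :
    ∃ D : Fin n → (Fin n → ℝ) →L[ℝ] ℂ,
      (∀ j, HasFDerivAt (fun t => ((cubeJacMatrix c t).updateRow a (Pi.single j 1)).det) (D j) t) ∧
      ∑ j, D j (Pi.single j 1) = 0 := by
  set A := cubeJacMatrix c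
  set H : Fin n → Fin n → Fin n → ℂ := fun r j l =>
    fderiv ℝ (fderiv ℝ c) t (Pi.single j 1) (Pi.single l 1) r with hH
  have hsymm : ∀ r j l, H r j l = H r l j := by
    intro r j l
    have : IsSymmSndFDerivAt ℝ c t :=
      (hc.contDiffAt).isSymmSndFDerivAt (by
        rw [minSmoothness_of_isRCLikeNormedField]; exact WithTop.coe_le_coe.2 (le_top : (2 : ℕ∞) ≤ ⊤))
    simp only [hH]
    rw [this.eq]
  -- Row `a` is a constant unit vector, so only the other rows contribute to the derivative.
  have hD : ∀ j, ∃ D : (Fin n → ℝ) →L[ℝ] ℂ,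
      HasFDerivAt (fun t => ((A t).updateRow a (Pi.single j 1)).det) D t ∧
      ∀ v, D v = ∑ r, (((A t).updateRow a (Pi.single j 1)).updateRow r
        (fun l => if r = a then 0 else fderiv ℝ (fderiv ℝ c) t v (Pi.single l 1) r)).det := by
    intro j
    obtain ⟨D, hD, hDv⟩ := hasFDerivAt_det (M := fun t => (A t).updateRow a (Pi.single j 1))
      (M' := fun r l => if r = a then 0 else
        (ContinuousLinearMap.proj r ∘L ContinuousLinearMap.apply ℝ (Fin n → ℂ) (Pi.single l 1)) ∘L
        fderiv ℝ (fderiv ℝ c) t) (x := t) (by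
        intro r l
        by_cases hr : r = a
        · subst hr
          simp only [Matrix.updateRow_self, if_true]
          exact hasFDerivAt_const _ _
        · simp only [Matrix.updateRow_ne hr, if_neg hr]
          exact hasFDerivAt_cubeJacMatrix hc t r l)
    refine ⟨D, hD, fun v => ?_⟩
    rw [hDv]
    refine Finset.sum_congr rfl fun r _ => ?_
    congr 2
    ext l
    split_ifs <;> rfl
  choose D hDd hDv using hD
  refine ⟨D, hDd, ?_⟩
  simp_rw [hDv]
  rw [Finset.sum_comm]
  refine Finset.sum_eq_zero fun r _ => ?_
  by_cases hr : r = a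
  · refine Finset.sum_eq_zero fun j _ => ?_
    refine Matrix.det_eq_zero_of_row_eq_zero r fun l => ?_
    simp [hr]
  simp only [if_neg hr]
  set B : Fin n → Fin n → ℂ := fun j l =>
    (((A t).updateRow a (Pi.single j 1)).updateRow r (Pi.single l 1)).det with hB
  have hanti : ∀ j l, B j l = - B l j := fun j l =>
    Matrix.det_updateRow_updateRow_swap _ (Ne.symm hr) _ _
  have h1 : ∀ j, (((A t).updateRow a (Pi.single j 1)).updateRow r (H r j)).det =
      ∑ l, H r j l * B j l := fun j => (Matrix.sum_mul_det_updateRow_single _ _ _).symm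
  -- `H` is symmetric in `j, l` (second derivatives commute) and `B` is antisymmetric.
  have h2 : ∑ j, ∑ l, H r j l * B j l = -∑ j, ∑ l, H r j l * B j l := by
    conv_lhs => rw [Finset.sum_comm]
    rw [← Finset.sum_neg_distrib]
    refine Finset.sum_congr rfl fun j _ => ?_
    rw [← Finset.sum_neg_distrib]
    refine Finset.sum_congr rfl fun l _ => ?_
    rw [hsymm, hanti]
    ring
  calc _ = ∑ j, ∑ l, H r j l * B j l := Finset.sum_congr rfl fun j _ => h1 j
    _ = 0 := by linear_combination h2 / 2

theorem cubeFace_eq_insertNth (j : Fin (n + 1)) (e : Bool) (u : Fin n → ℝ) :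
    cubeFace (n := n + 1) j e u = j.insertNth (α := fun _ => ℝ) (if e then (1 : ℝ) else 0) u := by
  ext i
  rcases Fin.eq_self_or_eq_succAbove j i with rfl | ⟨i', rfl⟩
  · simp [cubeFace]
  · rw [Fin.insertNth_apply_succAbove]
    rcases lt_or_ge i'.castSucc j with h | h
    · rw [Fin.succAbove_of_castSucc_lt _ _ h]
      have h' : i'.1 < j.1 := h
      simp [cubeFace, h']
    · rw [Fin.succAbove_of_le_castSucc _ _ h]
      have h' : j.1 ≤ i'.1 := h
      have h1 : ¬ (i'.1 + 1 < j.1) := by omega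
      have h2 : ¬ (i'.1 + 1 = j.1) := by omega
      simp [cubeFace, h1, h2]

theorem hasFDerivAt_cubeFace (j : Fin (n + 1)) (e : Bool) (u : Fin n → ℝ) :
    HasFDerivAt (𝕜 := ℝ) (fun u : Fin n → ℝ => cubeFace (n := n + 1) j e u)
      (ContinuousLinearMap.pi fun i : Fin (n + 1) => j.insertNth (α := fun _ => (Fin n → ℝ) →L[ℝ] ℝ) 0
        (fun b => ContinuousLinearMap.proj b) i) u := by
  simp_rw [cubeFace_eq_insertNth]
  refine hasFDerivAt_pi.2 fun i => ?_
  rcases Fin.eq_self_or_eq_succAbove j i with rfl | ⟨i', rfl⟩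
  · simpa using hasFDerivAt_const _ _
  · simpa using hasFDerivAt_apply i' u

theorem continuous_cubeFace (j : Fin (n + 1)) (e : Bool) :
    Continuous (fun u : Fin n → ℝ => cubeFace (n := n + 1) j e u) :=
  continuous_iff_continuousAt.2 fun u => (hasFDerivAt_cubeFace j e u).continuousAt

theorem cubeFace_mem (j : Fin (n + 1)) (e : Bool) {u : Fin n → ℝ} (hu : u ∈ unitCube n) :
    cubeFace (n := n + 1) j e u ∈ unitCube (n + 1) := by
  rw [cubeFace_eq_insertNth]
  refine ⟨fun i => ?_, fun i => ?_⟩ <;>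
  · rcases Fin.eq_self_or_eq_succAbove j i with rfl | ⟨i', rfl⟩
    · cases e <;> simp
    · first
        | simpa using hu.1 i'
        | simpa using hu.2 i'

theorem fderiv_comp_cubeFace {c : (Fin (n + 1) → ℝ) → (Fin (n + 1) → ℂ)} (hc : ContDiff ℝ ∞ c)
    (j : Fin (n + 1)) (e : Bool) (u : Fin n → ℝ) (b : Fin n) :
    fderiv ℝ (fun u : Fin n → ℝ => c (cubeFace (n := n + 1) j e u)) u (Pi.single b 1) =
      fderiv ℝ c (cubeFace (n := n + 1) j e u) (Pi.single (j.succAbove b) 1) := by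
  have h1 : DifferentiableAt ℝ c (cubeFace (n := n + 1) j e u) :=
    (hc.differentiable (by simp)).differentiableAt
  have := (h1.hasFDerivAt.comp u (hasFDerivAt_cubeFace j e u)).fderiv
  rw [Function.comp_def] at this
  rw [this]
  simp only [ContinuousLinearMap.comp_apply]
  congr 1
  ext i
  rcases Fin.eq_self_or_eq_succAbove j i with rfl | ⟨i', rfl⟩
  · simp
  · simp [Pi.single_apply]

/-- The minor of the Jacobian of `φ : ℝⁿ → ℂⁿ⁺¹` obtained by omitting the component `a`. -/
noncomputable def omitMinor (a : Fin (n + 1)) (φ' : (Fin n → ℝ) →L[ℝ] (Fin (n + 1) → ℂ)) : ℂ :=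
  (Matrix.of fun r b : Fin n => φ' (Pi.single b 1) (a.succAbove r)).det

/-- The normal cofactor on a face involves only tangential derivatives, so it depends only on the
restriction of `c` to that face. This lets coinciding faces cancel. -/
theorem det_updateRow_cubeFace {c : (Fin (n + 1) → ℝ) → (Fin (n + 1) → ℂ)} (hc : ContDiff ℝ ∞ c)
    (a j : Fin (n + 1)) (e : Bool) (u : Fin n → ℝ) :
    ((cubeJacMatrix c (cubeFace (n := n + 1) j e u)).updateRow a (Pi.single j 1)).det =
      (-1) ^ (a.1 + j.1) *
        omitMinor a (fderiv ℝ (fun u : Fin n → ℝ => c (cubeFace (n := n + 1) j e u)) u) := by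
  rw [← Matrix.adjugate_apply, Matrix.adjugate_fin_succ_eq_det_submatrix, omitMinor]
  congr 2
  ext r b
  simp only [fderiv_comp_cubeFace hc]
  rfl

/-- Stokes' formula for the pull-back of `h` times the product of all `dx_l` with `l ≠ a`. The
divergence theorem is applied to the field `h` times the cofactors of row `a`: these have divergence
zero, and pairing them with `dh = ∑ g_l dx_l` leaves `g_a` times the Jacobian, because the terms
with `l ≠ a` are determinants with two equal rows. -/
theorem integral_unitCube_succ_eq_sum_faces {c : (Fin (n + 1) → ℝ) → (Fin (n + 1) → ℂ)}
    (hc : ContDiff ℝ ∞ c) (a : Fin (n + 1)) {h : (Fin (n + 1) → ℝ) → ℂ}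
    {g : Fin (n + 1) → (Fin (n + 1) → ℝ) → ℂ} (hh : ContinuousOn h (unitCube (n + 1)))
    (hg : ContinuousOn (g a) (unitCube (n + 1)))
    (hd : ∀ t ∈ interior (unitCube (n + 1)), HasFDerivAt (𝕜 := ℝ) h
      (∑ l, g l t • (ContinuousLinearMap.proj l ∘L fderiv ℝ c t)) t) :
    ∫ t in unitCube (n + 1), g a t * cubeJacobian c t =
      ∑ j : Fin (n + 1), ∑ e : Bool, faceSign j e * ((-1) ^ a.1 * ∫ u in unitCube n,
        h (cubeFace (n := n + 1) j e u) *
        omitMinor a (fderiv ℝ (fun u : Fin n → ℝ => c (cubeFace (n := n + 1) j e u)) u)) := by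
  set A := cubeJacMatrix c with hA
  choose D hD hD0 using fun t => exists_hasFDerivAt_cofactor hc a t
  set F : Fin (n + 1) → (Fin (n + 1) → ℝ) → ℂ := fun j t =>
    h t * ((A t).updateRow a (Pi.single j 1)).det with hF
  set h' : (Fin (n + 1) → ℝ) → (Fin (n + 1) → ℝ) →L[ℝ] ℂ := fun t =>
    ∑ l, g l t • (ContinuousLinearMap.proj l ∘L fderiv ℝ c t) with hh'
  set F' : Fin (n + 1) → (Fin (n + 1) → ℝ) → (Fin (n + 1) → ℝ) →L[ℝ] ℂ := fun j t =>
    h t • D t j + ((A t).updateRow a (Pi.single j 1)).det • h' t with hF'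
  have hdiv : ∀ t, ∑ j, F' j t (Pi.single j 1) = g a t * cubeJacobian c t := by
    intro t
    simp only [hF', add_apply, smul_apply, smul_eq_mul]
    rw [Finset.sum_add_distrib, ← Finset.mul_sum, hD0, mul_zero, zero_add]
    have h1 : ∀ j, h' t (Pi.single j 1) = ∑ l, g l t * A t l j := by
      intro j
      simp [hh', hA, cubeJacMatrix]
    simp_rw [h1, Finset.mul_sum]
    rw [Finset.sum_comm]
    have h2 : ∀ l, ∑ j, ((A t).updateRow a (Pi.single j 1)).det * (g l t * A t l j) =
        g l t * ((A t).updateRow a (A t l)).det := by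
      intro l
      rw [← Matrix.sum_mul_det_updateRow_single, Finset.mul_sum]
      exact Finset.sum_congr rfl fun j _ => by ring
    simp_rw [h2]
    rw [Finset.sum_eq_single a]
    · rw [Matrix.updateRow_eq_self]; rfl
    · intro l _ hl
      rw [Matrix.det_zero_of_row_eq (Ne.symm hl), mul_zero]
      rw [Matrix.updateRow_self, Matrix.updateRow_ne hl]
    · simp
  have hcof : ∀ j, Continuous fun t => ((A t).updateRow a (Pi.single j 1)).det := fun j =>
    continuous_iff_continuousAt.2 fun t => (hD t j).continuousAt
  have hcube : unitCube (n + 1) = Icc 0 1 := rfl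
  have hint : interior (unitCube (n + 1)) = pi univ fun i : Fin (n + 1) => Ioo ((0 : Fin (n + 1) → ℝ) i) ((1 : Fin (n + 1) → ℝ) i) := by
    rw [hcube, ← pi_univ_Icc, interior_pi_set finite_univ]
    simp
  have key := integral_divergence_of_hasFDerivAt_off_countable' (E := ℂ) (0 : Fin (n + 1) → ℝ) 1
    zero_le_one F F' ∅ countable_empty (fun j => hh.mul (hcof j).continuousOn)
    (fun t ht j => by
      rw [sdiff_empty, ← hint] at ht
      exact (hd t ht).mul (hD t j)) (by
      simp_rw [hdiv]
      exact (hg.mul (continuous_cubeJacobian hc).continuousOn).integrableOn_compact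
        (isCompact_unitCube _))
  simp_rw [hdiv] at key
  rw [hcube, key]
  refine Finset.sum_congr rfl fun j _ => ?_
  have hface : ∀ e : Bool, ∫ u in unitCube n, F j (cubeFace (n := n + 1) j e u) =
      (-1) ^ j.1 * ((-1) ^ a.1 * ∫ u in unitCube n, h (cubeFace (n := n + 1) j e u) *
        omitMinor a (fderiv ℝ (fun u : Fin n → ℝ => c (cubeFace (n := n + 1) j e u)) u)) := by
    intro e
    rw [← mul_assoc, ← integral_const_mul]
    refine integral_congr_ae (Filter.Eventually.of_forall fun u => ?_)
    simp only [hF]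
    rw [det_updateRow_cubeFace hc, pow_add]
    ring
  have hs1 : faceSign j true = (-1) ^ j.1 := by simp [faceSign, pow_add]
  have hs0 : faceSign j false = -(-1) ^ j.1 := by simp [faceSign, pow_add]
  rw [Fintype.sum_bool, hs1, hs0, ← hface true, neg_mul, ← hface false, ← sub_eq_add_neg]
  simp only [cubeFace_eq_insertNth]
  rfl

theorem interior_unitCube_ae_eq (n : ℕ) :
    interior (unitCube n) =ᵐ[volume] unitCube n :=
  interior_ae_eq_of_null_frontier ((convex_Icc (0 : Fin n → ℝ) 1).addHaar_frontier _)

theorem continuous_omitMinor_cubeFace {c : (Fin (n + 1) → ℝ) → (Fin (n + 1) → ℂ)}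
    (hc : ContDiff ℝ ∞ c) (a j : Fin (n + 1)) (e : Bool) :
    Continuous fun u : Fin n → ℝ =>
      omitMinor a (fderiv ℝ (fun u : Fin n → ℝ => c (cubeFace (n := n + 1) j e u)) u) := by
  choose D hD hD0 using fun t => exists_hasFDerivAt_cofactor hc a t
  have hcof : Continuous fun t => ((cubeJacMatrix c t).updateRow a (Pi.single j 1)).det :=
    continuous_iff_continuousAt.2 fun t => (hD t j).continuousAt
  have h1 := (continuous_const (y := ((-1 : ℂ)) ^ (a.1 + j.1))).mul
    (hcof.comp (continuous_cubeFace j e))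
  refine h1.congr fun u => ?_
  change (-1 : ℂ) ^ (a.1 + j.1) *
    ((cubeJacMatrix c (cubeFace (n := n + 1) j e u)).updateRow a (Pi.single j 1)).det = _
  rw [det_updateRow_cubeFace hc, ← mul_assoc, ← pow_add, Even.neg_one_pow ⟨_, rfl⟩, one_mul]

end Stokes

/-- Cycle conditions are stated one class of coinciding faces at a time, whereas Stokes' formula
sums over all faces. -/
theorem Finset.sum_eq_zero_of_sum_equivalence_class {ι : Type*} [Fintype ι] {R : ι → ι → Prop}
    (hR : Equivalence R) [∀ x y, Decidable (R x y)] {b : ι → ℂ}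
    (h : ∀ x₀, ∑ x, (if R x x₀ then b x else 0) = 0) : ∑ x, b x = 0 := by
  classical
  let s : Setoid ι := ⟨R, hR⟩
  rw [← Finset.sum_fiberwise Finset.univ (Quotient.mk s) b]
  refine Finset.sum_eq_zero fun q _ => ?_
  obtain ⟨x₀, rfl⟩ := Quotient.exists_rep q
  rw [Finset.sum_filter]
  refine Eq.trans ?_ (h x₀)
  refine Finset.sum_congr rfl fun x _ => ?_
  simp only [Quotient.eq]
  rfl

open Classical in
/-- Stokes' theorem for a chain of cubes carrying functions whose faces cancel: `R` identifies the
faces on which the maps have the same derivative. -/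
theorem sum_integral_unitCube_eq_zero {n : ℕ} (hn : 0 < n) {P : ℕ} (coef : Fin P → ℂ)
    {c : Fin P → (Fin n → ℝ) → (Fin n → ℂ)} (hc : ∀ p, ContDiff ℝ ∞ (c p)) (a : Fin n)
    {h : Fin P → (Fin n → ℝ) → ℂ} {g : Fin P → Fin n → (Fin n → ℝ) → ℂ}
    (hh : ∀ p, ContinuousOn (h p) (unitCube n)) (hg : ∀ p, ContinuousOn (g p a) (unitCube n))
    (hd : ∀ p, ∀ t ∈ interior (unitCube n), HasFDerivAt (𝕜 := ℝ) (h p)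
      (∑ l, g p l t • (ContinuousLinearMap.proj l ∘L fderiv ℝ (c p) t)) t)
    {R : (Fin P × Fin n × Bool) → (Fin P × Fin n × Bool) → Prop} (hR : Equivalence R)
    (hRD : ∀ F F₀, R F F₀ → ∀ u ∈ interior (unitCube (n - 1)),
      fderiv ℝ (fun u => c F.1 (cubeFace F.2.1 F.2.2 u)) u =
        fderiv ℝ (fun u => c F₀.1 (cubeFace F₀.2.1 F₀.2.2 u)) u)
    (hcl : ∀ F₀, ∀ u ∈ unitCube (n - 1), ∑ p, ∑ j, ∑ e, (if R (p, j, e) F₀ then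
      faceSign j e * coef p * h p (cubeFace j e u) else 0) = 0) :
    ∑ p, coef p * ∫ t in unitCube n, g p a t * cubeJacobian (c p) t = 0 := by
  cases n with
  | zero => exact absurd hn (lt_irrefl 0)
  | succ n =>
    set m : (Fin P × Fin (n + 1) × Bool) → (Fin n → ℝ) → ℂ := fun F u =>
      omitMinor a (fderiv ℝ (fun u : Fin n → ℝ => c F.1 (cubeFace (n := n + 1) F.2.1 F.2.2 u)) u)
      with hm
    set H : (Fin P × Fin (n + 1) × Bool) → (Fin n → ℝ) → ℂ := fun F u =>
      faceSign F.2.1 F.2.2 * coef F.1 * h F.1 (cubeFace (n := n + 1) F.2.1 F.2.2 u) with hH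
    have hHc : ∀ F, ContinuousOn (H F) (unitCube n) := fun F =>
      continuousOn_const.mul ((hh F.1).comp (continuous_cubeFace _ _).continuousOn
        fun u hu => cubeFace_mem _ _ hu)
    have hmc : ∀ F, Continuous (m F) := fun F => continuous_omitMinor_cubeFace (hc F.1) a _ _
    have h1 : ∑ F, ∫ u in unitCube n, H F u * m F u = 0 := by
      refine Finset.sum_eq_zero_of_sum_equivalence_class hR fun F₀ => ?_
      have h2 : ∀ F, (if R F F₀ then ∫ u in unitCube n, H F u * m F u else 0) =
          ∫ u in unitCube n, (if R F F₀ then H F u else 0) * m F₀ u := by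
        intro F
        split_ifs with hF
        -- The minors of coinciding faces are known to agree only on the open face, which has full
        -- measure; there the minor of `F₀` replaces that of `F`, and the carried functions cancel
        -- by `hcl`.
        · rw [← setIntegral_congr_set (interior_unitCube_ae_eq n),
            ← setIntegral_congr_set (interior_unitCube_ae_eq n)]
          refine setIntegral_congr_fun isOpen_interior.measurableSet fun u hu => ?_
          exact congrArg (fun D => H F u * omitMinor a D) (hRD F F₀ hF u hu)
        · simp
      simp_rw [h2]
      rw [← integral_finsetSum]
      · refine Eq.trans (setIntegral_congr_fun (measurableSet_unitCube n) fun u hu => ?_)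
          (integral_zero (Fin n → ℝ) ℂ)
        simp only [← Finset.sum_mul]
        have := hcl F₀ u hu
        simp only [Fintype.sum_prod_type, hH]
        rw [this, zero_mul]
      · intro F _
        refine ContinuousOn.integrableOn_compact (isCompact_unitCube n) ?_
        refine ContinuousOn.mul ?_ (hmc F₀).continuousOn
        split_ifs
        · exact hHc F
        · exact continuousOn_const
    calc _ = ∑ p, (-1) ^ a.1 * ∑ j : Fin (n + 1), ∑ e : Bool, ∫ u in unitCube n,
              H (p, j, e) u * m (p, j, e) u := by
          refine Finset.sum_congr rfl fun p _ => ?_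
          rw [integral_unitCube_succ_eq_sum_faces (hc p) a (hh p) (hg p) (hd p)]
          simp_rw [Finset.mul_sum]
          refine Finset.sum_congr rfl fun j _ => Finset.sum_congr rfl fun e _ => ?_
          rw [mul_left_comm, ← mul_assoc, mul_left_comm, ← integral_const_mul]
          congr 1
          refine integral_congr_ae (Filter.Eventually.of_forall fun u => ?_)
          simp only [hH, hm]
          ring
      _ = 0 := by
          rw [← Finset.mul_sum]
          simp only [Fintype.sum_prod_type] at h1
          rw [h1, mul_zero]

/-! ### Continuous branches of the logarithm -/

/-- By continuity `L x - L x₀` has norm less than `1 < π`, so it is the principal logarithm of the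
quotient. Branches that are only assumed continuous thus inherit the differentiability of `F`. -/
theorem eventuallyEq_log_of_exp_eq {X : Type*} [TopologicalSpace X] {L F : X → ℂ} {x₀ : X}
    (hL : ContinuousAt L x₀) (hF : ∀ᶠ x in 𝓝 x₀, Complex.exp (L x) = F x) :
    L =ᶠ[𝓝 x₀] fun x => Complex.log (F x / F x₀) + L x₀ := by
  have h1 : ∀ᶠ x in 𝓝 x₀, ‖L x - L x₀‖ < 1 := by
    have := hL (ball_mem_nhds _ one_pos)
    filter_upwards [this] with x hx
    simpa [dist_eq_norm] using hx
  filter_upwards [h1, hF] with x hx hFx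
  rw [← hFx, ← hF.self_of_nhds, ← Complex.exp_sub, Complex.log_exp]
  · ring
  · have := (abs_lt.1 ((Complex.abs_im_le_norm _).trans_lt hx)).1
    linarith [Real.pi_gt_three]
  · have := (abs_lt.1 ((Complex.abs_im_le_norm _).trans_lt hx)).2
    linarith [Real.pi_gt_three]

theorem hasDerivAt_of_exp_eq {L F : ℂ → ℂ} {x₀ F' : ℂ} (hL : ContinuousAt L x₀)
    (hF : ∀ᶠ x in 𝓝 x₀, Complex.exp (L x) = F x) (hF' : HasDerivAt F F' x₀) :
    HasDerivAt L (F' / F x₀) x₀ := by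
  have h0 : F x₀ ≠ 0 := by rw [← hF.self_of_nhds]; exact Complex.exp_ne_zero _
  have h1 : HasDerivAt (fun x => Complex.log (F x / F x₀) + L x₀) (F' / F x₀) x₀ := by
    have := ((hF'.div_const (F x₀)).clog (by simp [div_self h0])).add_const (L x₀)
    simpa [div_self h0] using this
  exact h1.congr_of_eventuallyEq (eventuallyEq_log_of_exp_eq hL hF)

theorem hasFDerivAt_of_exp_eq {X : Type*} [NormedAddCommGroup X] [NormedSpace ℝ X] {L F : X → ℂ}
    {x₀ : X} {F' : X →L[ℝ] ℂ} (hL : ContinuousAt L x₀)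
    (hF : ∀ᶠ x in 𝓝 x₀, Complex.exp (L x) = F x) (hF' : HasFDerivAt F F' x₀) :
    HasFDerivAt L ((F x₀)⁻¹ • F') x₀ := by
  have h0 : F x₀ ≠ 0 := by rw [← hF.self_of_nhds]; exact Complex.exp_ne_zero _
  have h1 : HasFDerivAt (fun x => Complex.log (F x / F x₀) + L x₀) ((F x₀)⁻¹ • F') x₀ := by
    have h2 : HasFDerivAt (fun x => F x / F x₀) ((F x₀)⁻¹ • F') x₀ := by
      simpa [div_eq_mul_inv] using hF'.mul_const (F x₀)⁻¹
    have h3 : HasDerivAt Complex.log (F x₀ / F x₀)⁻¹ (F x₀ / F x₀) :=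
      Complex.hasDerivAt_log (by simp [div_self h0])
    have := (h3.comp_hasFDerivAt (f := fun x => F x / F x₀) x₀ h2).add_const (L x₀)
    simpa [div_self h0] using this
  exact h1.congr_of_eventuallyEq (eventuallyEq_log_of_exp_eq hL hF)

theorem hasFDerivAt_prod_zpow {X : Type*} [NormedAddCommGroup X] [NormedSpace ℝ X] {n : ℕ}
    {x : X → Fin n → ℂ} {D : Fin n → X →L[ℝ] ℂ} {t : X}
    (hx : ∀ l, HasFDerivAt (fun t => x t l) (D l) t) (h0 : ∀ l, x t l ≠ 0) (e : Fin n → ℤ) :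
    HasFDerivAt (fun t => ∏ l, x t l ^ e l) (∑ l, ((∏ l, x t l ^ e l) * (e l / x t l)) • D l) t := by
  have h1 : ∀ l, HasFDerivAt (fun t => x t l ^ e l) (((e l : ℂ) * x t l ^ (e l - 1)) • D l) t :=
    fun l => (hasDerivAt_zpow (e l) (x t l) (Or.inl (h0 l))).comp_hasFDerivAt
      (f := fun t => x t l) t (hx l)
  have h2 := HasFDerivAt.finsetProd (u := Finset.univ) fun l _ => h1 l
  refine h2.congr_fderiv ?_
  refine Finset.sum_congr rfl fun l _ => ?_
  rw [smul_smul, ← Finset.mul_prod_erase _ _ (Finset.mem_univ l), zpow_sub_one₀ (h0 l)]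
  congr 1
  field_simp

/-- The complex line through `w` in the direction of the coordinate `c`. -/
noncomputable def coordLine {n : ℕ} (w : Fin n → ℂ) (c : Fin n) (σ : ℂ) : Fin n → ℂ :=
  w + σ • Pi.single c 1

theorem hasDerivAt_coordLine {n : ℕ} (w : Fin n → ℂ) (c : Fin n) (σ : ℂ) :
    HasDerivAt (coordLine w c) (Pi.single c 1) σ := by
  have := ((hasDerivAt_id σ).smul_const (Pi.single c 1 : Fin n → ℂ)).const_add w
  rwa [one_smul] at this

theorem continuous_coordLine {n : ℕ} (w : Fin n → ℂ) (c : Fin n) : Continuous (coordLine w c) :=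
  continuous_iff_continuousAt.2 fun σ => (hasDerivAt_coordLine w c σ).continuousAt

@[simp] theorem coordLine_zero {n : ℕ} (w : Fin n → ℂ) (c : Fin n) : coordLine w c 0 = w := by
  simp [coordLine]

/-! ### Monomials and polynomials in logarithmic parameters -/

namespace CISystem

variable {N k m : ℕ} (S : CISystem N k m)

/-- The phase variables `s` and `s'`, in the order of the coordinates of `ℂ^(k+m)`. -/
def paramVar (c : Fin (k + m)) : PhaseVar N k m :=
  Fin.addCases (fun q => .inr (.inl q)) (fun j => .inl (.inr j)) c

@[simp] theorem paramVar_castAdd (q : Fin k) :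
    paramVar (N := N) (Fin.castAdd m q) = .inr (.inl q) := by simp [paramVar]

@[simp] theorem paramVar_natAdd (j : Fin m) :
    paramVar (N := N) (Fin.natAdd k j) = .inl (.inr j) := by simp [paramVar]

theorem paramVar_injective : Function.Injective (paramVar (N := N) (k := k) (m := m)) := by
  intro c d
  refine Fin.addCases (fun q => ?_) (fun j => ?_) c <;>
    refine Fin.addCases (fun q' => ?_) (fun j' => ?_) d <;> simp

theorem sum_phaseVar {M : Type*} [AddCommMonoid M] (f : PhaseVar N k m → M) :
    ∑ c, f c = ∑ j, f (.inl (.inl j)) + ∑ c, f (paramVar c) + ∑ q, f (.inr (.inr q)) := by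
  simp only [Fintype.sum_sum_type, Fin.sum_univ_add, paramVar_castAdd, paramVar_natAdd]
  abel

/-- The monomial `T_a` without the variable `y`, at `(s, s') = exp w`. -/
noncomputable def monoVal (a : S.Mono) (x : Fin N → ℂ) (w : Fin (k + m) → ℂ) : ℂ :=
  Complex.exp (∑ c, (S.phaseMatrix a (paramVar c) : ℂ) * w c) *
    ∏ j, x j ^ S.phaseMatrix a (.inl (.inl j))

/-- This is `f_q + s_q = ∂F/∂y_q`; the `y_q`-column of `L` serves as the indicator of the monomials
in the `q`-th polynomial. -/
theorem fiberEq_eq_sum (q : Fin k) (x : Fin N → ℂ) (w : Fin (k + m) → ℂ) :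
    S.fiberEq q x w = ∑ a, (S.phaseMatrix a (.inr (.inr q)) : ℂ) * S.monoVal a x w := by
  rw [Fintype.sum_sum_type, Fintype.sum_sigma, Finset.sum_eq_single q, Finset.sum_eq_single q]
  · have h : ∀ r, S.monoVal (.inl ⟨q, r⟩) x w =
        (∏ j, if S.mark j = ⟨q, r⟩ then Complex.exp (w (Fin.natAdd k j)) else 1) *
          ∏ j, x j ^ S.α q r j := by
      intro r
      simp only [monoVal, Fin.sum_univ_add, paramVar_castAdd, paramVar_natAdd, phaseMatrix]
      simp only [Int.cast_zero, zero_mul, Finset.sum_const_zero, zero_add, Complex.exp_sum,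
        zpow_natCast]
      congr 1
      refine Finset.prod_congr rfl fun j _ => ?_
      split_ifs <;> simp
    have h2 : S.monoVal (.inr q) x w = Complex.exp (w (Fin.castAdd m q)) := by
      simp [monoVal, Fin.sum_univ_add, phaseMatrix]
    rw [fiberEq, f, h2]
    simp only [h]
    simp [phaseMatrix]
  · intro q' _ hq'
    simp [phaseMatrix, hq']
  · simp
  · intro q' _ hq'
    simp [phaseMatrix, hq']
  · simp

theorem hasDerivAt_monoVal (a : S.Mono) (x : Fin N → ℂ) (w : Fin (k + m) → ℂ) (c : Fin (k + m))
    (σ : ℂ) : HasDerivAt (fun σ : ℂ => S.monoVal a x (coordLine w c σ))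
      (S.phaseMatrix a (paramVar c) * S.monoVal a x (coordLine w c σ)) σ := by
  have h1 : HasDerivAt (fun σ : ℂ => ∑ c', (S.phaseMatrix a (paramVar c') : ℂ) *
      coordLine w c σ c')
      (∑ c', (S.phaseMatrix a (paramVar c') : ℂ) * (Pi.single c 1 : Fin (k + m) → ℂ) c') σ :=
    HasDerivAt.fun_sum fun c' _ => HasDerivAt.const_mul _
      (hasDerivAt_pi.1 (hasDerivAt_coordLine w c σ) c')
  have h2 := (h1.cexp).mul_const (∏ j, x j ^ S.phaseMatrix a (.inl (.inl j)))
  refine h2.congr_deriv ?_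
  simp [monoVal, Pi.single_apply]
  ring

theorem hasFDerivAt_monoVal {X : Type*} [NormedAddCommGroup X] [NormedSpace ℝ X] (a : S.Mono)
    {x : X → Fin N → ℂ} {D : Fin N → X →L[ℝ] ℂ} {t : X}
    (hx : ∀ l, HasFDerivAt (fun t => x t l) (D l) t) (h0 : ∀ l, x t l ≠ 0)
    (w : Fin (k + m) → ℂ) : HasFDerivAt (fun t => S.monoVal a (x t) w)
      (∑ l, (S.monoVal a (x t) w * (S.phaseMatrix a (.inl (.inl l)) / x t l)) • D l) t := by
  refine ((hasFDerivAt_prod_zpow hx h0 _).const_mul _).congr_fderiv ?_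
  rw [Finset.smul_sum]
  refine Finset.sum_congr rfl fun l _ => ?_
  rw [smul_smul, monoVal, mul_assoc]

theorem continuousOn_monoVal (a : S.Mono) :
    ContinuousOn (fun p : (Fin N → ℂ) × (Fin (k + m) → ℂ) => S.monoVal a p.1 p.2)
      ({x | ∀ j, x j ≠ 0} ×ˢ univ) := by
  unfold monoVal
  refine ContinuousOn.mul (Continuous.continuousOn (by fun_prop)) ?_
  refine continuousOn_finsetProd _ fun j _ => ?_
  exact ContinuousOn.zpow₀ (Continuous.continuousOn (by fun_prop)) _ fun p hp => Or.inl (hp.1 j)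

end CISystem

/-! ### Linear relations between fibre integrals -/

namespace FibreCycle

variable {N k m : ℕ} {S : CISystem N k m} {ζ : Fin k → ℂ} {V : Set (Fin (k + m) → ℂ)}
  (γ : FibreCycle S ζ V)

open CISystem

theorem continuousOn_monoVal (a : S.Mono) (p : Fin γ.numCells) :
    ContinuousOn (fun vt : (Fin (k + m) → ℂ) × (Fin N → ℝ) => S.monoVal a (γ.map p vt.2) vt.1)
      (V ×ˢ unitCube N) := by
  have hc := (γ.smooth p).continuous
  exact (S.continuousOn_monoVal a).comp
    (f := fun vt : (Fin (k + m) → ℂ) × (Fin N → ℝ) => (γ.map p vt.2, vt.1))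
    (Continuous.continuousOn (by fun_prop)) fun vt hvt => ⟨γ.ne_zero p _ hvt.2, mem_univ _⟩

theorem fiberEq_ne_zero (q : Fin k) (p : Fin γ.numCells) {v : Fin (k + m) → ℂ} (hv : v ∈ V)
    {t : Fin N → ℝ} (ht : t ∈ unitCube N) : S.fiberEq q (γ.map p t) v ≠ 0 := by
  rw [← γ.exp_lg p q v hv t ht]
  exact Complex.exp_ne_zero _

theorem continuousOn_fiberEq (q : Fin k) (p : Fin γ.numCells) :
    ContinuousOn (fun vt : (Fin (k + m) → ℂ) × (Fin N → ℝ) => S.fiberEq q (γ.map p vt.2) vt.1)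
      (V ×ˢ unitCube N) := by
  simp_rw [S.fiberEq_eq_sum]
  exact continuousOn_finsetSum _ fun a _ => continuousOn_const.mul (γ.continuousOn_monoVal a p)

/-- The integrand `∏_q (f_q + s_q) ^ (- η_q - 1) x ^ i` on a cell. -/
noncomputable def dens (η : Fin k → ℂ) (i : Fin N → ℤ) (p : Fin γ.numCells)
    (v : Fin (k + m) → ℂ) (t : Fin N → ℝ) : ℂ :=
  Complex.exp (-∑ q, (η q + 1) * γ.lg p q v t) * ∏ j, γ.map p t j ^ i j

/-- The quotient of the monomial `T_a` by the polynomial `f_q + s_q` to which it belongs. -/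
noncomputable def ratio (a : S.Mono) (p : Fin γ.numCells) (v : Fin (k + m) → ℂ)
    (t : Fin N → ℝ) : ℂ :=
  S.monoVal a (γ.map p t) v / S.fiberEq (S.block a) (γ.map p t) v

/-- The integral of a function times `dx_1 ∧ … ∧ dx_N` over the chain underlying `γ`. -/
noncomputable def chain (f : Fin γ.numCells → (Fin N → ℝ) → ℂ) : ℂ :=
  ∑ p, γ.coeff p * ∫ t in unitCube N, f p t * cubeJacobian (γ.map p) t

/-- The fibre integral over `γ` with an arbitrary exponent `η` in place of `ζ`. -/
noncomputable def gen (η : Fin k → ℂ) (i : Fin N → ℤ) (v : Fin (k + m) → ℂ) : ℂ :=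
  γ.chain fun p t => γ.dens η i p v t

/-- The fibre integral with the monomial `T_a` divided by `f_q + s_q` inserted. -/
noncomputable def genMono (a : S.Mono) (η : Fin k → ℂ) (i : Fin N → ℤ) (v : Fin (k + m) → ℂ) : ℂ :=
  γ.chain fun p t => γ.dens η i p v t * γ.ratio a p v t

theorem integral_eq_gen (i : Fin N → ℤ) (v : Fin (k + m) → ℂ) : γ.integral i v = γ.gen ζ i v := rfl

theorem continuousOn_dens_prod (η : Fin k → ℂ) (i : Fin N → ℤ) (p : Fin γ.numCells) :
    ContinuousOn (fun vt : (Fin (k + m) → ℂ) × (Fin N → ℝ) => γ.dens η i p vt.1 vt.2)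
      (V ×ˢ unitCube N) := by
  unfold dens
  have hc := (γ.smooth p).continuous
  refine ContinuousOn.mul ?_ (continuousOn_finsetProd _ fun j _ => ?_)
  · exact (continuousOn_finsetSum _ fun q _ =>
      continuousOn_const.mul (γ.lg_continuous p q)).neg.cexp
  · exact ContinuousOn.zpow₀ (Continuous.continuousOn (by fun_prop)) _
      fun _ hvt => Or.inl (γ.ne_zero p _ hvt.2 j)

theorem continuousOn_ratio_prod (a : S.Mono) (p : Fin γ.numCells) :
    ContinuousOn (fun vt : (Fin (k + m) → ℂ) × (Fin N → ℝ) => γ.ratio a p vt.1 vt.2)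
      (V ×ˢ unitCube N) :=
  (γ.continuousOn_monoVal a p).div (γ.continuousOn_fiberEq _ p)
    fun _ hvt => γ.fiberEq_ne_zero _ p hvt.1 hvt.2

theorem continuousOn_dens (η : Fin k → ℂ) (i : Fin N → ℤ) (p : Fin γ.numCells)
    {v : Fin (k + m) → ℂ} (hv : v ∈ V) : ContinuousOn (γ.dens η i p v) (unitCube N) :=
  (γ.continuousOn_dens_prod η i p).comp (f := fun t => (v, t)) (by fun_prop) fun _ ht => ⟨hv, ht⟩

theorem continuousOn_ratio (a : S.Mono) (p : Fin γ.numCells) {v : Fin (k + m) → ℂ} (hv : v ∈ V) :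
    ContinuousOn (γ.ratio a p v) (unitCube N) :=
  (γ.continuousOn_ratio_prod a p).comp (f := fun t => (v, t)) (by fun_prop) fun _ ht => ⟨hv, ht⟩

theorem chain_congr {f g : Fin γ.numCells → (Fin N → ℝ) → ℂ}
    (h : ∀ p, ∀ t ∈ unitCube N, f p t = g p t) : γ.chain f = γ.chain g := by
  refine Finset.sum_congr rfl fun p _ => ?_
  congr 1
  refine setIntegral_congr_fun (measurableSet_unitCube N) fun t ht => ?_
  simp only [h p t ht]

theorem chain_add {f g : Fin γ.numCells → (Fin N → ℝ) → ℂ}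
    (hf : ∀ p, ContinuousOn (f p) (unitCube N)) (hg : ∀ p, ContinuousOn (g p) (unitCube N)) :
    γ.chain (fun p t => f p t + g p t) = γ.chain f + γ.chain g := by
  simp only [chain]
  rw [← Finset.sum_add_distrib]
  refine Finset.sum_congr rfl fun p _ => ?_
  have hJ := (continuous_cubeJacobian (γ.smooth p)).continuousOn (s := unitCube N)
  have h := integral_add (((hf p).mul hJ).integrableOn_compact (isCompact_unitCube N))
    (((hg p).mul hJ).integrableOn_compact (isCompact_unitCube N)) (μ := volume.restrict (unitCube N))
  simp only [Pi.mul_apply] at h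
  rw [← mul_add, ← h]
  simp only [add_mul]

theorem chain_const_mul (r : ℂ) (f : Fin γ.numCells → (Fin N → ℝ) → ℂ) :
    γ.chain (fun p t => r * f p t) = r * γ.chain f := by
  simp only [chain, Finset.mul_sum]
  refine Finset.sum_congr rfl fun p _ => ?_
  simp only [mul_assoc]
  rw [integral_const_mul]
  ring

theorem chain_sum {ι : Type*} (s : Finset ι) {f : ι → Fin γ.numCells → (Fin N → ℝ) → ℂ}
    (hf : ∀ b p, ContinuousOn (f b p) (unitCube N)) :
    γ.chain (fun p t => ∑ b ∈ s, f b p t) = ∑ b ∈ s, γ.chain (f b) := by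
  classical
  induction s using Finset.induction_on with
  | empty => simp [chain]
  | insert b s hb ih =>
    simp only [Finset.sum_insert hb]
    rw [chain_add γ (hf b) (fun p => continuousOn_finsetSum _ fun b _ => hf b p), ih]

theorem chain_dens_mul_sum {v : Fin (k + m) → ℂ} (hv : v ∈ V) (η : Fin k → ℂ) (i : Fin N → ℤ)
    (r : S.Mono → ℂ) :
    γ.chain (fun p t => γ.dens η i p v t * ∑ a, r a * γ.ratio a p v t) =
      ∑ a, r a * γ.genMono a η i v := by
  have h1 : γ.chain (fun p t => γ.dens η i p v t * ∑ a, r a * γ.ratio a p v t) =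
      γ.chain (fun p t => ∑ a, r a * (γ.dens η i p v t * γ.ratio a p v t)) := by
    refine γ.chain_congr fun p t _ => ?_
    rw [Finset.mul_sum]
    exact Finset.sum_congr rfl fun a _ => by ring
  rw [h1, γ.chain_sum]
  · exact Finset.sum_congr rfl fun a _ => γ.chain_const_mul _ _
  · exact fun a p => continuousOn_const.mul ((γ.continuousOn_dens η i p hv).mul
      (γ.continuousOn_ratio a p hv))

theorem sum_phaseMatrix_y_mul_ratio {v : Fin (k + m) → ℂ} (hv : v ∈ V) (q : Fin k)
    (p : Fin γ.numCells) {t : Fin N → ℝ} (ht : t ∈ unitCube N) :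
    ∑ a, (S.phaseMatrix a (.inr (.inr q)) : ℂ) * γ.ratio a p v t = 1 := by
  have h0 := γ.fiberEq_ne_zero q p hv ht
  rw [← div_self h0]
  conv_rhs => rw [S.fiberEq_eq_sum, Finset.sum_div]
  refine Finset.sum_congr rfl fun a _ => ?_
  rw [S.phaseMatrix_y, ratio]
  split_ifs with h
  · rw [h, S.fiberEq_eq_sum, mul_div_assoc]
  · simp

/-- Homogeneity of degree one in the `y` variables. -/
theorem gen_eq_sum_y {v : Fin (k + m) → ℂ} (hv : v ∈ V) (η : Fin k → ℂ) (i : Fin N → ℤ)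
    (q : Fin k) :
    γ.gen η i v = ∑ a, (S.phaseMatrix a (.inr (.inr q)) : ℂ) * γ.genMono a η i v := by
  rw [← γ.chain_dens_mul_sum hv]
  refine γ.chain_congr fun p t ht => ?_
  rw [γ.sum_phaseMatrix_y_mul_ratio hv q p ht, mul_one]

/-- Each monomial lies in exactly one block, so the weighted logarithmic derivatives of the `f_q +
s_q` combine into one sum over monomials. -/
theorem sum_block (η : Fin k → ℂ) (r : S.Mono → ℂ) (X : S.Mono → ℂ) (f : Fin k → ℂ) :
    ∑ q, (η q + 1) * ((∑ a, (S.phaseMatrix a (.inr (.inr q)) : ℂ) * (r a * X a)) / f q) =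
      ∑ a, (r a * (η (S.block a) + 1)) * (X a / f (S.block a)) := by
  simp_rw [Finset.sum_div, Finset.mul_sum]
  rw [Finset.sum_comm]
  refine Finset.sum_congr rfl fun a _ => ?_
  simp only [S.phaseMatrix_y]
  rw [Finset.sum_eq_single (S.block a)]
  · simp; ring
  · intro q _ hq
    simp [hq.symm]
  · simp

theorem hasDerivAt_lg (hV : IsOpen V) (p : Fin γ.numCells) (q : Fin k) (c : Fin (k + m))
    {v : Fin (k + m) → ℂ} {σ : ℂ} (hv : coordLine v c σ ∈ V) {t : Fin N → ℝ}
    (ht : t ∈ unitCube N) :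
    HasDerivAt (fun σ : ℂ => γ.lg p q (coordLine v c σ) t)
      ((∑ a, (S.phaseMatrix a (.inr (.inr q)) : ℂ) * ((S.phaseMatrix a (paramVar c) : ℂ) *
        S.monoVal a (γ.map p t) (coordLine v c σ))) /
          S.fiberEq q (γ.map p t) (coordLine v c σ)) σ := by
  have hO : IsOpen (coordLine v c ⁻¹' V) := hV.preimage (continuous_coordLine v c)
  have hO' : coordLine v c ⁻¹' V ∈ 𝓝 σ := hO.mem_nhds hv
  have h1 : ContinuousOn (fun σ : ℂ => γ.lg p q (coordLine v c σ) t) (coordLine v c ⁻¹' V) :=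
    (γ.lg_continuous p q).comp (f := fun σ : ℂ => (coordLine v c σ, t))
      (((continuous_coordLine v c).prodMk continuous_const).continuousOn) fun σ hσ => ⟨hσ, ht⟩
  have h2 : HasDerivAt (fun σ => S.fiberEq q (γ.map p t) (coordLine v c σ))
      (∑ a, (S.phaseMatrix a (.inr (.inr q)) : ℂ) * ((S.phaseMatrix a (paramVar c) : ℂ) *
        S.monoVal a (γ.map p t) (coordLine v c σ))) σ := by
    simp_rw [S.fiberEq_eq_sum]
    exact HasDerivAt.fun_sum fun a _ => (S.hasDerivAt_monoVal a _ v c σ).const_mul _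
  have h3 : ∀ᶠ σ' in 𝓝 σ, Complex.exp (γ.lg p q (coordLine v c σ') t) =
      S.fiberEq q (γ.map p t) (coordLine v c σ') :=
    Filter.eventually_of_mem hO' fun σ' hσ' => γ.exp_lg p q _ hσ' t ht
  have h4 := hasDerivAt_of_exp_eq (L := fun σ : ℂ => γ.lg p q (coordLine v c σ) t)
    (F := fun σ => S.fiberEq q (γ.map p t) (coordLine v c σ)) (h1.continuousAt hO') h3 h2
  exact h4

theorem hasDerivAt_dens (hV : IsOpen V) (η : Fin k → ℂ) (i : Fin N → ℤ) (p : Fin γ.numCells)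
    (c : Fin (k + m)) {v : Fin (k + m) → ℂ} {σ : ℂ} (hv : coordLine v c σ ∈ V)
    {t : Fin N → ℝ} (ht : t ∈ unitCube N) :
    HasDerivAt (fun σ : ℂ => γ.dens η i p (coordLine v c σ) t)
      (γ.dens η i p (coordLine v c σ) t *
        ∑ a, -((S.phaseMatrix a (paramVar c) : ℂ) * (η (S.block a) + 1)) *
          γ.ratio a p (coordLine v c σ) t) σ := by
  have h1 := ((HasDerivAt.fun_sum (u := Finset.univ) fun q _ =>
    (γ.hasDerivAt_lg hV p q c hv ht).const_mul (η q + 1)).fun_neg.cexp).mul_const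
      (∏ j, γ.map p t j ^ i j)
  refine h1.congr_deriv ?_
  rw [sum_block]
  simp only [neg_mul, Finset.sum_neg_distrib, dens, ratio]
  ring

/-- The chain does not move with `v`, so one differentiates under the integral. Each parameter
contributes one equation, with coefficients its column of `L`, to the system for the quantities `(η
+ 1) * genMono`. -/
theorem hasDerivAt_gen (hV : IsOpen V) (η : Fin k → ℂ) (i : Fin N → ℤ) (c : Fin (k + m))
    {v : Fin (k + m) → ℂ} (hv : v ∈ V) :
    HasDerivAt (fun σ : ℂ => γ.gen η i (coordLine v c σ))
      (-∑ a, (S.phaseMatrix a (paramVar c) : ℂ) * ((η (S.block a) + 1) * γ.genMono a η i v)) 0 := by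
  set O : Set ℂ := coordLine v c ⁻¹' V with hOdef
  have hO : IsOpen O := hV.preimage (continuous_coordLine v c)
  have h0 : O ∈ 𝓝 (0 : ℂ) := hO.mem_nhds (by simpa [hOdef] using hv)
  have hmap : ∀ {f : (Fin (k + m) → ℂ) × (Fin N → ℝ) → ℂ}, ContinuousOn f (V ×ˢ unitCube N) →
      ContinuousOn (fun p : ℂ × (Fin N → ℝ) => f (coordLine v c p.1, p.2)) (O ×ˢ unitCube N) :=
    fun hf => hf.comp (f := fun p : ℂ × (Fin N → ℝ) => (coordLine v c p.1, p.2))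
      (((continuous_coordLine v c).comp continuous_fst).prodMk continuous_snd).continuousOn
      fun p hp => ⟨hp.1, hp.2⟩
  set r : S.Mono → ℂ := fun a => -((S.phaseMatrix a (paramVar c) : ℂ) * (η (S.block a) + 1)) with hr
  have hcell : ∀ p : Fin γ.numCells, HasDerivAt
      (fun σ : ℂ => ∫ t in unitCube N, γ.dens η i p (coordLine v c σ) t * cubeJacobian (γ.map p) t)
      (∫ t in unitCube N, γ.dens η i p (coordLine v c 0) t *
        (∑ a, r a * γ.ratio a p (coordLine v c 0) t) * cubeJacobian (γ.map p) t) 0 := by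
    intro p
    have hJ : Continuous fun q : ℂ × (Fin N → ℝ) => cubeJacobian (γ.map p) q.2 :=
      (continuous_cubeJacobian (γ.smooth p)).comp continuous_snd
    have hc1 := (hmap (γ.continuousOn_dens_prod η i p)).mul hJ.continuousOn
    have hc2 := ((hmap (γ.continuousOn_dens_prod η i p)).mul
      (continuousOn_finsetSum Finset.univ fun a _ => (continuousOn_const (c := r a)).mul
        (hmap (γ.continuousOn_ratio_prod a p)))).mul hJ.continuousOn
    exact hasDerivAt_integral_unitCube
      (F := fun σ t => γ.dens η i p (coordLine v c σ) t * cubeJacobian (γ.map p) t)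
      (F' := fun σ t => γ.dens η i p (coordLine v c σ) t *
        (∑ a, r a * γ.ratio a p (coordLine v c σ) t) * cubeJacobian (γ.map p) t)
      h0 hc1 hc2 fun σ hσ t ht => (γ.hasDerivAt_dens hV η i p c hσ ht).mul_const _
  have h1 := HasDerivAt.fun_sum (u := Finset.univ) fun p _ => (hcell p).const_mul (γ.coeff p)
  refine h1.congr_deriv ?_
  have h2 := γ.chain_dens_mul_sum hv η i r
  simp only [coordLine_zero]
  refine h2.trans ?_
  rw [← Finset.sum_neg_distrib]
  exact Finset.sum_congr rfl fun a _ => by ring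

/-- Dividing by `f_q + s_q` raises `η_q` by one, the `x`-part of the monomial shifts `i`, and its
`(s, s')`-part is constant on the fibre. -/
theorem genMono_eq {v : Fin (k + m) → ℂ} (hv : v ∈ V) (η : Fin k → ℂ) (i : Fin N → ℤ)
    (a : S.Mono) :
    γ.genMono a η i v = Complex.exp (∑ c, (S.phaseMatrix a (paramVar c) : ℂ) * v c) *
      γ.gen (fun q => η q + S.phaseMatrix a (.inr (.inr q)))
        (fun j => i j + S.phaseMatrix a (.inl (.inl j))) v := by
  rw [gen, ← γ.chain_const_mul]
  refine γ.chain_congr fun p t ht => ?_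
  have h1 : (∏ j, γ.map p t j ^ (i j + S.phaseMatrix a (.inl (.inl j)))) =
      (∏ j, γ.map p t j ^ i j) * ∏ j, γ.map p t j ^ S.phaseMatrix a (.inl (.inl j)) := by
    rw [← Finset.prod_mul_distrib]
    exact Finset.prod_congr rfl fun j _ => zpow_add₀ (γ.ne_zero p t ht j) _ _
  have h2 : ∑ q, (η q + S.phaseMatrix a (.inr (.inr q)) + 1) * γ.lg p q v t =
      (∑ q, (η q + 1) * γ.lg p q v t) + γ.lg p (S.block a) v t := by
    have h3 : γ.lg p (S.block a) v t =
        ∑ q, (S.phaseMatrix a (.inr (.inr q)) : ℂ) * γ.lg p q v t := by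
      simp [S.phaseMatrix_y]
    rw [h3, ← Finset.sum_add_distrib]
    exact Finset.sum_congr rfl fun q _ => by ring
  simp only [dens, ratio, h1, h2, neg_add, Complex.exp_add, CISystem.monoVal]
  rw [Complex.exp_neg (γ.lg p (S.block a) v t), γ.exp_lg p _ v hv t ht]
  ring

/-- The exact form in the direction of `x_j` gives a linear relation between fibre integrals. -/
theorem euler_x {v : Fin (k + m) → ℂ} (hv : v ∈ V) (n : Fin k → ℤ) (i : Fin N → ℤ) (j : Fin N) :
    ((i j : ℂ) + 1) * γ.gen (fun q => ζ q + n q) i v =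
      ∑ a, (S.phaseMatrix a (.inl (.inl j)) : ℂ) *
        (((ζ (S.block a) + n (S.block a)) + 1) * γ.genMono a (fun q => ζ q + n q) i v) := by
  classical
  set η : Fin k → ℂ := fun q => ζ q + n q with hη
  -- The primitive is `x_j` times the integrand; its derivative in `x_j` produces the factor `i_j +
  -- 1`.
  set i' : Fin N → ℤ := fun l => i l + if l = j then 1 else 0 with hi'
  have hprod : ∀ p, ∀ t ∈ unitCube N, γ.dens η i' p v t = γ.dens η i p v t * γ.map p t j := by
    intro p t ht
    simp only [dens, hi', mul_assoc]
    congr 1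
    rw [← Finset.mul_prod_erase _ _ (Finset.mem_univ j),
      ← Finset.mul_prod_erase _ (fun l => γ.map p t l ^ i l) (Finset.mem_univ j), if_pos rfl,
      zpow_add_one₀ (γ.ne_zero p t ht j)]
    rw [Finset.prod_congr rfl fun l hl => by rw [if_neg (Finset.ne_of_mem_erase hl), add_zero]]
    ring
  set g : Fin γ.numCells → Fin N → (Fin N → ℝ) → ℂ := fun p l t =>
    γ.dens η i' p v t * ((i' l / γ.map p t l) - ∑ a, ((S.phaseMatrix a (.inl (.inl l)) : ℂ) /
      γ.map p t l * (η (S.block a) + 1)) * γ.ratio a p v t) with hg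
  have hgj : ∀ p, ∀ t ∈ unitCube N, g p j t = γ.dens η i p v t * (((i j : ℂ) + 1) -
      ∑ a, ((S.phaseMatrix a (.inl (.inl j)) : ℂ) * (η (S.block a) + 1)) * γ.ratio a p v t) := by
    intro p t ht
    have h0 := γ.ne_zero p t ht j
    simp only [hg, hprod p t ht]
    rw [mul_assoc, mul_sub, Finset.mul_sum]
    congr 2
    · simp [hi']
      field_simp
    · refine Finset.sum_congr rfl fun a _ => ?_
      field_simp
  have hzero : γ.chain (fun p t => g p j t) = 0 := by
    refine sum_integral_unitCube_eq_zero (lt_of_le_of_lt (Nat.zero_le _) j.2) γ.coeff γ.smooth j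
      (h := fun p t => γ.dens η i' p v t) (g := g)
      (R := fun F F₀ => ∀ u' ∈ unitCube (N - 1), γ.map F.1 (cubeFace F.2.1 F.2.2 u') =
        γ.map F₀.1 (cubeFace F₀.2.1 F₀.2.2 u'))
      (fun p => γ.continuousOn_dens η i' p hv) (fun p => ?_) (fun p t ht => ?_) ?_ ?_ ?_
    · refine ContinuousOn.congr ?_ (hgj p)
      exact (γ.continuousOn_dens η i p hv).mul (continuousOn_const.sub
        (continuousOn_finsetSum _ fun a _ => continuousOn_const.mul (γ.continuousOn_ratio a p hv)))
    · have ht' : t ∈ unitCube N := interior_subset ht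
      have hx : ∀ l, HasFDerivAt (fun t => γ.map p t l)
          (ContinuousLinearMap.proj l ∘L fderiv ℝ (γ.map p) t) t := fun l =>
        (ContinuousLinearMap.proj (R := ℝ) (φ := fun _ : Fin N => ℂ) l).hasFDerivAt.comp t
          (((γ.smooth p).differentiable (by simp)).differentiableAt.hasFDerivAt)
      have h0 := γ.ne_zero p t ht'
      -- The branches are continuous only over the closed cube, hence differentiable in its
      -- interior, which suffices for Stokes' formula.
      have hlg : ∀ q, HasFDerivAt (fun t => γ.lg p q v t) ((S.fiberEq q (γ.map p t) v)⁻¹ •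
          ∑ a, (S.phaseMatrix a (.inr (.inr q)) : ℂ) • ∑ l, (S.monoVal a (γ.map p t) v *
            (S.phaseMatrix a (.inl (.inl l)) / γ.map p t l)) •
              (ContinuousLinearMap.proj l ∘L fderiv ℝ (γ.map p) t)) t := by
        intro q
        refine hasFDerivAt_of_exp_eq (F := fun t => S.fiberEq q (γ.map p t) v) ?_ ?_ ?_
        · have : ContinuousOn (fun t => γ.lg p q v t) (unitCube N) :=
            (γ.lg_continuous p q).comp (f := fun t => (v, t)) (by fun_prop) fun _ ht => ⟨hv, ht⟩
          exact this.continuousAt (mem_interior_iff_mem_nhds.1 ht)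
        · filter_upwards [mem_interior_iff_mem_nhds.1 ht] with t' ht'
          exact γ.exp_lg p q v hv t' ht'
        · simp_rw [S.fiberEq_eq_sum]
          exact HasFDerivAt.fun_sum fun a _ => (S.hasFDerivAt_monoVal a hx h0 v).const_mul _
      have h1 := ((HasFDerivAt.fun_sum (u := Finset.univ) fun q _ =>
        (hlg q).const_mul (η q + 1)).fun_neg.cexp).mul (hasFDerivAt_prod_zpow hx h0 i')
      refine h1.congr_fderiv ?_
      ext w
      have hs := fun l => sum_block (S := S) η
        (fun a => (S.phaseMatrix a (.inl (.inl l)) : ℂ) / γ.map p t l)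
        (fun a => S.monoVal a (γ.map p t) v) (fun q => S.fiberEq q (γ.map p t) v)
      set dx : Fin N → ℂ := fun l => fderiv ℝ (γ.map p) t w l with hdx
      set M : S.Mono → ℂ := fun a => S.monoVal a (γ.map p t) v with hM
      have hl : ∀ l, g p l t = γ.dens η i' p v t * ((i' l / γ.map p t l) -
          ∑ q, (η q + 1) * ((∑ a, (S.phaseMatrix a (.inr (.inr q)) : ℂ) *
            ((S.phaseMatrix a (.inl (.inl l)) : ℂ) / γ.map p t l * M a)) /
              S.fiberEq q (γ.map p t) v)) := by
        intro l
        rw [hs]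
        rfl
      simp only [sum_apply, smul_apply, add_apply, neg_apply, ContinuousLinearMap.comp_apply,
        ContinuousLinearMap.proj_apply, smul_eq_mul, hl]
      have hswap : ∑ l, (∑ q, (η q + 1) * ((∑ a, (S.phaseMatrix a (.inr (.inr q)) : ℂ) *
            ((S.phaseMatrix a (.inl (.inl l)) : ℂ) / γ.map p t l * M a)) /
              S.fiberEq q (γ.map p t) v)) * dx l =
          ∑ q, (η q + 1) * ((S.fiberEq q (γ.map p t) v)⁻¹ *
            ∑ a, (S.phaseMatrix a (.inr (.inr q)) : ℂ) * ∑ l, M a *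
              ((S.phaseMatrix a (.inl (.inl l)) : ℂ) / γ.map p t l) * dx l) := by
        simp only [Finset.sum_mul, Finset.mul_sum, Finset.sum_div]
        rw [Finset.sum_comm]
        refine Finset.sum_congr rfl fun q _ => ?_
        rw [Finset.sum_comm]
        refine Finset.sum_congr rfl fun a _ => Finset.sum_congr rfl fun l _ => ?_
        ring
      simp only [mul_sub, sub_mul, Finset.sum_sub_distrib, mul_assoc (γ.dens η i' p v t)]
      rw [← Finset.mul_sum, ← Finset.mul_sum, hswap]
      simp only [mul_assoc (∏ l, γ.map p t l ^ i' l), ← Finset.mul_sum, dens]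
      ring
    · exact ⟨fun _ _ _ => rfl, fun h u hu => (h u hu).symm,
        fun h h' u hu => (h u hu).trans (h' u hu)⟩
    · intro F F₀ hF u hu
      refine Filter.EventuallyEq.fderiv_eq ?_
      filter_upwards [mem_interior_iff_mem_nhds.1 hu] with u' hu'
      exact hF u' hu'
    · rintro ⟨p₀, j₀, e₀⟩ u hu
      have hcl := γ.closed v hv p₀ j₀ e₀ u hu
      -- `γ` is closed for the exponent `ζ`. Passing to `ζ + n` multiplies the branches by the
      -- integer powers in `B`, which are single-valued functions of the point and hence common to
      -- coinciding faces.
      set B : (Fin N → ℂ) → ℂ := fun x =>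
        (∏ q, S.fiberEq q x v ^ (-n q)) * ∏ l, x l ^ i' l with hB
      have hdens : ∀ p, ∀ t ∈ unitCube N, γ.dens η i' p v t =
          Complex.exp (-∑ q, (ζ q + 1) * γ.lg p q v t) * B (γ.map p t) := by
        intro p t ht
        simp only [dens, hB, ← mul_assoc]
        congr 1
        simp_rw [← γ.exp_lg p _ v hv t ht, ← Complex.exp_int_mul]
        rw [← Complex.exp_sum, ← Complex.exp_add, ← Finset.sum_neg_distrib,
          ← Finset.sum_neg_distrib, ← Finset.sum_add_distrib]
        congr 1
        refine Finset.sum_congr rfl fun q _ => ?_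
        simp only [hη]
        push_cast
        ring
      have hmem : ∀ j e, cubeFace j e u ∈ unitCube N := by
        intro j e
        obtain ⟨N', rfl⟩ : ∃ N', N = N' + 1 := ⟨N - 1, by have := j.2; omega⟩
        exact cubeFace_mem j e hu
      refine Eq.trans ?_ ((congrArg (· * B (γ.map p₀ (cubeFace j₀ e₀ u))) hcl).trans (zero_mul _))
      simp only [Finset.sum_mul]
      refine Finset.sum_congr rfl fun p _ => Finset.sum_congr rfl fun j _ =>
        Finset.sum_congr rfl fun e _ => ?_
      split_ifs with h
      · rw [hdens p _ (hmem j e), h u hu]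
        ring
      · simp
  have h3 : γ.chain (fun p t => g p j t) = γ.chain (fun p t => ((i j : ℂ) + 1) * γ.dens η i p v t +
      (-1) * (γ.dens η i p v t * ∑ a, ((S.phaseMatrix a (.inl (.inl j)) : ℂ) *
        (η (S.block a) + 1)) * γ.ratio a p v t)) :=
    γ.chain_congr fun p t ht => by rw [hgj p t ht]; ring
  rw [h3, chain_add, chain_const_mul, chain_const_mul, γ.chain_dens_mul_sum hv] at hzero
  · rw [gen]
    have h4 : ∀ a, (S.phaseMatrix a (.inl (.inl j)) : ℂ) *
        (((ζ (S.block a) + n (S.block a)) + 1) * γ.genMono a η i v) =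
        ((S.phaseMatrix a (.inl (.inl j)) : ℂ) * (η (S.block a) + 1)) * γ.genMono a η i v :=
      fun a => by rw [mul_assoc]
    simp_rw [h4]
    linear_combination hzero
  · exact fun p => continuousOn_const.mul (γ.continuousOn_dens η i p hv)
  · exact fun p => continuousOn_const.mul ((γ.continuousOn_dens η i p hv).mul
      (continuousOn_finsetSum _ fun a _ => continuousOn_const.mul (γ.continuousOn_ratio a p hv)))

/-- The linear relations between the fibre integrals, solved for the shifted integrals. -/
theorem scaled_genMono {Δ : ℤ} {T : Matrix (PhaseVar N k m) S.Mono ℤ}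
    (h : S.IsScaledInverse Δ T) {v : Fin (k + m) → ℂ} (hv : v ∈ V) (n : Fin k → ℤ)
    (i : Fin N → ℤ) (b : S.Mono) (d : Fin (k + m) → ℂ)
    (hd : ∀ c, d c = -∑ a, (S.phaseMatrix a (paramVar c) : ℂ) *
      (((ζ (S.block a) + n (S.block a)) + 1) * γ.genMono a (fun q => ζ q + n q) i v)) :
    (Δ : ℂ) * ((ζ (S.block b) + n (S.block b) + 1) * γ.genMono b (fun q => ζ q + n q) i v) =
      ((∑ j, (T (.inl (.inl j)) b : ℂ) * ((i j : ℂ) + 1)) +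
        ∑ q, (T (.inr (.inr q)) b : ℂ) * (ζ q + n q + 1)) * γ.gen (fun q => ζ q + n q) i v -
        ∑ c, (T (paramVar c) b : ℂ) * d c := by
  set η : Fin k → ℂ := fun q => ζ q + n q with hη
  set Y : S.Mono → ℂ := fun a => (ζ (S.block a) + n (S.block a) + 1) * γ.genMono a η i v with hY
  have hy : ∀ q, (ζ q + n q + 1) * γ.gen η i v =
      ∑ a, (S.phaseMatrix a (.inr (.inr q)) : ℂ) * Y a := by
    intro q
    rw [γ.gen_eq_sum_y hv η i q, Finset.mul_sum]
    refine Finset.sum_congr rfl fun a _ => ?_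
    simp only [S.phaseMatrix_y, hY]
    split_ifs with hq
    · rw [hq]; push_cast; ring
    · simp
  -- `L T = Δ` isolates `Y b`. The inner sums are known for each kind of variable `c`: from
  -- `euler_x` for `x`, from `hd` for the parameters, from `hy` for `y`.
  have h1 : ∑ c, (T c b : ℂ) * ∑ a, (S.phaseMatrix a c : ℂ) * Y a = Δ * Y b := by
    simp_rw [Finset.mul_sum]
    rw [Finset.sum_comm]
    have h2 : ∀ a, ∑ c, (T c b : ℂ) * ((S.phaseMatrix a c : ℂ) * Y a) =
        if a = b then Δ * Y b else 0 := by
      intro a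
      have h3 : ∑ c, (S.phaseMatrix a c : ℂ) * (T c b : ℂ) = if a = b then (Δ : ℂ) else 0 := by
        have := h.mul_apply a b
        have h4 := congrArg (Int.cast : ℤ → ℂ) this
        push_cast at h4
        exact h4
      calc _ = (∑ c, (S.phaseMatrix a c : ℂ) * (T c b : ℂ)) * Y a := by
            rw [Finset.sum_mul]
            exact Finset.sum_congr rfl fun c _ => by ring
        _ = _ := by
            rw [h3]
            split_ifs with hab
            · rw [hab]
            · simp
    simp_rw [h2]
    simp
  rw [sum_phaseVar] at h1
  have e1 : ∑ j, (T (.inl (.inl j)) b : ℂ) * ∑ a, (S.phaseMatrix a (.inl (.inl j)) : ℂ) * Y a =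
      (∑ j, (T (.inl (.inl j)) b : ℂ) * ((i j : ℂ) + 1)) * γ.gen η i v := by
    rw [Finset.sum_mul]
    refine Finset.sum_congr rfl fun j _ => ?_
    rw [mul_assoc]
    exact congrArg _ (γ.euler_x hv n i j).symm
  have e2 : ∑ c, (T (paramVar c) b : ℂ) * ∑ a, (S.phaseMatrix a (paramVar c) : ℂ) * Y a =
      -∑ c, (T (paramVar c) b : ℂ) * d c := by
    rw [← Finset.sum_neg_distrib]
    refine Finset.sum_congr rfl fun c _ => ?_
    rw [hd c, mul_neg, neg_neg]
  have e3 : ∑ q, (T (.inr (.inr q)) b : ℂ) * ∑ a, (S.phaseMatrix a (.inr (.inr q)) : ℂ) * Y a =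
      (∑ q, (T (.inr (.inr q)) b : ℂ) * (ζ q + n q + 1)) * γ.gen η i v := by
    rw [Finset.sum_mul]
    refine Finset.sum_congr rfl fun q _ => ?_
    rw [mul_assoc, hy q]
  rw [e1, e2, e3] at h1
  rw [← h1]
  ring

end FibreCycle

/-! ### The Mellin kernel in logarithmic coordinates -/

theorem cubeFace_mem_unitCube {n : ℕ} (j : Fin n) (e : Bool) {u : Fin (n - 1) → ℝ}
    (hu : u ∈ unitCube (n - 1)) : cubeFace j e u ∈ unitCube n := by
  cases n with
  | zero => exact j.elim0
  | succ n => exact cubeFace_mem j e hu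

theorem differentiable_cubeFace {n : ℕ} (j : Fin n) (e : Bool) :
    Differentiable ℝ (cubeFace j e) := by
  cases n with
  | zero => exact j.elim0
  | succ n => exact fun u => (hasFDerivAt_cubeFace j e u).differentiableAt

/-- The function `s ^ Z` of the logarithms `w` of `s`. -/
noncomputable def expKernel {n : ℕ} (Z w : Fin n → ℂ) : ℂ := Complex.exp (∑ c, Z c * w c)

/-- The partial derivative of a function on `ℂⁿ`. -/
noncomputable def partialDeriv {n : ℕ} (c : Fin n) (G : (Fin n → ℂ) → ℂ) (w : Fin n → ℂ) : ℂ :=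
  fderiv ℂ G w (Pi.single c 1)

section Kernel

variable {n : ℕ}

theorem hasFDerivAt_expKernel (Z w : Fin n → ℂ) :
    HasFDerivAt (expKernel Z) (expKernel Z w • ∑ c, Z c • ContinuousLinearMap.proj (R := ℂ)
      (φ := fun _ : Fin n => ℂ) c) w :=
  (HasFDerivAt.fun_sum fun c _ => (hasFDerivAt_apply (𝕜 := ℂ) c w).const_mul (Z c)).cexp

theorem differentiable_expKernel (Z : Fin n → ℂ) : Differentiable ℂ (expKernel Z) :=
  fun w => (hasFDerivAt_expKernel Z w).differentiableAt

theorem expKernel_add (Z Z' w : Fin n → ℂ) :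
    expKernel (Z + Z') w = expKernel Z w * expKernel Z' w := by
  simp only [expKernel, ← Complex.exp_add, Pi.add_apply, add_mul, Finset.sum_add_distrib]

theorem partialDeriv_expKernel_mul (Z : Fin n → ℂ) {G : (Fin n → ℂ) → ℂ} {w : Fin n → ℂ}
    (hG : DifferentiableAt ℂ G w) (c : Fin n) :
    partialDeriv c (fun w => expKernel Z w * G w) w =
      expKernel Z w * (Z c * G w + partialDeriv c G w) := by
  have h := ((hasFDerivAt_expKernel Z w).mul hG.hasFDerivAt).fderiv
  change fderiv ℂ (expKernel Z * G) w _ = _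
  rw [h]
  simp [partialDeriv, Pi.single_apply]
  ring

theorem hasDerivAt_comp_coordLine {G : (Fin n → ℂ) → ℂ} {w : Fin n → ℂ}
    (hG : DifferentiableAt ℂ G w) (c : Fin n) :
    HasDerivAt (fun σ : ℂ => G (coordLine w c σ)) (partialDeriv c G w) 0 := by
  have h1 : HasFDerivAt G (fderiv ℂ G w) (coordLine w c 0) := by
    rw [coordLine_zero]; exact hG.hasFDerivAt
  exact h1.comp_hasDerivAt 0 (hasDerivAt_coordLine w c 0)

theorem DifferentiableOn.partialDeriv {G : (Fin n → ℂ) → ℂ} {U : Set (Fin n → ℂ)} (hU : IsOpen U)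
    (hG : DifferentiableOn ℂ G U) (c : Fin n) : DifferentiableOn ℂ (partialDeriv c G) U :=
  hG.fderiv_apply_const hU _

/-- Maps with the same exponentials have the same derivative. -/
theorem fderiv_eq_of_exp_eventuallyEq {X : Type*} [NormedAddCommGroup X] [NormedSpace ℝ X]
    {φ ψ : X → Fin n → ℂ} {u : X} (hφ : DifferentiableAt ℝ φ u) (hψ : DifferentiableAt ℝ ψ u)
    (h : ∀ᶠ u' in 𝓝 u, ∀ c, Complex.exp (φ u' c) = Complex.exp (ψ u' c)) :
    fderiv ℝ φ u = fderiv ℝ ψ u := by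
  have h1 : ∀ c, ContinuousLinearMap.proj c ∘L fderiv ℝ φ u =
      ContinuousLinearMap.proj c ∘L fderiv ℝ ψ u := by
    intro c
    have hc : (fun u' => Complex.exp (φ u' c)) =ᶠ[𝓝 u] fun u' => Complex.exp (ψ u' c) := by
      filter_upwards [h] with u' hu'
      exact hu' c
    have e1 := (hasFDerivAt_pi'.1 hφ.hasFDerivAt c).cexp
    have e2 := (hasFDerivAt_pi'.1 hψ.hasFDerivAt c).cexp
    have := (e1.congr_of_eventuallyEq hc.symm).unique e2
    rw [h.self_of_nhds c] at this
    exact smul_right_injective _ (Complex.exp_ne_zero _) this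
  ext w c
  exact congrArg (fun D => D w) (h1 c)

theorem hasFDerivAt_comp_map {H : (Fin n → ℂ) → ℂ} {φ : (Fin n → ℝ) → (Fin n → ℂ)} {t : Fin n → ℝ}
    (hφ : DifferentiableAt ℝ φ t) (hH : DifferentiableAt ℂ H (φ t)) :
    HasFDerivAt (𝕜 := ℝ) (fun t => H (φ t))
      (∑ l, partialDeriv l H (φ t) • (ContinuousLinearMap.proj l ∘L fderiv ℝ φ t)) t := by
  have h1 := (hH.hasFDerivAt.restrictScalars ℝ).comp t hφ.hasFDerivAt
  refine h1.congr_fderiv ?_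
  ext w
  have h2 := LinearMap.pi_apply_eq_sum_univ (fderiv ℂ H (φ t)).toLinearMap (fderiv ℝ φ t w)
  simp only [ContinuousLinearMap.coe_coe, smul_eq_mul] at h2
  simp only [ContinuousLinearMap.comp_apply, ContinuousLinearMap.coe_restrictScalars', h2,
    sum_apply, smul_apply, ContinuousLinearMap.proj_apply, smul_eq_mul, partialDeriv]
  refine Finset.sum_congr rfl fun l _ => ?_
  rw [mul_comm]
  congr 2
  ext j
  simp [Pi.single_apply, eq_comm]

end Kernel

/-! ### Integration by parts over the Mellin cycle -/

namespace MellinCycle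

variable {N k m : ℕ} {S : CISystem N k m} {i : Fin N → ℤ} {ζ : Fin k → ℂ} (C : MellinCycle S i ζ)

open CISystem

/-- The value of a polynomial at `exp (2πi Z)`. -/
noncomputable def polyVal {n : ℕ} (P : MvPolynomial (Fin n) ℂ) (Z : Fin n → ℂ) : ℂ :=
  MvPolynomial.eval
    (fun c => Complex.exp (2 * (Real.pi : ℂ) * Complex.I * (Z c / ((1 : ℤ) : ℂ)))) P

theorem expEval_one_eq (P : MvPolynomial (Fin (k + m)) ℂ) (z : Fin k → ℂ) (z' : Fin m → ℂ) :
    expEval 1 P z z' = polyVal P (Fin.append z z') := rfl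

theorem append_split (Z : Fin (k + m) → ℂ) :
    Fin.append (fun q => Z (Fin.castAdd m q)) (fun j => Z (Fin.natAdd k j)) = Z := by
  ext c
  refine Fin.addCases (fun q => ?_) (fun j => ?_) c <;> simp

/-- The coefficients of the cycle are finite. -/
def Regular (Z : Fin (k + m) → ℂ) : Prop := ∀ p, polyVal (C.den p) Z ≠ 0

/-- The coefficient of a cell. -/
noncomputable def coef (p : Fin C.numCells) (Z : Fin (k + m) → ℂ) : ℂ :=
  polyVal (C.num p) Z / polyVal (C.den p) Z

/-- Two faces coincide in the torus. -/
def SameFace (F F₀ : Fin C.numCells × Fin (k + m) × Bool) : Prop :=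
  ∀ u' ∈ unitCube (k + m - 1), ∀ c, Complex.exp (C.map F.1 (cubeFace F.2.1 F.2.2 u') c)
    = Complex.exp (C.map F₀.1 (cubeFace F₀.2.1 F₀.2.2 u') c)

open Classical in
/-- The sum of the germs carried by the faces that coincide with `F₀`. -/
noncomputable def germSum (G : Fin C.numCells → (Fin (k + m) → ℂ) → ℂ) (Z : Fin (k + m) → ℂ)
    (F₀ : Fin C.numCells × Fin (k + m) × Bool) (u : Fin (k + m - 1) → ℝ) (h : Fin (k + m) → ℂ) : ℂ :=
  ∑ p, ∑ j, ∑ e, (if C.SameFace (p, j, e) F₀ then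
    faceSign j e * C.coef p Z * (expKernel Z (C.map p (cubeFace j e u) + h) *
      G p (C.map p (cubeFace j e u) + h)) else 0)

/-- Holomorphic functions on the domains of the cells whose germs cancel along the faces. -/
structure Admissible (G : Fin C.numCells → (Fin (k + m) → ℂ) → ℂ) : Prop where
  diff : ∀ p, DifferentiableOn ℂ (G p) (C.dom p)
  closed : ∀ Z, C.Regular Z → ∀ F₀, ∀ u ∈ unitCube (k + m - 1), ∀ᶠ h in 𝓝 0,
    C.germSum G Z F₀ u h = 0

theorem isOpen_dom (p : Fin C.numCells) : IsOpen (C.dom p) := (C.isFibreIntegral p).1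

theorem admissible_J : C.Admissible C.J where
  diff p := (C.isFibreIntegral p).2.2.1
  closed Z hZ F₀ u hu := by
    have := C.closed (fun q => Z (Fin.castAdd m q)) (fun j => Z (Fin.natAdd k j))
      (fun p => by rw [expEval_one_eq, append_split]; exact hZ p) F₀.1 F₀.2.1 F₀.2.2 u hu
    filter_upwards [this] with h hh
    simp only [expEval_one_eq, mellinKernel, append_split] at hh
    exact hh

variable {C} {G G' : Fin C.numCells → (Fin (k + m) → ℂ) → ℂ}

theorem germSum_add (Z : Fin (k + m) → ℂ)
    (F₀ : Fin C.numCells × Fin (k + m) × Bool) (u : Fin (k + m - 1) → ℝ) (h : Fin (k + m) → ℂ) :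
    C.germSum (fun p w => G p w + G' p w) Z F₀ u h =
      C.germSum G Z F₀ u h + C.germSum G' Z F₀ u h := by
  simp only [germSum, ← Finset.sum_add_distrib]
  refine Finset.sum_congr rfl fun p _ => Finset.sum_congr rfl fun j _ =>
    Finset.sum_congr rfl fun e _ => ?_
  split_ifs
  · ring
  · simp

theorem germSum_const_mul (r : ℂ) (Z : Fin (k + m) → ℂ)
    (F₀ : Fin C.numCells × Fin (k + m) × Bool) (u : Fin (k + m - 1) → ℝ) (h : Fin (k + m) → ℂ) :
    C.germSum (fun p w => r * G p w) Z F₀ u h = r * C.germSum G Z F₀ u h := by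
  simp only [germSum, Finset.mul_sum]
  refine Finset.sum_congr rfl fun p _ => Finset.sum_congr rfl fun j _ =>
    Finset.sum_congr rfl fun e _ => ?_
  split_ifs
  · ring
  · simp

theorem Admissible.add (hG : C.Admissible G) (hG' : C.Admissible G') :
    C.Admissible fun p w => G p w + G' p w where
  diff p := (hG.diff p).add (hG'.diff p)
  closed Z hZ F₀ u hu := by
    filter_upwards [hG.closed Z hZ F₀ u hu, hG'.closed Z hZ F₀ u hu] with h h1 h2
    rw [germSum_add, h1, h2, add_zero]

theorem Admissible.const_mul (hG : C.Admissible G) (r : ℂ) :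
    C.Admissible fun p w => r * G p w where
  diff p := (hG.diff p).const_mul r
  closed Z hZ F₀ u hu := by
    filter_upwards [hG.closed Z hZ F₀ u hu] with h h1
    rw [germSum_const_mul, h1, mul_zero]

theorem Admissible.sum {ι : Type*} (s : Finset ι)
    {G : ι → Fin C.numCells → (Fin (k + m) → ℂ) → ℂ} (hG : ∀ b, C.Admissible (G b)) :
    C.Admissible fun p w => ∑ b ∈ s, G b p w := by
  classical
  induction s using Finset.induction_on with
  | empty =>
    refine ⟨fun p => by simp, fun Z _ F₀ u _ => Filter.Eventually.of_forall fun h => ?_⟩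
    simp [germSum]
  | insert b s hb ih =>
    simp only [Finset.sum_insert hb]
    exact (hG b).add ih

/-- Differentiating the relation between the germs. -/
theorem Admissible.partialDeriv (hG : C.Admissible G) (c : Fin (k + m)) :
    C.Admissible fun p => partialDeriv c (G p) where
  diff p := (hG.diff p).partialDeriv (C.isOpen_dom p) c
  closed Z hZ F₀ u hu := by
    -- The relation is needed on a neighbourhood of each small `h`, so that it can be differentiated
    -- there.
    have hev := (hG.closed Z hZ F₀ u hu).eventually_nhds
    have hdom : ∀ p j e, ∀ᶠ h : Fin (k + m) → ℂ in 𝓝 0,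
        C.map p (cubeFace j e u) + h ∈ C.dom p := by
      intro p j e
      have h1 : Filter.Tendsto (fun h : Fin (k + m) → ℂ => C.map p (cubeFace j e u) + h) (𝓝 0)
          (𝓝 (C.map p (cubeFace j e u))) := by
        have : Continuous fun h : Fin (k + m) → ℂ => C.map p (cubeFace j e u) + h := by fun_prop
        simpa using this.tendsto 0
      exact h1 ((C.isOpen_dom p).mem_nhds (C.map_mem p _ (cubeFace_mem_unitCube j e hu)))
    have hdom' : ∀ᶠ h : Fin (k + m) → ℂ in 𝓝 0, ∀ p j e,
        C.map p (cubeFace j e u) + h ∈ C.dom p := by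
      simpa only [Filter.eventually_all] using hdom
    filter_upwards [hev, hdom'] with h hh hd
    classical
    have hterm : ∀ p j e, HasDerivAt (fun σ : ℂ => if C.SameFace (p, j, e) F₀ then
        faceSign j e * C.coef p Z * (expKernel Z (C.map p (cubeFace j e u) + coordLine h c σ) *
          G p (C.map p (cubeFace j e u) + coordLine h c σ)) else 0)
        (if C.SameFace (p, j, e) F₀ then
        faceSign j e * C.coef p Z * (expKernel Z (C.map p (cubeFace j e u) + h) *
          (Z c * G p (C.map p (cubeFace j e u) + h) +
            _root_.partialDeriv c (G p) (C.map p (cubeFace j e u) + h))) else 0) 0 := by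
      intro p j e
      split_ifs
      · refine HasDerivAt.const_mul _ ?_
        have hGd : DifferentiableAt ℂ (G p) (C.map p (cubeFace j e u) + h) :=
          (hG.diff p).differentiableAt ((C.isOpen_dom p).mem_nhds (hd p j e))
        rw [← partialDeriv_expKernel_mul Z hGd]
        have := hasDerivAt_comp_coordLine
          (((differentiable_expKernel Z).differentiableAt).mul hGd) c
        have hline : ∀ σ, coordLine (C.map p (cubeFace j e u) + h) c σ =
            C.map p (cubeFace j e u) + coordLine h c σ := fun σ => by
          simp only [coordLine, add_assoc]
        simp only [hline] at this
        exact this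
      · exact hasDerivAt_const _ _
    -- The term with `Z c` comes from differentiating the kernel. It is a multiple of the original
    -- relation, so the relation for the derivatives remains.
    have hsum : HasDerivAt (fun σ : ℂ => C.germSum G Z F₀ u (coordLine h c σ))
        (Z c * C.germSum G Z F₀ u h +
          C.germSum (fun p => _root_.partialDeriv c (G p)) Z F₀ u h) 0 := by
      have := HasDerivAt.fun_sum (u := Finset.univ) fun p _ =>
        HasDerivAt.fun_sum (u := Finset.univ) fun j _ =>
          HasDerivAt.fun_sum (u := Finset.univ) fun e _ => hterm p j e
      refine this.congr_deriv ?_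
      rw [← germSum_const_mul, ← germSum_add]
      rfl
    have hzero : (fun σ : ℂ => C.germSum G Z F₀ u (coordLine h c σ)) =ᶠ[𝓝 0] fun _ => 0 := by
      have h1 : Filter.Tendsto (coordLine h c) (𝓝 0) (𝓝 h) := by
        simpa using (continuous_coordLine h c).tendsto 0
      exact h1 hh
    have := (hsum.congr_of_eventuallyEq hzero.symm).unique (hasDerivAt_const (0 : ℂ) (0 : ℂ))
    rw [hh.self_of_nhds, mul_zero, zero_add] at this
    exact this

variable (C) in
/-- The Mellin transform of a family of functions on the domains of the cells. -/
noncomputable def pairing (Z : Fin (k + m) → ℂ) (G : Fin C.numCells → (Fin (k + m) → ℂ) → ℂ) : ℂ :=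
  ∑ p, C.coef p Z * ∫ t in unitCube (k + m),
    expKernel Z (C.map p t) * G p (C.map p t) * cubeJacobian (C.map p) t

theorem mellin_eq_pairing (z : Fin k → ℂ) (z' : Fin m → ℂ) :
    C.mellin z z' = C.pairing (Fin.append z z') C.J := rfl

theorem continuousOn_comp_map (p : Fin C.numCells) {g : (Fin (k + m) → ℂ) → ℂ}
    (hg : DifferentiableOn ℂ g (C.dom p)) :
    ContinuousOn (fun t => g (C.map p t)) (unitCube (k + m)) :=
  hg.continuousOn.comp (C.smooth p).continuous.continuousOn (C.map_mem p)

theorem continuousOn_integrand (hG : ∀ p, DifferentiableOn ℂ (G p) (C.dom p))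
    (p : Fin C.numCells) (Z : Fin (k + m) → ℂ) :
    ContinuousOn (fun t => expKernel Z (C.map p t) * G p (C.map p t) * cubeJacobian (C.map p) t)
      (unitCube (k + m)) :=
  (((differentiable_expKernel Z).continuous.comp (C.smooth p).continuous).continuousOn.mul
    (continuousOn_comp_map p (hG p))).mul (continuous_cubeJacobian (C.smooth p)).continuousOn

theorem pairing_congr {Z : Fin (k + m) → ℂ} (h : ∀ p, ∀ w ∈ C.dom p, G p w = G' p w) :
    C.pairing Z G = C.pairing Z G' := by
  refine Finset.sum_congr rfl fun p _ => ?_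
  congr 1
  refine setIntegral_congr_fun (measurableSet_unitCube _) fun t ht => ?_
  simp only [h p _ (C.map_mem p t ht)]

theorem pairing_add (hG : ∀ p, DifferentiableOn ℂ (G p) (C.dom p))
    (hG' : ∀ p, DifferentiableOn ℂ (G' p) (C.dom p)) (Z : Fin (k + m) → ℂ) :
    C.pairing Z (fun p w => G p w + G' p w) = C.pairing Z G + C.pairing Z G' := by
  simp only [pairing]
  rw [← Finset.sum_add_distrib]
  refine Finset.sum_congr rfl fun p _ => ?_
  have h := integral_add
    ((continuousOn_integrand hG p Z).integrableOn_compact (isCompact_unitCube _))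
    ((continuousOn_integrand hG' p Z).integrableOn_compact (isCompact_unitCube _))
    (μ := volume.restrict (unitCube (k + m)))
  rw [← mul_add, ← h]
  simp only [mul_add, add_mul]

theorem pairing_const_mul (r : ℂ) (Z : Fin (k + m) → ℂ) :
    C.pairing Z (fun p w => r * G p w) = r * C.pairing Z G := by
  simp only [pairing, Finset.mul_sum]
  refine Finset.sum_congr rfl fun p _ => ?_
  rw [mul_left_comm, ← integral_const_mul r]
  congr 1
  refine integral_congr_ae (Filter.Eventually.of_forall fun t => ?_)
  ring

theorem pairing_sum {ι : Type*} (s : Finset ι)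
    {G : ι → Fin C.numCells → (Fin (k + m) → ℂ) → ℂ}
    (hG : ∀ b p, DifferentiableOn ℂ (G b p) (C.dom p)) (Z : Fin (k + m) → ℂ) :
    C.pairing Z (fun p w => ∑ b ∈ s, G b p w) = ∑ b ∈ s, C.pairing Z (G b) := by
  classical
  induction s using Finset.induction_on with
  | empty => simp [pairing]
  | insert b s hb ih =>
    simp only [Finset.sum_insert hb]
    rw [pairing_add (hG b) (fun p => DifferentiableOn.fun_sum fun b _ => hG b p), ih]

/-- Integration by parts. -/
theorem pairing_partialDeriv (hkm : 0 < k + m) (hG : C.Admissible G) {Z : Fin (k + m) → ℂ}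
    (hZ : C.Regular Z) (c : Fin (k + m)) :
    C.pairing Z (fun p => partialDeriv c (G p)) = -Z c * C.pairing Z G := by
  classical
  have hH : ∀ p, DifferentiableOn ℂ (fun w => expKernel Z w * G p w) (C.dom p) := fun p =>
    (differentiable_expKernel Z).differentiableOn.mul (hG.diff p)
  have hGd : ∀ p, ∀ t ∈ unitCube (k + m), DifferentiableAt ℂ (G p) (C.map p t) := fun p t ht =>
    (hG.diff p).differentiableAt ((C.isOpen_dom p).mem_nhds (C.map_mem p t ht))
  have hHd : ∀ p, ∀ t ∈ unitCube (k + m),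
      DifferentiableAt ℂ (fun w => expKernel Z w * G p w) (C.map p t) := fun p t ht =>
    (hH p).differentiableAt ((C.isOpen_dom p).mem_nhds (C.map_mem p t ht))
  -- Faces need to coincide only in the torus: equal exponentials force equal derivatives of the
  -- logarithmic maps. Only the values at `h = 0` enter; the cancellation of whole germs is what
  -- makes derivatives admissible again.
  have key := sum_integral_unitCube_eq_zero hkm (fun p => C.coef p Z) C.smooth c
    (h := fun p t => expKernel Z (C.map p t) * G p (C.map p t))
    (g := fun p l t => partialDeriv l (fun w => expKernel Z w * G p w) (C.map p t))
    (R := C.SameFace)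
    (fun p => continuousOn_comp_map p (hH p))
    (fun p => continuousOn_comp_map p ((hH p).partialDeriv (C.isOpen_dom p) c))
    (fun p t ht => hasFDerivAt_comp_map (H := fun w => expKernel Z w * G p w)
      ((C.smooth p).differentiable (by simp)).differentiableAt (hHd p t (interior_subset ht)))
    ⟨fun _ _ _ _ => rfl, fun h u hu c => (h u hu c).symm,
      fun h h' u hu c => (h u hu c).trans (h' u hu c)⟩
    (fun F F₀ hF u hu => by
      refine fderiv_eq_of_exp_eventuallyEq ?_ ?_ ?_
      · exact (((C.smooth F.1).differentiable (by simp)).comp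
          (differentiable_cubeFace _ _)).differentiableAt
      · exact (((C.smooth F₀.1).differentiable (by simp)).comp
          (differentiable_cubeFace _ _)).differentiableAt
      · filter_upwards [mem_interior_iff_mem_nhds.1 hu] with u' hu'
        exact hF u' hu')
    (fun F₀ u hu => by
      have := (hG.closed Z hZ F₀ u hu).self_of_nhds
      simpa only [germSum, add_zero] using this)
  have h1 : C.pairing Z (fun p w => Z c * G p w + partialDeriv c (G p) w) = 0 := by
    rw [← key]
    refine Finset.sum_congr rfl fun p _ => ?_
    congr 1
    refine setIntegral_congr_fun (measurableSet_unitCube _) fun t ht => ?_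
    simp only [partialDeriv_expKernel_mul Z (hGd p t ht)]
  rw [pairing_add (fun p => (hG.diff p).const_mul _)
    (fun p => (hG.diff p).partialDeriv (C.isOpen_dom p) c), pairing_const_mul] at h1
  linear_combination h1

theorem polyVal_add_single {n : ℕ} (P : MvPolynomial (Fin n) ℂ) (Z : Fin n → ℂ) (c : Fin n)
    (d : ℤ) : polyVal P (Z + Pi.single c (d : ℂ)) = polyVal P Z := by
  rw [polyVal, polyVal]
  congr 2
  ext c'
  by_cases h : c' = c
  · subst h
    simp only [Pi.add_apply, Pi.single_eq_same, Int.cast_one, div_one, mul_add, Complex.exp_add]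
    rw [mul_comm _ (d : ℂ), Complex.exp_int_mul_two_pi_mul_I, mul_one]
  · simp [h]

theorem Regular.add_single {Z : Fin (k + m) → ℂ} (hZ : C.Regular Z) (c : Fin (k + m)) (d : ℤ) :
    C.Regular (Z + Pi.single c (d : ℂ)) := fun p => by
  rw [polyVal_add_single]; exact hZ p

/-- The coefficients depend only on `exp (2πi Z)`, so an integer shift of `Z` affects only the
kernel. -/
theorem pairing_add_single (Z : Fin (k + m) → ℂ) (c : Fin (k + m)) (d : ℤ) :
    C.pairing (Z + Pi.single c (d : ℂ)) G =
      C.pairing Z (fun p w => expKernel (Pi.single c (d : ℂ)) w * G p w) := by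
  refine Finset.sum_congr rfl fun p _ => ?_
  rw [coef, coef, polyVal_add_single, polyVal_add_single]
  simp only [expKernel_add, mul_assoc]

end MellinCycle

/-! ### Linear forms and exponents of products of monomials -/

namespace CISystem

variable {N k m : ℕ} {S : CISystem N k m} {Δ : ℤ} {T : Matrix (PhaseVar N k m) S.Mono ℤ}

/-- The linear form `𝓛_a` as a function of the concatenation `Z` of `z` and `z'`. -/
noncomputable def linFormZ (S : CISystem N k m) (Δ : ℤ) (T : Matrix (PhaseVar N k m) S.Mono ℤ)
    (i : Fin N → ℤ) (ζ : Fin k → ℂ) (a : S.Mono) (Z : Fin (k + m) → ℂ) : ℂ :=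
  ((∑ j, (T (.inl (.inl j)) a : ℂ) * ((i j : ℂ) + 1)) + (∑ c, (T (paramVar c) a : ℂ) * Z c)
    + ∑ q, (T (.inr (.inr q)) a : ℂ) * (ζ q + 1)) / (Δ : ℂ)

theorem linForm_eq_linFormZ (i : Fin N → ℤ) (ζ : Fin k → ℂ) (a : S.Mono) (z : Fin k → ℂ)
    (z' : Fin m → ℂ) :
    S.linForm Δ T a i z z' ζ = S.linFormZ Δ T i ζ a (Fin.append z z') := by
  rw [linForm, linFormZ]
  congr 1
  simp only [Fin.sum_univ_add, paramVar_castAdd, paramVar_natAdd, Fin.append_left,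
    Fin.append_right, Finset.sum_add_distrib]
  ring

theorem linFormZ_add_single (hΔ : Δ ≠ 0) (i : Fin N → ℤ) (ζ : Fin k → ℂ) (a : S.Mono)
    (Z : Fin (k + m) → ℂ) (c : Fin (k + m)) :
    S.linFormZ Δ T i ζ a (Z + Pi.single c (Δ : ℂ)) =
      S.linFormZ Δ T i ζ a Z + T (paramVar c) a := by
  have hΔ' : (Δ : ℂ) ≠ 0 := by exact_mod_cast hΔ
  simp only [linFormZ, Pi.add_apply, mul_add, Finset.sum_add_distrib, Pi.single_apply]
  simp
  field_simp
  ring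

/-- The exponent of the variable `c` in `∏_a T_a ^ ν_a`. -/
def expo (S : CISystem N k m) (ν : S.Mono → ℕ) (c : PhaseVar N k m) : ℤ :=
  ∑ a, (ν a : ℤ) * S.phaseMatrix a c

/-- The degree of `∏_a T_a ^ ν_a` in the variable `y_q`. -/
def yDegree (S : CISystem N k m) (ν : S.Mono → ℕ) (q : Fin k) : ℕ :=
  ∑ a, if S.block a = q then ν a else 0

theorem expo_y (ν : S.Mono → ℕ) (q : Fin k) : S.expo ν (.inr (.inr q)) = S.yDegree ν q := by
  simp [expo, yDegree, S.phaseMatrix_y]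

theorem expo_add_single (ν : S.Mono → ℕ) (b : S.Mono) (c : PhaseVar N k m) :
    S.expo (ν + Pi.single b 1) c = S.expo ν c + S.phaseMatrix b c := by
  simp only [expo, Pi.add_apply, Nat.cast_add, add_mul, Finset.sum_add_distrib, Pi.single_apply]
  simp

theorem yDegree_add_single (ν : S.Mono → ℕ) (b : S.Mono) (q : Fin k) :
    S.yDegree (ν + Pi.single b 1) q = S.yDegree ν q + if S.block b = q then 1 else 0 := by
  zify
  rw [← expo_y, ← expo_y, expo_add_single, S.phaseMatrix_y]

/-- The product of Pochhammer symbols `∏_q (ζ_q + 1)_{deg_q ν}`. -/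
noncomputable def pochFactor (ζ : Fin k → ℂ) (d : Fin k → ℕ) : ℂ :=
  ∏ q, ∏ t ∈ Finset.range (d q), (ζ q + t + 1)

theorem pochFactor_succ (ζ : Fin k → ℂ) (d : Fin k → ℕ) (q₀ : Fin k) :
    pochFactor ζ (fun q => d q + if q₀ = q then 1 else 0) =
      pochFactor ζ d * (ζ q₀ + d q₀ + 1) := by
  rw [pochFactor, pochFactor, ← Finset.mul_prod_erase _ _ (Finset.mem_univ q₀),
    ← Finset.mul_prod_erase _ (fun q => ∏ t ∈ Finset.range (d q), (ζ q + t + 1))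
      (Finset.mem_univ q₀), if_pos rfl, Finset.prod_range_succ]
  have hcongr : ∏ q ∈ Finset.univ.erase q₀, ∏ t ∈ Finset.range (d q + if q₀ = q then 1 else 0),
      (ζ q + t + 1) = ∏ q ∈ Finset.univ.erase q₀, ∏ t ∈ Finset.range (d q), (ζ q + t + 1) :=
    Finset.prod_congr rfl fun q hq => by rw [if_neg (Finset.ne_of_mem_erase hq).symm, add_zero]
  rw [hcongr]
  ring

/-- This is `(ν L) T = Δ ν`. It turns the exponents accumulated by earlier insertions into the
summand `ν b` of `𝓛_b + ν b`. -/
theorem IsScaledInverse.sum_expo (h : S.IsScaledInverse Δ T) (ν : S.Mono → ℕ) (b : S.Mono) :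
    ∑ c, S.expo ν c * T c b = ν b * Δ := by
  simp only [expo, Finset.sum_mul]
  rw [Finset.sum_comm]
  have : ∀ a, ∑ c, (ν a : ℤ) * S.phaseMatrix a c * T c b = if a = b then (ν b : ℤ) * Δ else 0 := by
    intro a
    simp only [mul_assoc]
    rw [← Finset.mul_sum, h.mul_apply]
    split_ifs with hab
    · rw [hab]
    · simp
  simp_rw [this]
  simp

end CISystem

theorem Function.induction_add_single {ι : Type*} [Fintype ι] [DecidableEq ι]
    {P : (ι → ℕ) → Prop} (h0 : P 0) (h1 : ∀ ν b, P ν → P (ν + Pi.single b 1)) (ν : ι → ℕ) : P ν := by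
  induction hn : ∑ a, ν a generalizing ν with
  | zero =>
    have : ν = 0 := by
      ext a
      simpa using (Finset.sum_eq_zero_iff.1 hn) a (Finset.mem_univ a)
    rwa [this]
  | succ n ih =>
    obtain ⟨b, hb⟩ : ∃ b, ν b ≠ 0 := by
      by_contra! h
      simp [h] at hn
    have hν : ν = (ν - Pi.single b 1) + Pi.single b 1 := by
      ext a
      by_cases hab : a = b
      · subst hab
        simp
        omega
      · simp [hab]
    rw [hν]
    refine h1 _ _ (ih _ ?_)
    have h2 : ∑ a, ν a = ∑ a, (ν - Pi.single b 1 : ι → ℕ) a + ∑ a, (Pi.single b 1 : ι → ℕ) a := by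
      rw [← Finset.sum_add_distrib]
      exact Finset.sum_congr rfl fun a _ => congrFun hν a
    rw [Finset.sum_pi_single'] at h2
    simp at h2 ⊢
    omega

/-! ### Insertion of monomials and periodicity -/

namespace MellinCycle

variable {N k m : ℕ} {S : CISystem N k m} {i : Fin N → ℤ} {ζ : Fin k → ℂ} {C : MellinCycle S i ζ}
  {Δ : ℤ} {T : Matrix (PhaseVar N k m) S.Mono ℤ}

open CISystem

/-- With reciprocals the functional equation of `Γ` holds everywhere, so poles need no separate
treatment. -/
theorem prod_Gamma_inv_succ {ι : Type*} [Fintype ι] [DecidableEq ι] (ℓ : ι → ℂ) (ν : ι → ℕ)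
    (b : ι) : (ℓ b + ν b) * ∏ a, (Complex.Gamma (ℓ a + (ν + Pi.single b 1 : ι → ℕ) a))⁻¹ =
      ∏ a, (Complex.Gamma (ℓ a + ν a))⁻¹ := by
  rw [← Finset.mul_prod_erase _ _ (Finset.mem_univ b),
    ← Finset.mul_prod_erase _ (fun a => (Complex.Gamma (ℓ a + ν a))⁻¹) (Finset.mem_univ b),
    ← mul_assoc]
  congr 1
  · rw [Complex.one_div_Gamma_eq_self_mul_one_div_Gamma_add_one (ℓ b + ν b)]
    simp [add_assoc]
  · refine Finset.prod_congr rfl fun a ha => ?_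
    simp [Finset.ne_of_mem_erase ha]

/-- The Mellin transform of a fibre integral with shifted exponents. -/
theorem exists_shifted (h : S.IsScaledInverse Δ T) (hkm : 0 < k + m)
    {V : Fin C.numCells → Set (Fin (k + m) → ℂ)} (hVo : ∀ p, IsOpen (V p)) (hVU : ∀ p, V p ⊆ C.dom p)
    (γ : ∀ p, FibreCycle S ζ (V p)) (hJ : ∀ p, ∀ v ∈ V p, C.J p v = (γ p).integral i v)
    (ν : S.Mono → ℕ) :
    ∃ G : Fin C.numCells → (Fin (k + m) → ℂ) → ℂ, C.Admissible G ∧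
      (∀ p, ∀ v ∈ V p, G p v = pochFactor ζ (S.yDegree ν) *
        expKernel (fun c => (S.expo ν (paramVar c) : ℂ)) v *
          (γ p).gen (fun q => ζ q + S.expo ν (.inr (.inr q)))
            (fun j => i j + S.expo ν (.inl (.inl j))) v) ∧
      ∀ Z, C.Regular Z →
        C.pairing Z G * ∏ a, (Complex.Gamma (S.linFormZ Δ T i ζ a Z + ν a))⁻¹ =
          C.pairing Z C.J * ∏ a, (Complex.Gamma (S.linFormZ Δ T i ζ a Z))⁻¹ := by
  have hΔ : (Δ : ℂ) ≠ 0 := by exact_mod_cast h.1.ne'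
  induction ν using Function.induction_add_single with
  | h0 =>
    refine ⟨C.J, C.admissible_J, fun p v hv => ?_, fun Z _ => by simp⟩
    rw [hJ p v hv, FibreCycle.integral_eq_gen]
    simp [expo, yDegree, pochFactor, expKernel]
  | h1 ν b ih =>
    obtain ⟨G, hG, hGV, hGZ⟩ := ih
    set n : Fin k → ℤ := fun q => S.expo ν (.inr (.inr q)) with hn
    set i' : Fin N → ℤ := fun j => i j + S.expo ν (.inl (.inl j)) with hi'
    set β : Fin (k + m) → ℂ := fun c => (S.expo ν (paramVar c) : ℂ) with hβ
    -- The operator `r + ∑ μ_c ∂_c` inserts `T_b`: `R` and `μ` come from `scaled_genMono` at the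
    -- shifted exponents, and `r` compensates for the derivatives of the factor `s ^ β` contained in
    -- `G`. It acts on the continuation `G` over the whole domain, although `γ p` exists only over
    -- `V p`.
    set R : ℂ := (∑ j, (T (.inl (.inl j)) b : ℂ) * ((i' j : ℂ) + 1)) +
        ∑ q, (T (.inr (.inr q)) b : ℂ) * (ζ q + n q + 1) with hR
    set r : ℂ := (R + ∑ c, (T (paramVar c) b : ℂ) * β c) / Δ with hr
    set μ : Fin (k + m) → ℂ := fun c => -((T (paramVar c) b : ℂ) / Δ) with hμ
    have hsum : C.Admissible fun p w => ∑ c, μ c * partialDeriv c (G p) w :=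
      Admissible.sum Finset.univ fun c => (hG.partialDeriv c).const_mul (μ c)
    refine ⟨fun p w => r * G p w + ∑ c, μ c * partialDeriv c (G p) w,
      (hG.const_mul r).add hsum, fun p v hv => ?_, fun Z hZ => ?_⟩
    · set d : Fin (k + m) → ℂ := fun c => -∑ a, (S.phaseMatrix a (paramVar c) : ℂ) *
        (((ζ (S.block a) + n (S.block a)) + 1) * (γ p).genMono a (fun q => ζ q + n q) i' v) with hd
      set κ := pochFactor ζ (S.yDegree ν) with hκ
      have hpd : ∀ c, partialDeriv c (G p) v =
          κ * expKernel β v * (β c * (γ p).gen (fun q => ζ q + n q) i' v + d c) := by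
        intro c
        have h1 := (γ p).hasDerivAt_gen (hVo p) (fun q => ζ q + n q) i' c hv
        have h2 := hasDerivAt_comp_coordLine
          ((differentiable_expKernel β).differentiableAt (x := v)) c
        have h2' : partialDeriv c (expKernel β) v = expKernel β v * β c := by
          rw [partialDeriv, (hasFDerivAt_expKernel β v).fderiv]
          simp [Pi.single_apply]
        rw [h2'] at h2
        have h3 := (h2.const_mul κ).fun_mul h1
        have h4 := hasDerivAt_comp_coordLine ((hG.diff p).differentiableAt
          ((C.isOpen_dom p).mem_nhds (hVU p hv))) c
        have h5 : (fun σ : ℂ => G p (coordLine v c σ)) =ᶠ[𝓝 0] fun σ : ℂ =>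
            κ * expKernel β (coordLine v c σ) * (γ p).gen (fun q => ζ q + n q) i' (coordLine v c σ) := by
          have h6 : coordLine v c ⁻¹' V p ∈ 𝓝 (0 : ℂ) :=
            ((hVo p).preimage (continuous_coordLine v c)).mem_nhds (by simpa using hv)
          filter_upwards [h6] with σ hσ
          exact hGV p _ hσ
        rw [h4.unique (h3.congr_of_eventuallyEq h5)]
        simp only [coordLine_zero, hd]
        ring
      have h1 := (γ p).scaled_genMono h hv n i' b d fun c => rfl
      simp only [hpd, hGV p v hv]
      have h2 := (γ p).genMono_eq hv (fun q => ζ q + n q) i' b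
      have h3 : S.yDegree (ν + Pi.single b 1) =
          fun q => S.yDegree ν q + if S.block b = q then 1 else 0 := by
        ext q; rw [yDegree_add_single]
      rw [h3, pochFactor_succ]
      have h4 : expKernel (fun c => (S.expo (ν + Pi.single b 1) (paramVar c) : ℂ)) v =
          expKernel β v * Complex.exp (∑ c, (S.phaseMatrix b (paramVar c) : ℂ) * v c) := by
        simp only [expo_add_single, expKernel, hβ]
        push_cast
        simp only [add_mul, Finset.sum_add_distrib, Complex.exp_add]
      have h5 : (fun q => ζ q + (S.expo (ν + Pi.single b 1) (.inr (.inr q)) : ℂ)) =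
          fun q => ζ q + n q + (S.phaseMatrix b (.inr (.inr q)) : ℂ) := by
        ext q
        simp only [expo_add_single, hn]
        push_cast
        ring
      have h6 : (fun j => i j + S.expo (ν + Pi.single b 1) (.inl (.inl j))) =
          fun j => i' j + S.phaseMatrix b (.inl (.inl j)) := by
        ext j
        simp only [expo_add_single, hi']
        ring
      rw [h4, h5, h6]
      have h7 : (n (S.block b) : ℂ) = S.yDegree ν (S.block b) := by
        simp only [hn, expo_y]
        simp
      rw [h7] at h1
      have h8 : ∑ c, μ c * (κ * expKernel β v * (β c * (γ p).gen (fun q => ζ q + n q) i' v + d c)) =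
          -(κ * expKernel β v / Δ) * ((∑ c, (T (paramVar c) b : ℂ) * β c) *
            (γ p).gen (fun q => ζ q + n q) i' v + ∑ c, (T (paramVar c) b : ℂ) * d c) := by
        rw [Finset.sum_mul, ← Finset.sum_add_distrib, Finset.mul_sum]
        refine Finset.sum_congr rfl fun c _ => ?_
        simp only [hμ]
        ring
      rw [h8, mul_assoc κ (_ + _ + _), ← mul_assoc, ← mul_assoc]
      rw [h2] at h1
      simp only [hr]
      field_simp
      linear_combination (-κ * expKernel β v) * h1
    -- Replacing each `∂_c` by `-Z c` turns the operator into the linear form; `sum_expo` collects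
    -- all shifts into `ν b`.
    · have h1 : C.pairing Z (fun p w => r * G p w + ∑ c, μ c * partialDeriv c (G p) w) =
          (S.linFormZ Δ T i ζ b Z + ν b) * C.pairing Z G := by
        rw [pairing_add (hG.const_mul r).diff hsum.diff, pairing_const_mul,
          pairing_sum Finset.univ (fun c => ((hG.partialDeriv c).const_mul (μ c)).diff)]
        simp only [pairing_const_mul, pairing_partialDeriv hkm hG hZ]
        have h2 : ∑ c, μ c * (-Z c * C.pairing Z G) =
            (∑ c, (T (paramVar c) b : ℂ) * Z c) / Δ * C.pairing Z G := by
          rw [Finset.sum_div, Finset.sum_mul]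
          refine Finset.sum_congr rfl fun c _ => ?_
          simp only [hμ]
          ring
        rw [h2, ← add_mul]
        congr 1
        have h3 := h.sum_expo ν b
        rw [sum_phaseVar] at h3
        have h4 := congrArg (Int.cast : ℤ → ℂ) h3
        push_cast at h4
        have h5 : R + ∑ c, (T (paramVar c) b : ℂ) * β c =
            (∑ j, (T (.inl (.inl j)) b : ℂ) * ((i j : ℂ) + 1)) +
              (∑ q, (T (.inr (.inr q)) b : ℂ) * (ζ q + 1)) + ν b * Δ := by
          rw [← h4]
          simp only [hR, hi', hn, hβ]
          push_cast
          simp only [mul_add, Finset.sum_add_distrib, mul_comm (S.expo _ _ : ℂ)]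
          ring
        simp only [hr, h5, linFormZ]
        field_simp
        ring
      rw [h1, mul_assoc, mul_left_comm]
      exact (congrArg (C.pairing Z G * ·) (prod_Gamma_inv_succ
        (fun a => S.linFormZ Δ T i ζ a Z) ν b)).trans (hGZ Z hZ)

/-- The Mellin transform divided by the product of Gamma factors is `Δ`-periodic. -/
theorem pairing_periodic (h : S.IsScaledInverse Δ T) (hkm : 0 < k + m) (c : Fin (k + m))
    {Z : Fin (k + m) → ℂ} (hZ : C.Regular Z) :
    C.pairing (Z + Pi.single c (Δ : ℂ)) C.J *
        ∏ a, (Complex.Gamma (S.linFormZ Δ T i ζ a (Z + Pi.single c (Δ : ℂ))))⁻¹ =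
      C.pairing Z C.J * ∏ a, (Complex.Gamma (S.linFormZ Δ T i ζ a Z))⁻¹ := by
  have hfib := fun p => (C.isFibreIntegral p).2.2.2
  choose V hVU hVo hVne γ hJ using hfib
  -- Row `c` of `T` is split into positive and negative parts, so that only non-negative powers of
  -- monomials are inserted.
  set νp : S.Mono → ℕ := fun a => (T (paramVar c) a).toNat with hνp
  set νm : S.Mono → ℕ := fun a => (-T (paramVar c) a).toNat with hνm
  have hdiff : ∀ a, (νp a : ℤ) = νm a + T (paramVar c) a := fun a => by
    simp only [hνp, hνm]; omega
  have hexpo : ∀ d, S.expo νp d = S.expo νm d + if paramVar c = d then Δ else 0 := by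
    intro d
    rw [← h.mul_apply', expo, expo, ← Finset.sum_add_distrib]
    exact Finset.sum_congr rfl fun a _ => by rw [hdiff]; ring
  have hpv_y : ∀ q, (paramVar c : PhaseVar N k m) ≠ .inr (.inr q) := by
    intro q
    refine Fin.addCases (fun q' => ?_) (fun j => ?_) c <;> simp
  have hpv_x : ∀ j, (paramVar c : PhaseVar N k m) ≠ .inl (.inl j) := by
    intro q
    refine Fin.addCases (fun q' => ?_) (fun j => ?_) c <;> simp
  have hy : ∀ q, S.expo νp (.inr (.inr q)) = S.expo νm (.inr (.inr q)) := fun q => by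
    rw [hexpo, if_neg (hpv_y q), add_zero]
  have hx : ∀ j, S.expo νp (.inl (.inl j)) = S.expo νm (.inl (.inl j)) := fun j => by
    rw [hexpo, if_neg (hpv_x j), add_zero]
  -- The Pochhammer factors on both sides coincide, so they need not be divided out and may vanish.
  have hyd : S.yDegree νp = S.yDegree νm := by
    ext q
    have := hy q
    rw [expo_y, expo_y] at this
    exact_mod_cast this
  have hkern : (fun d => (S.expo νp (paramVar d) : ℂ)) =
      Pi.single c (Δ : ℂ) + fun d => (S.expo νm (paramVar d) : ℂ) := by
    ext d
    rw [hexpo]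
    simp only [paramVar_injective.eq_iff, Pi.add_apply, Pi.single_apply, eq_comm (a := c)]
    split_ifs <;> push_cast <;> ring
  obtain ⟨Gp, hGp, hGpV, hGpZ⟩ := exists_shifted h hkm hVo hVU γ hJ νp
  obtain ⟨Gm, hGm, hGmV, hGmZ⟩ := exists_shifted h hkm hVo hVU γ hJ νm
  -- Over `V p` both sides contain the same fibre integral; the identity theorem extends the
  -- equality to the connected domain.
  have hEq : ∀ p, EqOn (Gp p) (fun w => expKernel (Pi.single c (Δ : ℂ)) w * Gm p w) (C.dom p) := by
    intro p
    refine (hGp.diff p).eqOn_of_isPreconnected (C.isOpen_dom p) (C.isFibreIntegral p).2.1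
      ((differentiable_expKernel _).differentiableOn.mul (hGm.diff p)) (hVo p) (hVU p) (hVne p) ?_
    intro v hv
    simp only [hGpV p v hv, hGmV p v hv, hkern, expKernel_add, hyd, hy, hx]
    ring
  have h1 : C.pairing Z Gp = C.pairing (Z + Pi.single c (Δ : ℂ)) Gm := by
    rw [pairing_add_single]
    exact pairing_congr hEq
  rw [← hGpZ Z hZ, ← hGmZ _ (hZ.add_single c Δ), h1]
  congr 1
  refine Finset.prod_congr rfl fun a _ => ?_
  rw [linFormZ_add_single h.1.ne', add_assoc]
  have := hdiff a
  have h2 : (νp a : ℂ) = νm a + T (paramVar c) a := by exact_mod_cast congrArg (Int.cast : ℤ → ℂ) this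
  rw [h2, add_comm (νm a : ℂ)]

end MellinCycle

/-! ### A bound for `1 / Γ` on vertical strips -/

theorem Complex.norm_Gamma_le_Gamma_re {s : ℂ} (hs : 0 < s.re) :
    ‖Complex.Gamma s‖ ≤ Real.Gamma s.re := by
  rw [Complex.Gamma_eq_integral hs, Real.Gamma_eq_integral hs, Complex.GammaIntegral]
  refine (norm_integral_le_integral_norm _).trans (le_of_eq ?_)
  refine setIntegral_congr_fun measurableSet_Ioi fun x hx => ?_
  simp only [norm_mul, Complex.norm_real, Complex.norm_cpow_eq_rpow_re_of_pos hx]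
  simp

theorem Complex.norm_sin_le_exp (s : ℂ) : ‖Complex.sin s‖ ≤ Real.exp |s.im| := by
  rw [Complex.sin, norm_div, norm_mul, Complex.norm_I, mul_one]
  have h1 : ‖Complex.exp (-s * Complex.I)‖ ≤ Real.exp |s.im| := by
    rw [Complex.norm_exp]
    exact Real.exp_le_exp.2 (by simpa using le_abs_self s.im)
  have h2 : ‖Complex.exp (s * Complex.I)‖ ≤ Real.exp |s.im| := by
    rw [Complex.norm_exp]
    exact Real.exp_le_exp.2 (by simpa using neg_le_abs s.im)
  have h3 := norm_sub_le (Complex.exp (-s * Complex.I)) (Complex.exp (s * Complex.I))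
  have h4 : ‖(2 : ℂ)‖ = 2 := by simp
  rw [h4]
  linarith

/-- By the reflection formula `1/Γ(s) = Γ(1 - s) sin(πs) / π`. Here `Γ(1 - s)` is bounded by its
values on a compact real interval in `(0, ∞)`, and the sine contributes the exponential. -/
theorem Complex.norm_Gamma_inv_le_of_re_le_half (A : ℝ) :
    ∃ M : ℝ, 0 ≤ M ∧ ∀ s : ℂ, A ≤ s.re → s.re ≤ 1 / 2 →
      ‖(Complex.Gamma s)⁻¹‖ ≤ M * Real.exp (Real.pi * |s.im|) := by
  have hcont : ContinuousOn Real.Gamma (Icc (1 / 2) (1 - A)) := fun x hx =>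
    (Real.differentiableOn_Gamma_Ioi.differentiableAt
      (Ioi_mem_nhds (lt_of_lt_of_le (by norm_num) hx.1))).continuousAt.continuousWithinAt
  obtain ⟨M, hM⟩ := isCompact_Icc.exists_bound_of_continuousOn hcont
  refine ⟨max M 0, le_max_right _ _, fun s hA hs => ?_⟩
  have hre : (1 - s).re = 1 - s.re := by simp
  have h1 : ‖Complex.Gamma (1 - s)‖ ≤ max M 0 := by
    refine (Complex.norm_Gamma_le_Gamma_re (by rw [hre]; linarith)).trans
      (le_trans ?_ (le_max_left _ _))
    refine (Real.le_norm_self _).trans (hM _ ?_)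
    rw [hre]
    constructor <;> linarith
  have h2 : Complex.Gamma (1 - s) ≠ 0 :=
    Complex.Gamma_ne_zero_of_re_pos (by rw [hre]; linarith)
  have h3 : (Complex.Gamma s)⁻¹ = Complex.Gamma (1 - s) * (Complex.sin (Real.pi * s) / Real.pi) := by
    have h4 : Complex.Gamma s = Real.pi / Complex.sin (Real.pi * s) / Complex.Gamma (1 - s) := by
      rw [← Complex.Gamma_mul_Gamma_one_sub, mul_div_cancel_right₀ _ h2]
    rw [h4, inv_div, div_div_eq_mul_div, mul_div_assoc]
  have h5 : ‖Complex.sin (Real.pi * s)‖ ≤ Real.exp (Real.pi * |s.im|) := by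
    refine (Complex.norm_sin_le_exp _).trans (le_of_eq ?_)
    simp [abs_mul, abs_of_pos Real.pi_pos]
  rw [h3, norm_mul, norm_div]
  gcongr
  have h6 : ‖(Real.pi : ℂ)‖ = Real.pi := by simp [abs_of_pos Real.pi_pos]
  rw [h6]
  refine le_trans (div_le_self (norm_nonneg _) (by linarith [Real.pi_gt_three])) h5

/-- The strip is widened by one through `1/Γ(s - 1) = (s - 1)/Γ(s)`: for `|Im s| > 1` the factor `s
- 1` has norm at least `1`, and the remaining rectangle is compact. -/
theorem Complex.norm_Gamma_inv_le_of_re_le (n : ℕ) : ∀ A : ℝ,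
    ∃ M : ℝ, 0 ≤ M ∧ ∀ s : ℂ, A ≤ s.re → s.re ≤ n + 1 / 2 →
      ‖(Complex.Gamma s)⁻¹‖ ≤ M * Real.exp (Real.pi * |s.im|) := by
  induction n with
  | zero => simpa using Complex.norm_Gamma_inv_le_of_re_le_half
  | succ n ih =>
    intro A
    obtain ⟨M₁, hM₁, h₁⟩ := ih A
    obtain ⟨M₂, hM₂, h₂⟩ := ih (-1)
    have hcomp : IsCompact (Icc (0 : ℝ) (n + 2) ×ℂ Icc (-1 : ℝ) 1) :=
      isCompact_Icc.reProdIm isCompact_Icc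
    obtain ⟨M₃, hM₃⟩ := hcomp.exists_bound_of_continuousOn
      Complex.differentiable_one_div_Gamma.continuous.continuousOn
    refine ⟨max (max M₁ M₂) M₃, hM₁.trans ((le_max_left _ _).trans (le_max_left _ _)),
      fun s hA hs => ?_⟩
    have hexp : 1 ≤ Real.exp (Real.pi * |s.im|) :=
      Real.one_le_exp (mul_nonneg Real.pi_pos.le (abs_nonneg _))
    by_cases hs1 : s.re ≤ n + 1 / 2
    · refine (h₁ s hA hs1).trans ?_
      gcongr
      exact (le_max_left _ _).trans (le_max_left _ _)
    push Not at hs1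
    have hn : (0 : ℝ) ≤ n := Nat.cast_nonneg n
    push_cast at hs
    by_cases him : |s.im| ≤ 1
    · have := hM₃ s ⟨⟨by linarith, by linarith⟩, abs_le.1 him⟩
      refine this.trans ((le_max_right (max M₁ M₂) M₃).trans ?_)
      exact le_mul_of_one_le_right (hM₁.trans ((le_max_left _ _).trans (le_max_left _ _))) hexp
    · push Not at him
      have h3 := h₂ (s - 1) (by simp; linarith) (by simp; linarith)
      have h4 : (s - 1).im = s.im := by simp
      have h5 : 1 ≤ ‖s - 1‖ := by
        refine him.le.trans ?_
        rw [← h4]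
        exact Complex.abs_im_le_norm _
      have h6 := Complex.one_div_Gamma_eq_self_mul_one_div_Gamma_add_one (s - 1)
      rw [sub_add_cancel] at h6
      rw [h6, norm_mul, h4] at h3
      refine (le_mul_of_one_le_left (norm_nonneg _) h5).trans (h3.trans ?_)
      gcongr
      exact (le_max_right _ _).trans (le_max_left _ _)

theorem Complex.norm_Gamma_inv_le_strip (A B : ℝ) :
    ∃ M : ℝ, 0 ≤ M ∧ ∀ s : ℂ, A ≤ s.re → s.re ≤ B →
      ‖(Complex.Gamma s)⁻¹‖ ≤ M * Real.exp (Real.pi * |s.im|) := by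
  obtain ⟨n, hn⟩ := exists_nat_ge B
  obtain ⟨M, hM, h⟩ := Complex.norm_Gamma_inv_le_of_re_le n A
  exact ⟨M, hM, fun s hA hB => h s hA (by linarith)⟩

/-! ### Entire functions of polynomial growth -/

/-- Cauchy's estimates on circles of growing radius kill all Taylor coefficients beyond `d`. -/
theorem Differentiable.exists_polynomial_of_norm_le {F : ℂ → ℂ} (hF : Differentiable ℂ F) {d : ℕ}
    {M : ℝ} (hM : ∀ z, 1 ≤ ‖z‖ → ‖F z‖ ≤ M * ‖z‖ ^ d) :
    ∃ p : Polynomial ℂ, p.natDegree ≤ d ∧ ∀ z, F z = p.eval z := by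
  have hzero : ∀ n, d < n → iteratedDeriv n F 0 = 0 := by
    intro n hn
    have hbound : ∀ R : ℝ, 1 ≤ R → ‖iteratedDeriv n F 0‖ ≤ n.factorial * M / R := by
      intro R hR
      have hR0 : 0 < R := by linarith
      have hM0 : 0 ≤ M := by
        have := (norm_nonneg _).trans (hM 1 (by simp))
        simpa using this
      have := Complex.norm_iteratedDeriv_le_of_forall_mem_sphere_norm_le (c := 0) (R := R)
        (C := M * R ^ d) n hR0 hF.diffContOnCl (fun z hz => by
          have hz' : ‖z‖ = R := by simpa using hz
          have := hM z (by rw [hz']; exact hR)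
          rwa [hz'] at this)
      refine this.trans ?_
      obtain ⟨e, rfl⟩ : ∃ e, n = d + 1 + e := ⟨n - (d + 1), by omega⟩
      rw [div_le_div_iff₀ (by positivity) hR0]
      have h1 : (1 : ℝ) ≤ R ^ e := one_le_pow₀ hR
      have h2 : 0 ≤ ((d + 1 + e).factorial : ℝ) * M * (R ^ d * R) := by positivity
      calc _ = ((d + 1 + e).factorial : ℝ) * M * (R ^ d * R) * 1 := by ring
        _ ≤ ((d + 1 + e).factorial : ℝ) * M * (R ^ d * R) * R ^ e := by gcongr
        _ = _ := by ring
    by_contra hne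
    have hpos : 0 < ‖iteratedDeriv n F 0‖ := norm_pos_iff.2 hne
    set R := max 1 (n.factorial * M / ‖iteratedDeriv n F 0‖ + 1)
    have h1 := hbound R (le_max_left _ _)
    have hR0 : 0 < R := lt_of_lt_of_le one_pos (le_max_left _ _)
    rw [le_div_iff₀ hR0] at h1
    have h2 : n.factorial * M / ‖iteratedDeriv n F 0‖ + 1 ≤ R := le_max_right _ _
    have h3 : ‖iteratedDeriv n F 0‖ * (n.factorial * M / ‖iteratedDeriv n F 0‖ + 1) ≤
        n.factorial * M := (mul_le_mul_of_nonneg_left h2 hpos.le).trans h1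
    rw [mul_add, mul_div_cancel₀ _ hpos.ne'] at h3
    linarith
  refine ⟨∑ n ∈ Finset.range (d + 1),
    Polynomial.monomial n ((n.factorial : ℂ)⁻¹ * iteratedDeriv n F 0), ?_, fun z => ?_⟩
  · refine Polynomial.natDegree_sum_le_of_forall_le _ _ fun n hn => ?_
    exact (Polynomial.natDegree_monomial_le _).trans (by simpa [Nat.lt_succ_iff] using hn)
  · have h1 := Complex.hasSum_taylorSeries_of_entire hF 0 z
    have h2 := h1.unique (hasSum_sum_of_ne_finset_zero (s := Finset.range (d + 1)) fun n hn => by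
      rw [hzero n (by simpa using hn)]; simp)
    rw [h2, Polynomial.eval_finsetSum]
    refine Finset.sum_congr rfl fun n _ => ?_
    simp only [Polynomial.eval_monomial, sub_zero, smul_eq_mul]
    ring

/-! ### Periodic entire functions of exponential type -/

-- Let `q = exp (2πi z / Δ)`. The function `G q ^ K` is bounded for `Im z ≥ 0`, so as a function of
-- `q` it extends holomorphically across `q = 0`. For `Im z ≤ 0` it is at most `M |q| ^ (2K)`, so it
-- is a polynomial in `q`.
open Function.Periodic in
theorem exists_polynomial_of_periodic {Δ : ℝ} (hΔ : 0 < Δ) {G : ℂ → ℂ} (hG : Differentiable ℂ G)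
    (hper : Function.Periodic G Δ) {M : ℝ} {K : ℕ}
    (hM : ∀ z : ℂ, 0 ≤ z.re → z.re ≤ Δ → ‖G z‖ ≤ M * Real.exp (2 * Real.pi * K / Δ * |z.im|)) :
    ∃ p : Polynomial ℂ, p.natDegree ≤ 2 * K ∧ ∀ z, G z * qParam Δ z ^ K = p.eval (qParam Δ z) := by
  have hM' : ∀ z : ℂ, ‖G z‖ ≤ M * Real.exp (2 * Real.pi * K / Δ * |z.im|) := by
    intro z
    set n : ℤ := ⌊z.re / Δ⌋ with hn
    have h1 : G (z - n * Δ) = G z := hper.sub_int_mul_eq n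
    have h2 : (z - n * Δ : ℂ).im = z.im := by simp
    have h3 : (z - n * Δ : ℂ).re = z.re - n * Δ := by simp
    rw [← h1, ← h2]
    have h4 : (n : ℝ) ≤ z.re / Δ := Int.floor_le _
    have h5 : z.re / Δ < n + 1 := Int.lt_floor_add_one _
    rw [le_div_iff₀ hΔ] at h4
    rw [div_lt_iff₀ hΔ] at h5
    refine hM _ ?_ ?_ <;> rw [h3] <;> linarith
  have hMnn : 0 ≤ M := by
    have := (norm_nonneg _).trans (hM' 0)
    simpa using this
  set f : ℂ → ℂ := fun z => G z * qParam Δ z ^ K with hf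
  have hfd : Differentiable ℂ f := hG.mul ((differentiable_qParam).pow K)
  have hqper : ∀ z, qParam Δ (z + Δ) = qParam Δ z := by
    intro z
    have hΔ' : (Δ : ℂ) ≠ 0 := by exact_mod_cast hΔ.ne'
    rw [qParam, qParam, mul_add, add_div, mul_div_cancel_right₀ _ hΔ', Complex.exp_add,
      Complex.exp_two_pi_mul_I, mul_one]
  have hfper : Function.Periodic f Δ := fun z => by
    simp only [hf]
    rw [hper z, hqper]
  have hnq : ∀ z : ℂ, ‖qParam Δ z‖ ^ K = Real.exp (-(2 * Real.pi * K / Δ * z.im)) := by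
    intro z
    rw [norm_qParam, ← Real.exp_nat_mul]
    congr 1
    ring
  have hup : ∀ z : ℂ, 0 ≤ z.im → ‖f z‖ ≤ M := by
    intro z hz
    have h1 := hM' z
    simp only [hf, norm_mul, norm_pow, hnq]
    rw [abs_of_nonneg hz] at h1
    calc _ ≤ M * Real.exp (2 * Real.pi * K / Δ * z.im) *
          Real.exp (-(2 * Real.pi * K / Δ * z.im)) := by gcongr
      _ = M := by rw [mul_assoc, ← Real.exp_add, add_neg_cancel, Real.exp_zero, mul_one]
  have hdown : ∀ z : ℂ, z.im ≤ 0 → ‖f z‖ ≤ M * ‖qParam Δ z‖ ^ (2 * K) := by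
    intro z hz
    have h1 := hM' z
    rw [abs_of_nonpos hz, mul_neg, ← hnq] at h1
    simp only [hf, norm_mul, norm_pow]
    calc _ ≤ M * ‖qParam Δ z‖ ^ K * ‖qParam Δ z‖ ^ K := by gcongr
      _ = _ := by ring
  have hbd : (Filter.comap Complex.im Filter.atTop).BoundedAtFilter f := by
    refine Asymptotics.IsBigO.of_bound M ?_
    refine Filter.mem_comap.2 ⟨Ici 0, Filter.Ici_mem_atTop 0, fun z hz => ?_⟩
    simpa using hup z hz
  set F := cuspFunction Δ f with hF
  have hFd : Differentiable ℂ F := by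
    intro q
    by_cases hq : q = 0
    · rw [hq]
      exact differentiableAt_cuspFunction_zero hΔ hfper
        (Filter.Eventually.of_forall fun z => hfd z) hbd
    · rw [← qParam_right_inv hΔ.ne' hq]
      exact differentiableAt_cuspFunction hΔ.ne' hfper (hfd _)
  have hFf : ∀ z, F (qParam Δ z) = f z := eq_cuspFunction hΔ.ne' hfper
  obtain ⟨p, hp, hpe⟩ := hFd.exists_polynomial_of_norm_le (d := 2 * K) (M := M) (fun q hq => by
    have hq0 : q ≠ 0 := by rintro rfl; simp at hq; linarith
    have h1 := qParam_right_inv hΔ.ne' hq0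
    rw [← h1, hFf]
    refine hdown _ ?_
    rw [im_invQParam]
    exact mul_nonpos_of_nonpos_of_nonneg
      (div_nonpos_of_nonpos_of_nonneg (by linarith) (by positivity)) (Real.log_nonneg hq))
  exact ⟨p, hp, fun z => by rw [← hpe, hFf]⟩

/-- A function of several variables that is separately a polynomial of bounded degree in
`q (Z c)` is a polynomial. -/
theorem exists_mvPolynomial_of_separately {n : ℕ} {q : ℂ → ℂ} {d : ℕ}
    {x : ℕ → ℂ} (hx : Function.Injective fun t => q (x t)) {H : (Fin n → ℂ) → ℂ}
    (hH : ∀ Z c, ∃ p : Polynomial ℂ, p.natDegree ≤ d ∧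
      ∀ w, H (Function.update Z c w) = p.eval (q w)) :
    ∃ P : MvPolynomial (Fin n) ℂ, ∀ Z, H Z = MvPolynomial.eval (fun c => q (Z c)) P := by
  classical
  -- The variables are freed one at a time, those outside `s` being frozen at `Z₀`.
  have key : ∀ s : Finset (Fin n), ∀ Z₀ : Fin n → ℂ, ∃ P : MvPolynomial (Fin n) ℂ,
      ∀ Z, (∀ c ∉ s, Z c = Z₀ c) → H Z = MvPolynomial.eval (fun c => q (Z c)) P := by
    intro s
    induction s using Finset.induction_on with
    | empty =>
      intro Z₀
      refine ⟨MvPolynomial.C (H Z₀), fun Z hZ => ?_⟩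
      rw [MvPolynomial.eval_C, funext fun c => hZ c (by simp)]
    | insert c s hc ih =>
      intro Z₀
      choose P hP using fun t => ih (Function.update Z₀ c (x t))
      set ℓ : ℕ → Polynomial ℂ := Lagrange.basis (Finset.range (d + 1)) fun t => q (x t) with hℓ
      -- Lagrange interpolation in the new variable at `d + 1` nodes. The values at the nodes are
      -- polynomials in the other variables by induction; `bind₁` substitutes the node for the
      -- variable `c`.
      refine ⟨∑ t ∈ Finset.range (d + 1), MvPolynomial.bind₁
        (Function.update MvPolynomial.X c (MvPolynomial.C (q (x t)))) (P t) *
        Polynomial.aeval (MvPolynomial.X c) (ℓ t), fun Z hZ => ?_⟩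
      obtain ⟨p, hpd, hp⟩ := hH Z c
      have h1 : p = Lagrange.interpolate (Finset.range (d + 1)) (fun t => q (x t))
          fun t => H (Function.update Z c (x t)) := by
        refine Lagrange.eq_interpolate_of_eval_eq _ hx.injOn ?_ fun t _ => (hp (x t)).symm
        rw [Finset.card_range]
        exact (Polynomial.degree_le_of_natDegree_le hpd).trans_lt (by exact_mod_cast Nat.lt_succ_self d)
      have h2 : H Z = p.eval (q (Z c)) := by
        rw [← hp, Function.update_eq_self]
      rw [h2, h1, Lagrange.interpolate_apply, Polynomial.eval_finsetSum, map_sum]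
      refine Finset.sum_congr rfl fun t _ => ?_
      rw [Polynomial.eval_mul, Polynomial.eval_C, map_mul]
      congr 1
      · rw [hP t (Function.update Z c (x t)) (fun c' hc' => ?_)]
        · have h3 : ∀ v : Fin n → ℂ, MvPolynomial.eval v (MvPolynomial.bind₁ (Function.update
              MvPolynomial.X c (MvPolynomial.C (q (x t)))) (P t)) =
              MvPolynomial.eval (Function.update v c (q (x t))) (P t) := by
            intro v
            rw [← MvPolynomial.coe_aeval_eq_eval, ← MvPolynomial.coe_aeval_eq_eval,
              RingHom.coe_coe, RingHom.coe_coe, MvPolynomial.aeval_bind₁]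
            congr 2
            ext c'
            by_cases hcc : c' = c
            · subst hcc; simp
            · simp [hcc]
          rw [h3]
          congr 2
          ext c'
          by_cases hcc : c' = c
          · subst hcc; simp
          · simp [hcc]
        · by_cases hcc : c' = c
          · subst hcc; simp
          · simp only [Function.update_of_ne hcc]
            exact hZ c' (by simp [hcc, hc'])
      · rw [← MvPolynomial.coe_aeval_eq_eval, RingHom.coe_coe, ← Polynomial.aeval_algHom_apply,
          MvPolynomial.aeval_X, Polynomial.coe_aeval_eq_eval]
  obtain ⟨P, hP⟩ := key Finset.univ 0
  exact ⟨P, fun Z => hP Z (by simp)⟩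

/-! ### Separately entire functions of exponential type on strips -/

theorem Function.update_eq_update_zero_add_single {ι R : Type*} [DecidableEq ι] [AddZeroClass R]
    (Z : ι → R) (c : ι) (w : R) :
    Function.update Z c w = Function.update Z c 0 + Pi.single c w := by
  ext c'
  by_cases hc : c' = c
  · subst hc; simp
  · simp [hc]

/-- Functions of `n` complex variables that are entire and of exponential type in every vertical
strip, separately in each variable, with a uniform type. -/
structure StripBounded {n : ℕ} (Δ : ℝ) (f : (Fin n → ℂ) → ℂ) : Prop where
  diff : ∀ Z c, Differentiable ℂ fun w => f (Function.update Z c w)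
  bound : ∃ K : ℝ, 0 ≤ K ∧ ∀ Z c, ∃ M : ℝ, 0 ≤ M ∧ ∀ w : ℂ, 0 ≤ w.re → w.re ≤ Δ →
    ‖f (Function.update Z c w)‖ ≤ M * Real.exp (K * |w.im|)

namespace StripBounded

variable {n : ℕ} {Δ : ℝ} {f g : (Fin n → ℂ) → ℂ}

theorem const (Δ : ℝ) (a : ℂ) : StripBounded Δ fun _ : Fin n → ℂ => a :=
  ⟨fun _ _ => differentiable_const a,
    0, le_rfl, fun _ _ => ⟨‖a‖, norm_nonneg a, fun w _ _ => by simp⟩⟩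

theorem add (hf : StripBounded Δ f) (hg : StripBounded Δ g) :
    StripBounded Δ fun Z => f Z + g Z := by
  obtain ⟨K₁, hK₁, h₁⟩ := hf.bound
  obtain ⟨K₂, hK₂, h₂⟩ := hg.bound
  refine ⟨fun Z c => (hf.diff Z c).add (hg.diff Z c), max K₁ K₂, le_max_of_le_left hK₁,
    fun Z c => ?_⟩
  obtain ⟨M₁, hM₁, h₁⟩ := h₁ Z c
  obtain ⟨M₂, hM₂, h₂⟩ := h₂ Z c
  refine ⟨M₁ + M₂, add_nonneg hM₁ hM₂, fun w h0 hΔ => (norm_add_le _ _).trans ?_⟩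
  rw [add_mul]
  refine add_le_add ((h₁ w h0 hΔ).trans ?_) ((h₂ w h0 hΔ).trans ?_)
  · gcongr
    exact le_max_left _ _
  · gcongr
    exact le_max_right _ _

theorem mul (hf : StripBounded Δ f) (hg : StripBounded Δ g) :
    StripBounded Δ fun Z => f Z * g Z := by
  obtain ⟨K₁, hK₁, h₁⟩ := hf.bound
  obtain ⟨K₂, hK₂, h₂⟩ := hg.bound
  refine ⟨fun Z c => (hf.diff Z c).mul (hg.diff Z c), K₁ + K₂, add_nonneg hK₁ hK₂,
    fun Z c => ?_⟩
  obtain ⟨M₁, hM₁, h₁⟩ := h₁ Z c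
  obtain ⟨M₂, hM₂, h₂⟩ := h₂ Z c
  refine ⟨M₁ * M₂, mul_nonneg hM₁ hM₂, fun w h0 hΔ => ?_⟩
  rw [norm_mul, add_mul, Real.exp_add, mul_mul_mul_comm]
  exact mul_le_mul (h₁ w h0 hΔ) (h₂ w h0 hΔ) (norm_nonneg _) (by positivity)

theorem sum {ι : Type*} (s : Finset ι) {f : ι → (Fin n → ℂ) → ℂ}
    (hf : ∀ j, StripBounded Δ (f j)) : StripBounded Δ fun Z => ∑ j ∈ s, f j Z := by
  classical
  induction s using Finset.induction_on with
  | empty => simpa using const Δ 0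
  | insert j s hj ih => simpa only [Finset.sum_insert hj] using (hf j).add ih

theorem prod {ι : Type*} (s : Finset ι) {f : ι → (Fin n → ℂ) → ℂ}
    (hf : ∀ j, StripBounded Δ (f j)) : StripBounded Δ fun Z => ∏ j ∈ s, f j Z := by
  classical
  induction s using Finset.induction_on with
  | empty => simpa using const Δ 1
  | insert j s hj ih => simpa only [Finset.prod_insert hj] using (hf j).mul ih

theorem exp_coord (Δ : ℝ) (c' : Fin n) : StripBounded Δ fun Z =>
    Complex.exp (2 * (Real.pi : ℂ) * Complex.I * (Z c' / ((1 : ℤ) : ℂ))) := by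
  refine ⟨fun Z c => ?_, 2 * Real.pi, by positivity, fun Z c => ?_⟩
  · by_cases hc : c' = c
    · subst hc
      simp only [Function.update_self]
      fun_prop
    · simp only [Function.update_of_ne hc]
      exact differentiable_const _
  · by_cases hc : c' = c
    · subst hc
      refine ⟨1, zero_le_one, fun w _ _ => ?_⟩
      rw [Function.update_self, Complex.norm_exp, one_mul]
      refine Real.exp_le_exp.2 ?_
      have : (2 * (Real.pi : ℂ) * Complex.I * (w / ((1 : ℤ) : ℂ))).re = 2 * Real.pi * -w.im := by
        simp
      rw [this]
      gcongr
      exact neg_le_abs _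
    · refine ⟨‖Complex.exp (2 * (Real.pi : ℂ) * Complex.I * (Z c' / ((1 : ℤ) : ℂ)))‖, norm_nonneg _,
        fun w _ _ => ?_⟩
      rw [Function.update_of_ne hc]
      exact le_mul_of_one_le_right (norm_nonneg _) (Real.one_le_exp (by positivity))

theorem polyVal (Δ : ℝ) (P : MvPolynomial (Fin n) ℂ) : StripBounded Δ fun Z => MellinCycle.polyVal P Z := by
  simp only [MellinCycle.polyVal]
  induction P using MvPolynomial.induction_on with
  | C a => simpa only [MvPolynomial.eval_C] using const (n := n) Δ a
  | add p q hp hq =>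
    simpa only [map_add] using hp.add hq
  | mul_X p c hp =>
    simpa only [map_mul, MvPolynomial.eval_X] using hp.mul (exp_coord Δ c)

/-- The reciprocal of `Γ` at an affine form with real slopes. -/
theorem Gamma_inv (Δ : ℝ) {ℓ : (Fin n → ℂ) → ℂ} {t : Fin n → ℝ}
    (hℓ : ∀ Z c w, ℓ (Function.update Z c w) = ℓ (Function.update Z c 0) + t c * w) :
    StripBounded Δ fun Z => (Complex.Gamma (ℓ Z))⁻¹ := by
  refine ⟨fun Z c => ?_, Real.pi * ∑ c, |t c|, by positivity, fun Z c => ?_⟩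
  · rw [funext fun w => congrArg (fun s => (Complex.Gamma s)⁻¹) (hℓ Z c w)]
    exact Complex.differentiable_one_div_Gamma.comp (by fun_prop)
  · set β := ℓ (Function.update Z c 0)
    -- Since the slope is real, the strip `0 ≤ Re w ≤ Δ` is mapped into a vertical strip.
    obtain ⟨M, hM, h⟩ := Complex.norm_Gamma_inv_le_strip (β.re - |t c| * Δ) (β.re + |t c| * Δ)
    refine ⟨M * Real.exp (Real.pi * |β.im|), by positivity, fun w h0 hΔ => ?_⟩
    have hre : |t c * w.re| ≤ |t c| * Δ := by
      rw [abs_mul, abs_of_nonneg h0]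
      gcongr
    rw [abs_le] at hre
    have e1 : (β + t c * w).re = β.re + t c * w.re := by simp
    have e2 : (β + t c * w).im = β.im + t c * w.im := by simp
    rw [hℓ Z c w]
    refine (h _ (by rw [e1]; linarith) (by rw [e1]; linarith)).trans ?_
    rw [mul_assoc, ← Real.exp_add, e2]
    gcongr
    have h1 : |β.im + t c * w.im| ≤ |β.im| + |t c| * |w.im| := by
      rw [← abs_mul]
      exact abs_add_le _ _
    have h2 : |t c| ≤ ∑ c, |t c| :=
      Finset.single_le_sum (f := fun c => |t c|) (fun c _ => abs_nonneg _) (Finset.mem_univ c)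
    calc Real.pi * |β.im + t c * w.im| ≤ Real.pi * (|β.im| + (∑ c, |t c|) * |w.im|) := by
          have := Real.pi_pos.le
          gcongr
          exact h1.trans (by gcongr)
      _ = _ := by ring

theorem expKernel_update (Z : Fin n → ℂ) (c : Fin n) (w : ℂ) (x : Fin n → ℂ) :
    expKernel (Function.update Z c w) x =
      expKernel (Function.update Z c 0) x * Complex.exp (w * x c) := by
  rw [Function.update_eq_update_zero_add_single, expKernel_add]
  simp [expKernel, Pi.single_apply]

/-- A Laplace transform over a cube. -/
theorem integral_expKernel (Δ : ℝ) {φ : (Fin n → ℝ) → Fin n → ℂ} (hφ : Continuous φ)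
    {g : (Fin n → ℝ) → ℂ} (hg : ContinuousOn g (unitCube n)) :
    StripBounded Δ fun Z => ∫ t in unitCube n, expKernel Z (φ t) * g t := by
  have hK := isCompact_unitCube n
  have hcont : ∀ Z, ContinuousOn (fun t => expKernel Z (φ t) * g t) (unitCube n) := fun Z =>
    ((differentiable_expKernel Z).continuous.comp hφ).continuousOn.mul hg
  -- The variable `w` enters only through `exp (w * φ t c)`, and `φ` is bounded on the cube: this
  -- bound is the exponential type, independent of `Z`.
  have hform : ∀ Z c w t, expKernel (Function.update Z c w) (φ t) * g t =
      expKernel (Function.update Z c 0) (φ t) * g t * Complex.exp (w * φ t c) := by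
    intro Z c w t
    rw [expKernel_update]
    ring
  obtain ⟨R, hR⟩ := hK.exists_bound_of_continuousOn hφ.continuousOn
  refine ⟨fun Z c w₀ => ?_, max R 0, le_max_right _ _, fun Z c => ?_⟩
  · rw [funext fun w => integral_congr_ae (.of_forall (hform Z c w))]
    have h1 : ContinuousOn (fun p : ℂ × (Fin n → ℝ) => expKernel (Function.update Z c 0) (φ p.2) *
        g p.2 * Complex.exp (p.1 * φ p.2 c)) (univ ×ˢ unitCube n) := by
      refine ((hcont _).comp continuousOn_snd fun p hp => hp.2).mul (Continuous.continuousOn ?_)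
      fun_prop
    have h2 : ContinuousOn (fun p : ℂ × (Fin n → ℝ) => expKernel (Function.update Z c 0) (φ p.2) *
        g p.2 * Complex.exp (p.1 * φ p.2 c) * φ p.2 c) (univ ×ˢ unitCube n) :=
      h1.mul (Continuous.continuousOn (by fun_prop))
    refine (hasDerivAt_integral_unitCube (s := univ) (F := fun w t =>
      expKernel (Function.update Z c 0) (φ t) * g t * Complex.exp (w * φ t c)) (F' := fun w t =>
      expKernel (Function.update Z c 0) (φ t) * g t * Complex.exp (w * φ t c) * φ t c)
      Filter.univ_mem h1 h2
      fun w _ t _ => ?_).differentiableAt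
    have h3 := (((hasDerivAt_id w).mul_const (φ t c)).cexp).const_mul
      (expKernel (Function.update Z c 0) (φ t) * g t)
    simpa [mul_assoc] using h3
  · obtain ⟨M, hM⟩ := hK.exists_bound_of_continuousOn (hcont (Function.update Z c 0))
    refine ⟨max M 0 * Real.exp (max R 0 * Δ) * volume.real (unitCube n), by positivity,
      fun w h0 hw => ?_⟩
    have h1 : ∀ t ∈ unitCube n, ‖expKernel (Function.update Z c w) (φ t) * g t‖ ≤
        max M 0 * Real.exp (max R 0 * Δ) * Real.exp (max R 0 * |w.im|) := by
      intro t ht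
      have h2 : ‖φ t c‖ ≤ max R 0 := (norm_le_pi_norm _ c).trans ((hR t ht).trans (le_max_left _ _))
      rw [hform, norm_mul, mul_assoc, ← Real.exp_add, Complex.norm_exp]
      gcongr
      · exact (hM t ht).trans (le_max_left _ _)
      · calc (w * φ t c).re ≤ ‖w‖ * ‖φ t c‖ := (Complex.re_le_norm _).trans (norm_mul _ _).le
          _ ≤ (|w.re| + |w.im|) * max R 0 := by
            gcongr
            exact Complex.norm_le_abs_re_add_abs_im w
          _ ≤ (Δ + |w.im|) * max R 0 := by
            gcongr
            rwa [abs_of_nonneg h0]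
          _ = _ := by ring
    refine (norm_setIntegral_le_of_norm_le_const hK.measure_lt_top h1).trans (le_of_eq ?_)
    ring

open Function.Periodic in
/-- A periodic function is a trigonometric polynomial. -/
theorem exists_mvPolynomial {Δ : ℝ} (hΔ : 0 < Δ) (hf : StripBounded Δ f)
    (hper : ∀ Z c, f (Z + Pi.single c (Δ : ℂ)) = f Z) :
    ∃ (K : ℕ) (P : MvPolynomial (Fin n) ℂ), ∀ Z,
      f Z * ∏ c, qParam Δ (Z c) ^ K = MvPolynomial.eval (fun c => qParam Δ (Z c)) P := by
  obtain ⟨K₀, hK₀, hb⟩ := hf.bound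
  -- `K` depends only on the uniform type, so the degree bound `2 * K` holds on all coordinate
  -- lines, as interpolation requires. The nodes chosen below have `q`-values `1, 2, 3, …`.
  obtain ⟨K, hK⟩ := exists_nat_ge (K₀ * Δ / (2 * Real.pi))
  have hK' : K₀ ≤ 2 * Real.pi * K / Δ := by
    rw [div_le_iff₀ (by positivity)] at hK
    rw [le_div_iff₀ hΔ]
    linarith
  refine ⟨K, exists_mvPolynomial_of_separately (q := qParam Δ) (d := 2 * K)
    (x := fun t => invQParam Δ ((t : ℂ) + 1)) ?_
    (H := fun Z => f Z * ∏ c, qParam Δ (Z c) ^ K) fun Z c => ?_⟩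
  · intro s t hst
    simp only [qParam_right_inv hΔ.ne' (Nat.cast_add_one_ne_zero _)] at hst
    exact_mod_cast add_right_cancel hst
  · obtain ⟨M, hM, h⟩ := hb Z c
    obtain ⟨p, hp, he⟩ := exists_polynomial_of_periodic hΔ (K := K) (M := M) (hf.diff Z c)
      (fun w => by
        rw [← hper (Function.update Z c w) c]
        congr 1
        ext c'
        by_cases hc : c' = c
        · subst hc; simp
        · simp [hc])
      (fun w h0 hw => (h w h0 hw).trans (by gcongr))
    refine ⟨p * Polynomial.C (∏ c' ∈ Finset.univ.erase c, qParam Δ (Z c') ^ K),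
      (Polynomial.natDegree_mul_C_le _ _).trans hp, fun w => ?_⟩
    rw [Polynomial.eval_mul, Polynomial.eval_C, ← he,
      ← Finset.mul_prod_erase _ _ (Finset.mem_univ c), Function.update_self, ← mul_assoc]
    congr 1
    refine Finset.prod_congr rfl fun c' hc' => ?_
    rw [Function.update_of_ne (Finset.ne_of_mem_erase hc')]

end StripBounded

/-! ### Rationality of the periodic factor -/

namespace MellinCycle

variable {N k m : ℕ} {S : CISystem N k m} {i : Fin N → ℤ} {ζ : Fin k → ℂ} {C : MellinCycle S i ζ}
  {Δ : ℤ} {T : Matrix (PhaseVar N k m) S.Mono ℤ}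

open CISystem Function.Periodic

/-- The product of the denominators of the coefficients. -/
noncomputable def commonDen (C : MellinCycle S i ζ) (Z : Fin (k + m) → ℂ) : ℂ :=
  ∏ p, polyVal (C.den p) Z

/-- The Mellin transform multiplied by the product of the denominators. -/
noncomputable def clearedPairing (C : MellinCycle S i ζ) (Z : Fin (k + m) → ℂ) : ℂ :=
  ∑ p, polyVal (C.num p) Z * (∏ p' ∈ Finset.univ.erase p, polyVal (C.den p') Z) *
    ∫ t in unitCube (k + m), expKernel Z (C.map p t) *
      (C.J p (C.map p t) * cubeJacobian (C.map p) t)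

theorem commonDen_ne_zero {Z : Fin (k + m) → ℂ} : C.commonDen Z ≠ 0 ↔ C.Regular Z := by
  simp [commonDen, Regular, Finset.prod_ne_zero_iff]

theorem commonDen_add_single (C : MellinCycle S i ζ) (Z : Fin (k + m) → ℂ) (c : Fin (k + m))
    (d : ℤ) : C.commonDen (Z + Pi.single c (d : ℂ)) = C.commonDen Z := by
  simp only [commonDen, polyVal_add_single]

theorem clearedPairing_eq {Z : Fin (k + m) → ℂ} (hZ : C.Regular Z) :
    C.clearedPairing Z = C.commonDen Z * C.pairing Z C.J := by
  rw [clearedPairing, pairing, Finset.mul_sum]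
  refine Finset.sum_congr rfl fun p _ => ?_
  rw [commonDen, ← Finset.mul_prod_erase _ _ (Finset.mem_univ p), coef]
  simp only [mul_assoc]
  have := hZ p
  field_simp

theorem stripBounded_cleared (C : MellinCycle S i ζ) (T : Matrix (PhaseVar N k m) S.Mono ℤ)
    {Δ : ℤ} (hΔ : 0 < Δ) :
    StripBounded (Δ : ℝ) fun Z => C.commonDen Z * C.clearedPairing Z *
      ∏ a, (Complex.Gamma (S.linFormZ Δ T i ζ a Z))⁻¹ := by
  refine ((StripBounded.prod _ fun p => .polyVal _ _).mul (StripBounded.sum _ fun p =>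
    ((StripBounded.polyVal _ _).mul (.prod _ fun p' => .polyVal _ _)).mul
      (.integral_expKernel _ (C.smooth p).continuous
        ((continuousOn_comp_map p (C.admissible_J.diff p)).mul
          (continuous_cubeJacobian (C.smooth p)).continuousOn)))).mul
    (StripBounded.prod _ fun a => .Gamma_inv _ (t := fun c => (T (paramVar c) a : ℝ) / Δ)
      fun Z c w => ?_)
  have hΔ' : (Δ : ℂ) ≠ 0 := by exact_mod_cast hΔ.ne'
  have h : ∑ c', (T (paramVar c') a : ℂ) * Function.update Z c w c' =
      ∑ c', (T (paramVar c') a : ℂ) * Function.update Z c 0 c' + T (paramVar c) a * w := by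
    rw [Function.update_eq_update_zero_add_single]
    simp only [Pi.add_apply, mul_add, Finset.sum_add_distrib, Pi.single_apply]
    simp
  rw [linFormZ, linFormZ, h]
  push_cast
  field_simp
  ring

/-- At regular points this is `pairing_periodic`. The additional factor `commonDen` makes both sides
vanish at the other points, so periodicity holds everywhere without a continuity argument. -/
theorem cleared_periodic (h : S.IsScaledInverse Δ T) (hkm : 0 < k + m) (Z : Fin (k + m) → ℂ)
    (c : Fin (k + m)) :
    C.commonDen (Z + Pi.single c (Δ : ℂ)) * C.clearedPairing (Z + Pi.single c (Δ : ℂ)) *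
        ∏ a, (Complex.Gamma (S.linFormZ Δ T i ζ a (Z + Pi.single c (Δ : ℂ))))⁻¹ =
      C.commonDen Z * C.clearedPairing Z * ∏ a, (Complex.Gamma (S.linFormZ Δ T i ζ a Z))⁻¹ := by
  rw [commonDen_add_single]
  by_cases hZ : C.Regular Z
  · rw [clearedPairing_eq hZ, clearedPairing_eq (hZ.add_single c Δ), commonDen_add_single]
    linear_combination C.commonDen Z ^ 2 * pairing_periodic (C := C) h hkm c hZ
  · rw [← commonDen_ne_zero, not_not] at hZ
    simp [hZ]

/-- Since `exp (2πi Z)` is the `Δ`-th power of `exp (2πi Z / Δ)`, expanding by `Δ` rewrites the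
denominators of the cycle in the variables of `h`. -/
theorem eval_expand_qParam (hΔ : 0 < Δ) {n : ℕ} (P : MvPolynomial (Fin n) ℂ) (Z : Fin n → ℂ) :
    MvPolynomial.eval (fun c => qParam (Δ : ℝ) (Z c)) (MvPolynomial.expand Δ.toNat P) =
      polyVal P Z := by
  rw [MvPolynomial.eval_expand, polyVal]
  congr 2
  ext c
  have hΔ' : (Δ : ℂ) ≠ 0 := by exact_mod_cast hΔ.ne'
  have h : (Δ.toNat : ℂ) = Δ := by exact_mod_cast congrArg (Int.cast : ℤ → ℂ) (Int.toNat_of_nonneg hΔ.le)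
  rw [Pi.pow_apply, qParam, ← Complex.exp_nat_mul, h]
  congr 1
  push_cast
  field_simp

/-- The Mellin transform divided by the product of Gamma factors is a rational function of the
exponentials. -/
theorem exists_rational (h : S.IsScaledInverse Δ T) (hkm : 0 < k + m) (C : MellinCycle S i ζ) :
    ∃ P Q : MvPolynomial (Fin (k + m)) ℂ, Q ≠ 0 ∧ ∀ Z,
      MvPolynomial.eval (fun c => qParam (Δ : ℝ) (Z c)) Q ≠ 0 →
        C.pairing Z C.J * ∏ a, (Complex.Gamma (S.linFormZ Δ T i ζ a Z))⁻¹ =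
          MvPolynomial.eval (fun c => qParam (Δ : ℝ) (Z c)) P /
            MvPolynomial.eval (fun c => qParam (Δ : ℝ) (Z c)) Q := by
  obtain ⟨K, P, hP⟩ := (C.stripBounded_cleared T h.1).exists_mvPolynomial
    (by exact_mod_cast h.1) fun Z c => by simpa using cleared_periodic (C := C) h hkm Z c
  have hQ : ∀ Z : Fin (k + m) → ℂ, MvPolynomial.eval (fun c => qParam (Δ : ℝ) (Z c))
      ((∏ p, MvPolynomial.expand Δ.toNat (C.den p)) ^ 2 * ∏ c, MvPolynomial.X c ^ K) =
      C.commonDen Z ^ 2 * ∏ c, qParam (Δ : ℝ) (Z c) ^ K := by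
    intro Z
    simp only [map_mul, map_pow, map_prod, eval_expand_qParam h.1, MvPolynomial.eval_X, commonDen]
  -- The square accounts for clearing the denominators and for the additional `commonDen`; the
  -- powers of the variables clear the negative exponents of the Laurent polynomial.
  refine ⟨P, (∏ p, MvPolynomial.expand Δ.toNat (C.den p)) ^ 2 * ∏ c, MvPolynomial.X c ^ K,
    ?_, fun Z hZ => ?_⟩
  · refine mul_ne_zero (pow_ne_zero _ (Finset.prod_ne_zero_iff.2 fun p _ => ?_))
      (Finset.prod_ne_zero_iff.2 fun c _ => pow_ne_zero _ (MvPolynomial.X_ne_zero c))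
    exact (MvPolynomial.expand_ne_zero (by have := h.1; omega)).2 (C.den_ne_zero p)
  · rw [eq_div_iff hZ, ← hP]
    rw [hQ] at hZ ⊢
    have hreg : C.Regular Z :=
      commonDen_ne_zero.1 (pow_ne_zero_iff two_ne_zero |>.1 (left_ne_zero_of_mul hZ))
    rw [clearedPairing_eq hreg]
    ring

theorem expEval_eq_eval_qParam (P : MvPolynomial (Fin (k + m)) ℂ) (z : Fin k → ℂ)
    (z' : Fin m → ℂ) : expEval Δ P z z' =
      MvPolynomial.eval (fun c => qParam (Δ : ℝ) (Fin.append z z' c)) P := by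
  simp only [expEval, qParam, mul_div_assoc]
  norm_cast

end MellinCycle

theorem proposition2p1 {N k m : ℕ} (hk : 0 < k) (S : CISystem N k m) (hS : S.Nondegenerate) :
    ∃ (Δ : ℤ) (T : Matrix (PhaseVar N k m) S.Mono ℤ),
      -- `T = Δ · L⁻¹` is an integer matrix with coprime entries, and this determines `Δ` and `T`
      S.IsScaledInverse Δ T ∧
      (∀ (Δ' : ℤ) (T' : Matrix (PhaseVar N k m) S.Mono ℤ),
        S.IsScaledInverse Δ' T' → Δ' = Δ ∧ T' = T) ∧
      -- the Mellin transform is a `Δ`-periodic function times a product of Gamma factors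
      (∀ (i : Fin N → ℤ) (ζ : Fin k → ℂ) (C : MellinCycle S i ζ),
        ∃ P Q : MvPolynomial (Fin (k + m)) ℂ, Q ≠ 0 ∧
          ∀ (z : Fin k → ℂ) (z' : Fin m → ℂ), expEval Δ Q z z' ≠ 0 →
            (∀ (a : S.Mono) (n : ℕ), S.linForm Δ T a i z z' ζ ≠ -(n : ℂ)) →
            C.mellin z z' = expEval Δ P z z' / expEval Δ Q z z' *
              ∏ a : S.Mono, Complex.Gamma (S.linForm Δ T a i z z' ζ)) ∧
      -- the alternative for each linear form
      (∀ a : S.Mono,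
        (∃ l : Fin k, (∀ j, T (.inl (.inl j)) a = 0) ∧ (∀ j, T (.inl (.inr j)) a = 0) ∧
          (∀ l', T (.inr (.inl l')) a = if l' = l then Δ else 0) ∧
          (∀ l', T (.inr (.inr l')) a = 0) ∧
          ∀ (i : Fin N → ℤ) (z : Fin k → ℂ) (z' : Fin m → ℂ) (ζ : Fin k → ℂ),
            S.linForm Δ T a i z z' ζ = z l) ∨
        (∀ (i : Fin N → ℤ) (z : Fin k → ℂ) (z' : Fin m → ℂ) (ζ : Fin k → ℂ),
          S.linForm Δ T a i z z' ζ =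
            ((∑ j, (T (.inl (.inl j)) a : ℂ) * ((i j : ℂ) + 1))
              + (∑ j, (T (.inl (.inr j)) a : ℂ) * z' j)
              + ∑ l, (T (.inr (.inl l)) a : ℂ) * (z l - ζ l - 1)) / (Δ : ℂ))) ∧
      -- the column sums of `A`, `B` and `C` vanish
      (∀ j : Fin N, ∑ a : S.Mono, T (.inl (.inl j)) a = 0) ∧
      (∀ l : Fin k, ∑ a : S.Mono, T (.inr (.inl l)) a = 0) ∧
      (∀ j : Fin m, ∑ a : S.Mono, T (.inl (.inr j)) a = 0) ∧
      -- the sum of all the linear forms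
      (∀ (i : Fin N → ℤ) (z : Fin k → ℂ) (z' : Fin m → ℂ) (ζ : Fin k → ℂ),
        ∑ a : S.Mono, S.linForm Δ T a i z z' ζ = (∑ l, ζ l) + (k : ℂ)) := by
  obtain ⟨Δ, T, h⟩ := CISystem.exists_isScaledInverse hk hS
  refine ⟨Δ, T, h, fun Δ' T' h' => h.unique h', fun i ζ C => ?_, h.alternative, fun j => ?_,
    fun l => ?_, fun j => ?_, h.sum_linForm⟩
  · obtain ⟨P, Q, hQ, hPQ⟩ := C.exists_rational h (by omega)
    refine ⟨P, Q, hQ, fun z z' hz hpole => ?_⟩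
    rw [MellinCycle.expEval_eq_eval_qParam] at hz
    rw [MellinCycle.expEval_eq_eval_qParam, MellinCycle.expEval_eq_eval_qParam, ← hPQ _ hz,
      MellinCycle.mellin_eq_pairing, mul_assoc, ← Finset.prod_mul_distrib]
    -- Away from the non-positive integers `Γ` does not vanish, so it cancels against its
    -- reciprocal.
    rw [Finset.prod_eq_one fun a _ => ?_, mul_one]
    rw [← CISystem.linForm_eq_linFormZ]
    exact inv_mul_cancel₀ (Complex.Gamma_ne_zero (hpole a))
  · rw [h.row_sum]; simp
  · rw [h.row_sum]; simp
  · rw [h.row_sum]; simp
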